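/- Let $\mathbb N=\{1,2,3,\dots\}$ and let the scalar field be $\mathbb R$ or $\mathbb C$. For finite sets $E,F\subset\mathbb N$ write $E<F$ if $m<n$ for all $m\in E$, $n\in F$, and $n\le E$ if $n\le k$ for all $k\in E$. The Schreier families are given by $\mathcal S_0=\{E:|E|\le 1\}$, $$\mathcal S_{\xi+1}=\{\varnothing\}\cup\Big\{\bigcup_{i=1}^nE_i:\ \varnothing\ne E_i\in\mathcal S_\xi,\ n\le E_1,\ E_1<\dots<E_n\Big\},$$ and, for a countable limit ordinal $\xi$, $\mathcal S_\xi=\{E:\exists n\le E\in\mathcal S_{\xi_n+1}\}$, where $\xi_n\uparrow\xi$ is a fixed strictly increasing sequence such that $\mathcal S_{\xi_n+1}\subset\mathcal S_{\xi_{n+1}}$ for all $n$ (any such choice of sequences is allowed). For $x=(x(n))_n$ let $\|Ex\|_{\ell_1}=\sum_{n\in E}|x(n)|$. For $\xi<\omega_1$ put $\|x\|_\xi=\|x\|_{\xi,\infty}=\sup\{\|Ex\|_{\ell_1}:E\in\mathcal S_\xi\}$ and, for $1<p<\infty$, $\|x\|_{\xi,p}=\sup\{(\sum_i\|E_ix\|_{\ell_1}^p)^{1/p}:E_1<E_2<\cdots,\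 E_i\in\mathcal S_\xi\}$, with the sets $E_i$ pairwise successive. $X_{\xi,p}$ is the completion of $c_{00}$ in $\|\cdot\|_{\xi,p}$, regarded as a space of scalar sequences, and its canonical basis is the sequence of unit vectors. A sequence $(x_n)$ in a Banach space is an $\ell_1^\xi$-spreading model if $0<\inf_n\|x_n\|\le\sup_n\|x_n\|<\infty$ and there is $c>0$ with $\|\sum_{n\in F}a_nx_n\|\ge c$ whenever $F\in\mathcal S_\xi$ and $\sum_{n\in F}|a_n|=1$. It is $\xi$-weakly null if it is weakly null and has no subsequence that is an $\ell_1^\xi$-spreading model. It is WUC if $\sum_n|f(x_n)|<\infty$ for every bounded linear functional $f$. Sequences $(x_n)$ and $(y_n)$ are equivalent if there are $c,C>0$ with $c\|\sum a_ny_n\|\le\|\sum a_nx_n\|\le C\|\sum a_ny_n\|$ for all finitely supported scalars $(a_n)$. For $\gamma\le\xi$, $\xi-\gamma$ is the ordinal $\delta$ with $\gamma+\delta=\xi$. Let $\lambda(0)=0$, and for $\xi>0$ let $\lambda(\xi)=\omega^{\varepsilon_1}$, where $\varepsilon_1$ is the largest exponent in the Cantor normal form of $\xi$. **Theorem.** Let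 $\xi<\omega_1$, $1<p\le\infty$, let $(x_n)_{n=1}^\infty$ be a weakly null sequence in $X_{\xi,p}$, and let $\Gamma=\{\zeta\le\xi:\limsup_n\|x_n\|_\zeta>0\}$. 1. If $p=\infty$, then $\Gamma=\varnothing$ if and only if $(x_n)$ is norm null. 2. If $p<\infty$ and $\Gamma=\varnothing$, then either $(x_n)$ is norm null or $(x_n)$ has a subsequence equivalent to the canonical $\ell_p$ basis. 3. If $\Gamma\ne\varnothing$ and $\gamma=\min\Gamma$, then $(x_n)$ has a subsequence equivalent to a subsequence of the canonical basis of $X_{\xi-\gamma,p}$. Moreover, $(x_n)$ is $((\xi-\gamma)+1)$-weakly null and not $(\xi-\gamma)$-weakly null. 4. If $p=\infty$, then every subsequence of $(x_n)$ has a further subsequence that is WUC if and only if $\Gamma\subset\{\xi\}$. 5. If $\xi>0$, then $(x_n)$ is $\xi$-weakly null if and only if $\lim_n\|x_n\|_\beta=0$ for every $\beta<\lambda(\xi)$. -/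

import Mathlib

open Order Filter Topology
open scoped ENNReal Ordinal

noncomputable section

/-! Sets of positive integers and Schreier families. The set of natural numbers is `{1, 2, 3, …}`
throughout, that is `ℕ+`. -/

/-- `E < F`: every element of `E` is smaller than every element of `F` (vacuously true if one of
the two sets is empty). -/
def SetLT (E F : Finset ℕ+) : Prop := ∀ m ∈ E, ∀ n ∈ F, m < n

/-- The family of the sets `E₁ ∪ … ∪ Eₙ` with `∅ ≠ Eᵢ ∈ 𝓕`, `E₁ < … < Eₙ` and `n ≤ E₁`
(for `n = 0` this is the empty set). -/
def schreierSucc (𝓕 : Set (Finset ℕ+)) : Set (Finset ℕ+) :=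
  {E | ∃ (n : ℕ) (G : Fin n → Finset ℕ+),
    (∀ i, (G i).Nonempty) ∧ (∀ i, G i ∈ 𝓕) ∧ (∀ i j, i < j → SetLT (G i) (G j)) ∧
    (∀ i, ∀ k ∈ G i, n ≤ (k : ℕ)) ∧ E = Finset.univ.biUnion G}

/-- The Schreier families `𝓢_ξ` that belong to an assignment `a` of a sequence `(a l n)ₙ` of
ordinals below `l` to each limit ordinal `l`: `𝓢_0` consists of the sets with at most one element,
`𝓢_{ξ+1}` is obtained by `schreierSucc`, and, for a limit ordinal `l`,
`𝓢_l = {E | ∃ n, n ≤ E ∈ 𝓢_{a l n + 1}}`. -/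
def schreierFamily (a : Ordinal.{0} → ℕ+ → Ordinal.{0}) (ξ : Ordinal.{0}) : Set (Finset ℕ+) :=
  Ordinal.limitRecOn ξ
    {E | E.card ≤ 1}
    (fun _ 𝓕 => schreierSucc 𝓕)
    (fun l _ 𝓕 => {E | ∃ n : ℕ+, (∀ k ∈ E, n ≤ k) ∧ ∃ h : a l n + 1 < l, E ∈ 𝓕 (a l n + 1) h})

theorem schreierFamily_zero (a : Ordinal.{0} → ℕ+ → Ordinal.{0}) :
    schreierFamily a 0 = {E | E.card ≤ 1} := by
  unfold schreierFamily
  rw [Ordinal.limitRecOn_zero]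

theorem schreierFamily_add_one (a : Ordinal.{0} → ℕ+ → Ordinal.{0}) (ξ : Ordinal.{0}) :
    schreierFamily a (ξ + 1) = schreierSucc (schreierFamily a ξ) := by
  unfold schreierFamily
  rw [Ordinal.limitRecOn_add_one]

theorem schreierFamily_limit (a : Ordinal.{0} → ℕ+ → Ordinal.{0}) {l : Ordinal.{0}}
    (hl : IsSuccLimit l) (ha : ∀ n, a l n < l) :
    schreierFamily a l =
      {E | ∃ n : ℕ+, (∀ k ∈ E, n ≤ k) ∧ E ∈ schreierFamily a (a l n + 1)} := by
  unfold schreierFamily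
  rw [Ordinal.limitRecOn_limit _ _ _ _ hl]
  ext E
  constructor
  · rintro ⟨n, hn, _, hE⟩
    exact ⟨n, hn, hE⟩
  · rintro ⟨n, hn, hE⟩
    exact ⟨n, hn, hl.add_one_lt (ha n), hE⟩

/-- The sequences that define the Schreier families at limit ordinals: for each countable limit
ordinal `l` a sequence `seq l n ↑ l` with `𝓢_{seq l n + 1} ⊆ 𝓢_{seq l (n+1)}` for all `n`.
(The values at uncountable limit ordinals play no role.) -/
structure SchreierSystem where
  seq : Ordinal.{0} → ℕ+ → Ordinal.{0}
  seq_lt : ∀ l, IsSuccLimit l → ∀ n, seq l n < l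
  strictMono : ∀ l, IsSuccLimit l → l < ω₁ → StrictMono (seq l)
  exists_lt : ∀ l, IsSuccLimit l → l < ω₁ → ∀ η < l, ∃ n, η < seq l n
  subset : ∀ l, IsSuccLimit l → l < ω₁ → ∀ n,
    schreierFamily seq (seq l n + 1) ⊆ schreierFamily seq (seq l (n + 1))

/-- The Schreier family `𝓢_ξ`. -/
def SchreierSystem.family (S : SchreierSystem) (ξ : Ordinal.{0}) : Set (Finset ℕ+) :=
  schreierFamily S.seq ξ

/-! Existence of a Schreier system. -/

theorem schreierSucc_of_pieces {𝓕 : Set (Finset ℕ+)} {n : ℕ} (H : Fin n → Finset ℕ+)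
    (hF : ∀ i, (H i).Nonempty → H i ∈ 𝓕) (hlt : ∀ i j, i < j → SetLT (H i) (H j))
    (hn : ∀ i, ∀ k ∈ H i, n ≤ (k : ℕ)) : Finset.univ.biUnion H ∈ schreierSucc 𝓕 := by
  classical
  set I : Finset (Fin n) := Finset.univ.filter (fun i => (H i).Nonempty) with hI
  have hIn : I.card ≤ n := by simpa using Finset.card_le_univ I
  have hmem : ∀ j, (H (I.orderIsoOfFin rfl j)).Nonempty := fun j =>
    (Finset.mem_filter.1 (I.orderIsoOfFin rfl j).2).2
  refine ⟨I.card, fun j => H (I.orderIsoOfFin rfl j), hmem, fun j => hF _ (hmem j), ?_, ?_, ?_⟩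
  · intro i j hij
    exact hlt _ _ ((I.orderIsoOfFin rfl).strictMono hij)
  · intro i k hk
    exact hIn.trans (hn _ k hk)
  · ext k
    simp only [Finset.mem_biUnion, Finset.mem_univ, true_and]
    constructor
    · rintro ⟨i, hi⟩
      have : i ∈ I := by simp [hI]; exact ⟨k, hi⟩
      refine ⟨(I.orderIsoOfFin rfl).symm ⟨i, this⟩, ?_⟩
      simpa using hi
    · rintro ⟨j, hj⟩
      exact ⟨_, hj⟩

theorem subset_schreierSucc (𝓕 : Set (Finset ℕ+)) : 𝓕 ⊆ schreierSucc 𝓕 := by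
  intro E hE
  have := schreierSucc_of_pieces (𝓕 := 𝓕) (n := 1) (fun _ => E) (fun _ _ => hE)
    (fun i j hij => by omega) (fun _ k _ => k.pos)
  simpa using this

theorem union_mem_schreierSucc {𝓕 : Set (Finset ℕ+)} {A B : Finset ℕ+} (hA : A ∈ 𝓕) (hB : B ∈ 𝓕)
    (hAB : SetLT A B) (h2 : ∀ k ∈ A ∪ B, 2 ≤ (k : ℕ)) : A ∪ B ∈ schreierSucc 𝓕 := by
  have := schreierSucc_of_pieces (𝓕 := 𝓕) (n := 2) ![A, B]
    (fun i _ => by fin_cases i <;> simpa) (fun i j hij => by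
      fin_cases i <;> fin_cases j <;> simp_all)
    (fun i k hk => by fin_cases i <;> simp at hk <;> exact h2 k (by simp [hk]))
  have hU : Finset.univ.biUnion ![A, B] = A ∪ B := by
    ext k; simp [Fin.exists_fin_two]
  rwa [hU] at this

theorem schreierFamily_singleton (a : Ordinal.{0} → ℕ+ → Ordinal.{0})
    (ha : ∀ l, IsSuccLimit l → ∀ n, a l n < l) (ξ : Ordinal.{0}) (E : Finset ℕ+)
    (hE : E.card ≤ 1) : E ∈ schreierFamily a ξ := by
  induction ξ using WellFoundedLT.induction with
  | ind ξ ih =>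
  rcases Ordinal.zero_or_succ_or_isSuccLimit ξ with rfl | ⟨η, rfl⟩ | hl
  · rw [schreierFamily_zero]; exact hE
  · rw [succ_eq_add_one, schreierFamily_add_one]
    exact subset_schreierSucc _ (ih η (lt_succ η))
  · rw [schreierFamily_limit a hl (ha ξ hl)]
    exact ⟨1, fun k _ => one_le, ih _ (hl.add_one_lt (ha ξ hl 1))⟩

theorem schreierFamily_hereditary (a : Ordinal.{0} → ℕ+ → Ordinal.{0})
    (ha : ∀ l, IsSuccLimit l → ∀ n, a l n < l) (ξ : Ordinal.{0}) (E F : Finset ℕ+)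
    (hF : F ∈ schreierFamily a ξ) (hE : E ⊆ F) : E ∈ schreierFamily a ξ := by
  induction ξ using WellFoundedLT.induction generalizing E F with
  | ind ξ ih =>
  rcases Ordinal.zero_or_succ_or_isSuccLimit ξ with rfl | ⟨η, rfl⟩ | hl
  · rw [schreierFamily_zero] at hF ⊢
    exact (Finset.card_le_card hE).trans hF
  · rw [succ_eq_add_one, schreierFamily_add_one] at hF ⊢
    obtain ⟨n, G, -, hG, hlt, hn, rfl⟩ := hF
    have := schreierSucc_of_pieces (𝓕 := schreierFamily a η) (fun i => G i ∩ E)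
      (fun i _ => ih η (lt_succ η) _ _ (hG i) Finset.inter_subset_left)
      (fun i j hij x hx y hy => hlt i j hij x (Finset.mem_inter.1 hx).1 y (Finset.mem_inter.1 hy).1)
      (fun i k hk => hn i k (Finset.mem_inter.1 hk).1)
    rwa [← Finset.biUnion_inter, Finset.inter_eq_right.2 hE] at this
  · rw [schreierFamily_limit a hl (ha ξ hl)] at hF ⊢
    obtain ⟨n, hn, hF⟩ := hF
    exact ⟨n, fun k hk => hn k (hE hk), ih _ (hl.add_one_lt (ha ξ hl n)) _ _ hF hE⟩

theorem schreierFamily_one_mem (a : Ordinal.{0} → ℕ+ → Ordinal.{0})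
    (ha : ∀ l, IsSuccLimit l → ∀ n, a l n < l) (ξ : Ordinal.{0}) (E : Finset ℕ+)
    (hE : E ∈ schreierFamily a ξ) (h1 : 1 ∈ E) : E.card ≤ 1 := by
  induction ξ using WellFoundedLT.induction generalizing E with
  | ind ξ ih =>
  rcases Ordinal.zero_or_succ_or_isSuccLimit ξ with rfl | ⟨η, rfl⟩ | hl
  · rw [schreierFamily_zero] at hE
    exact hE
  · rw [succ_eq_add_one, schreierFamily_add_one] at hE
    obtain ⟨n, G, -, hG, hlt, hn, rfl⟩ := hE
    obtain ⟨i, -, hi⟩ := Finset.mem_biUnion.1 h1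
    have hn1 : n ≤ 1 := hn i 1 hi
    have : Finset.univ.biUnion G = G i := by
      ext k
      simp only [Finset.mem_biUnion, Finset.mem_univ, true_and]
      constructor
      · rintro ⟨j, hj⟩
        have : j = i := by ext; omega
        rwa [this] at hj
      · exact fun h => ⟨i, h⟩
    rw [this]
    exact ih η (lt_succ η) _ (hG i) hi
  · rw [schreierFamily_limit a hl (ha ξ hl)] at hE
    obtain ⟨n, hn, hE⟩ := hE
    exact ih _ (hl.add_one_lt (ha ξ hl n)) _ hE h1

theorem schreierFamily_almost_mono (a : Ordinal.{0} → ℕ+ → Ordinal.{0})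
    (ha : ∀ l, IsSuccLimit l → ∀ n, a l n < l) (κ : Ordinal.{0})
    (hc : ∀ l < κ, IsSuccLimit l → ∀ η < l, ∃ n, η < a l n) (α β : Ordinal.{0}) (hβ : β < κ)
    (hαβ : α ≤ β) : ∃ m : ℕ+, ∀ E ∈ schreierFamily a α, (∀ k ∈ E, m ≤ k) →
      E ∈ schreierFamily a β := by
  induction β using WellFoundedLT.induction with
  | ind β ih =>
  rcases hαβ.eq_or_lt with rfl | hlt
  · exact ⟨1, fun E hE _ => hE⟩
  rcases Ordinal.zero_or_succ_or_isSuccLimit β with rfl | ⟨η, rfl⟩ | hl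
  · exact absurd hlt (not_lt_bot)
  · obtain ⟨m, hm⟩ := ih η (lt_succ η) ((lt_succ η).trans hβ) (lt_succ_iff.1 hlt)
    refine ⟨m, fun E hE hk => ?_⟩
    rw [succ_eq_add_one, schreierFamily_add_one]
    exact subset_schreierSucc _ (hm E hE hk)
  · obtain ⟨n, hn⟩ := hc β hβ hl α hlt
    have hlt' := hl.add_one_lt (ha β hl n)
    obtain ⟨m, hm⟩ := ih _ hlt' (hlt'.trans hβ) (hn.le.trans (by simp))
    refine ⟨max m n, fun E hE hk => ?_⟩
    rw [schreierFamily_limit a hl (ha β hl)]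
    exact ⟨n, fun k h => (le_max_right _ _).trans (hk k h),
      hm E hE fun k h => (le_max_left _ _).trans (hk k h)⟩

theorem schreierFamily_subset_add_nat (a : Ordinal.{0} → ℕ+ → Ordinal.{0})
    (ha : ∀ l, IsSuccLimit l → ∀ n, a l n < l) (κ : Ordinal.{0})
    (hc : ∀ l < κ, IsSuccLimit l → ∀ η < l, ∃ n, η < a l n) (α β : Ordinal.{0}) (hβ : β < κ)
    (hαβ : α ≤ β) : ∃ j : ℕ, schreierFamily a α ⊆ schreierFamily a (β + j) := by
  obtain ⟨m, hm⟩ := schreierFamily_almost_mono a ha κ hc α β hβ hαβ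
  have key : ∀ (j : ℕ) (E : Finset ℕ+), (∀ k ∈ E, 2 ≤ (k : ℕ)) →
      (E.filter (· < m)).card ≤ j → E.filter (m ≤ ·) ∈ schreierFamily a β →
      E ∈ schreierFamily a (β + j) := by
    intro j
    induction j with
    | zero =>
      intro E _ h0 hE
      have : E.filter (m ≤ ·) = E := by
        rw [Finset.filter_eq_self]
        intro k hk
        by_contra hlt
        have : k ∈ E.filter (· < m) := Finset.mem_filter.2 ⟨hk, not_le.1 hlt⟩
        rw [Finset.card_eq_zero.1 (Nat.le_zero.1 h0)] at this
        simp at this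
      rw [this] at hE
      simpa using hE
    | succ j ih =>
      intro E h2 hj hE
      have hs : schreierFamily a (β + (j + 1 : ℕ)) = schreierSucc (schreierFamily a (β + j)) := by
        rw [← schreierFamily_add_one, Nat.cast_add, Nat.cast_one, add_assoc]
      rw [hs]
      by_cases hne : (E.filter (· < m)).Nonempty
      · obtain ⟨y, hy⟩ := hne
        have hEne : E.Nonempty := ⟨y, (Finset.mem_filter.1 hy).1⟩
        set x := E.min' hEne with hx
        have hxE : x ∈ E := E.min'_mem hEne
        have hxm : x < m := (E.min'_le y (Finset.mem_filter.1 hy).1).trans_lt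
          (Finset.mem_filter.1 hy).2
        have hE' : E.erase x ∈ schreierFamily a (β + j) := by
          refine ih _ (fun k hk => h2 k (Finset.mem_of_mem_erase hk)) ?_ ?_
          · rw [Finset.filter_erase, Finset.card_erase_of_mem (by simp [hxE, hxm])]
            omega
          · exact schreierFamily_hereditary a ha _ _ _ hE
              (Finset.filter_subset_filter _ (Finset.erase_subset _ _))
        have := union_mem_schreierSucc
          (schreierFamily_singleton a ha (β + j) {x} (by simp)) hE'
          (fun u hu v hv => by
            rw [Finset.mem_singleton] at hu
            subst hu
            exact lt_of_le_of_ne (E.min'_le v (Finset.mem_of_mem_erase hv))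
              (Finset.ne_of_mem_erase hv).symm)
          (fun k hk => h2 k (by
            rcases Finset.mem_union.1 hk with h | h
            · rw [Finset.mem_singleton] at h; rwa [h]
            · exact Finset.mem_of_mem_erase h))
        rwa [← Finset.insert_eq, Finset.insert_erase hxE] at this
      · refine subset_schreierSucc _ (ih E h2 ?_ hE)
        rw [Finset.not_nonempty_iff_eq_empty.1 hne]
        simp
  refine ⟨m, fun E hE => ?_⟩
  by_cases h1 : 1 ∈ E
  · exact schreierFamily_singleton a ha _ E (schreierFamily_one_mem a ha α E hE h1)
  · refine key m E (fun k hk => ?_) ?_ ?_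
    · have : k ≠ 1 := fun h => h1 (h ▸ hk)
      have h' : (k : ℕ) ≠ 1 := fun h => this (PNat.coe_eq_one_iff.1 h)
      have := k.pos
      omega
    · have : E.filter (· < m) ⊆ Finset.Iio m := fun k hk => by
        simpa using (Finset.mem_filter.1 hk).2
      refine (Finset.card_le_card this).trans ?_
      have h3 : ((Finset.Iio m).map ⟨PNat.val, PNat.coe_injective⟩) ⊆ Finset.range m := by
        intro k hk
        obtain ⟨q, hq, rfl⟩ := Finset.mem_map.1 hk
        simpa using hq
      simpa using Finset.card_le_card h3
    · exact hm _ (schreierFamily_hereditary a ha _ _ _ hE (Finset.filter_subset _ _))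
        (fun k hk => (Finset.mem_filter.1 hk).2)

theorem schreierFamily_congr (a b : Ordinal.{0} → ℕ+ → Ordinal.{0})
    (ha : ∀ l, IsSuccLimit l → ∀ n, a l n < l) (hb : ∀ l, IsSuccLimit l → ∀ n, b l n < l)
    (ξ : Ordinal.{0}) (hab : ∀ l ≤ ξ, a l = b l) : schreierFamily a ξ = schreierFamily b ξ := by
  induction ξ using WellFoundedLT.induction with
  | ind ξ ih =>
  rcases Ordinal.zero_or_succ_or_isSuccLimit ξ with rfl | ⟨η, rfl⟩ | hl
  · rw [schreierFamily_zero, schreierFamily_zero]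
  · rw [succ_eq_add_one, schreierFamily_add_one, schreierFamily_add_one,
      ih η (lt_succ η) fun l hlη => hab l (hlη.trans (le_succ η))]
  · rw [schreierFamily_limit a hl (ha ξ hl), schreierFamily_limit b hl (hb ξ hl), hab ξ le_rfl]
    ext E
    refine exists_congr fun n => and_congr_right fun _ => ?_
    have hlt := hl.add_one_lt (hb ξ hl n)
    rw [ih _ hlt fun l hl' => hab l (hl'.trans hlt.le)]

/-- The conditions on a sequence that is used at the limit ordinal `l`. -/
def IsSchreierSeq (a : Ordinal.{0} → ℕ+ → Ordinal.{0}) (l : Ordinal.{0})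
    (s : ℕ+ → Ordinal.{0}) : Prop :=
  (∀ n, s n < l) ∧ StrictMono s ∧ (∀ η < l, ∃ n, η < s n) ∧
    ∀ n, schreierFamily a (s n + 1) ⊆ schreierFamily a (s (n + 1))

theorem exists_isSchreierSeq (a : Ordinal.{0} → ℕ+ → Ordinal.{0})
    (ha : ∀ l, IsSuccLimit l → ∀ n, a l n < l) (κ : Ordinal.{0}) (hκ : IsSuccLimit κ)
    (hκ1 : κ < ω₁) (hc : ∀ l < κ, IsSuccLimit l → ∀ η < l, ∃ n, η < a l n) :
    ∃ s, IsSchreierSeq a κ s := by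
  have hcount : Countable (Set.Iio κ) := by
    rw [← Cardinal.mk_le_aleph0_iff, Cardinal.mk_Iio_ordinal, Cardinal.lift_le_aleph0]
    rw [← Cardinal.ord_aleph, Cardinal.lt_ord, ← Cardinal.succ_aleph0, lt_succ_iff] at hκ1
    exact hκ1
  have hne : Nonempty (Set.Iio κ) := ⟨⟨0, hκ.bot_lt⟩⟩
  obtain ⟨f, hf⟩ := exists_surjective_nat (Set.Iio κ)
  have hstep : ∀ (x y : Set.Iio κ), ∃ z : Set.Iio κ, (y : Ordinal) ≤ z ∧ (x : Ordinal) < z ∧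
      schreierFamily a ((x : Ordinal) + 1) ⊆ schreierFamily a z := by
    intro x y
    have hx1 : (x : Ordinal) + 1 < κ := hκ.add_one_lt x.2
    have hmax : max (y : Ordinal) (x + 1) < κ := max_lt y.2 hx1
    obtain ⟨j, hj⟩ := schreierFamily_subset_add_nat a ha κ hc (x + 1) _ hmax (le_max_right _ _)
    refine ⟨⟨_, hκ.add_natCast_lt hmax j⟩, ?_, ?_, hj⟩
    · exact (le_max_left _ _).trans le_self_add
    · exact (lt_add_one (x : Ordinal)).trans_le ((le_max_right _ _).trans le_self_add)
  choose g hg1 hg2 hg3 using hstep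
  let t : ℕ → Set.Iio κ := fun n => Nat.rec (f 0) (fun i x => g x (f (i + 1))) n
  have ht : ∀ i, t (i + 1) = g (t i) (f (i + 1)) := fun i => rfl
  have htmono : StrictMono t := strictMono_nat_of_lt_succ fun i => by
    rw [ht]; exact hg2 _ _
  have hft : ∀ i, f i ≤ t i := by
    intro i
    cases i with
    | zero => exact le_rfl
    | succ i => rw [ht]; exact hg1 _ _
  let s : ℕ+ → Ordinal.{0} := fun n => (t n.natPred).1
  refine ⟨s, fun n => (t n.natPred).2, ?_, ?_, ?_⟩
  · intro m n hmn
    exact htmono (PNat.natPred_lt_natPred.2 hmn)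
  · intro η hη
    obtain ⟨i, hi⟩ := hf ⟨η + 1, hκ.add_one_lt hη⟩
    refine ⟨i.succPNat, ?_⟩
    change η < (t i.succPNat.natPred).1
    rw [Nat.natPred_succPNat]
    have := hft i
    rw [hi] at this
    exact (lt_add_one η).trans_le this
  · intro n
    have : (n + 1).natPred = n.natPred + 1 := by
      have := n.pos
      simp [PNat.natPred]
      omega
    simp only [s, this, ht]
    exact hg3 _ _

instance : Nonempty SchreierSystem := by
  classical
  let step : ∀ l : Ordinal.{0}, (∀ l', l' < l → ℕ+ → Ordinal.{0}) → ℕ+ → Ordinal.{0} :=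
    fun l r => if h : ∃ s, IsSchreierSeq (fun l' => if h : l' < l then r l' h else fun _ => 0) l s
      then h.choose else fun _ => 0
  let a : Ordinal.{0} → ℕ+ → Ordinal.{0} := fun l =>
    WellFoundedLT.fix (motive := fun _ => ℕ+ → Ordinal.{0}) step l
  let b : Ordinal.{0} → Ordinal.{0} → ℕ+ → Ordinal.{0} :=
    fun l l' => if l' < l then a l' else fun _ => 0
  have hstep : ∀ l, a l = if h : ∃ s, IsSchreierSeq (b l) l s then h.choose else fun _ => 0 := by
    intro l
    have := WellFoundedLT.fix_eq (motive := fun _ => ℕ+ → Ordinal.{0}) step l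
    simpa [step, a, b] using this
  have ha : ∀ l, IsSuccLimit l → ∀ n, a l n < l := by
    intro l hl n
    rw [hstep]
    split_ifs with h
    · exact h.choose_spec.1 n
    · exact hl.bot_lt
  have hb : ∀ l l', IsSuccLimit l' → ∀ n, b l l' n < l' := by
    intro l l' hl' n
    simp only [b]
    split_ifs
    · exact ha l' hl' n
    · exact hl'.bot_lt
  have hmain : ∀ l, IsSuccLimit l → l < ω₁ → IsSchreierSeq (b l) l (a l) := by
    intro l
    induction l using WellFoundedLT.induction with
    | ind l ih =>
    intro hl hl1
    have hex : ∃ s, IsSchreierSeq (b l) l s := by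
      refine exists_isSchreierSeq (b l) (hb l) l hl hl1 fun l' hl' hlim η hη => ?_
      have := (ih l' hl' hlim (hl'.trans hl1)).2.2.1 η hη
      simpa [b, hl'] using this
    rw [hstep, dif_pos hex]
    exact hex.choose_spec
  have hab : ∀ l η, η < l → schreierFamily (b l) η = schreierFamily a η := fun l η hη =>
    schreierFamily_congr _ _ (hb l) ha η fun l' hl' => by simp [b, hl'.trans_lt hη]
  refine ⟨⟨a, ha, fun l hl h1 => (hmain l hl h1).2.1, fun l hl h1 => (hmain l hl h1).2.2.1,
    fun l hl h1 n => ?_⟩⟩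
  have := (hmain l hl h1).2.2.2 n
  rwa [hab l _ (hl.add_one_lt (ha l hl n)), hab l _ (ha l hl (n + 1))] at this

/-! Schreier and Baernstein spaces. -/

/-- The aggregation `(∑ᵢ tᵢ ^ p) ^ (1/p)` for `p < ∞`. -/
def powSum (p : ℝ≥0∞) (t : ℕ → ℝ≥0∞) : ℝ≥0∞ := (∑' i, t i ^ p.toReal) ^ (1 / p.toReal)

section

variable {𝕜 : Type*} [RCLike 𝕜]

/-- The (possibly infinite) norm of a scalar sequence `x` given by the family `𝓕`: for `p = ∞` it
is `sup {‖Ex‖_{ℓ₁} : E ∈ 𝓕}`, for `p < ∞` it is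
`sup {(∑ᵢ ‖Eᵢx‖_{ℓ₁} ^ p) ^ (1/p) : E₁ < E₂ < …, Eᵢ ∈ 𝓕}`, where `‖Ex‖_{ℓ₁} = ∑_{n ∈ E} |x n|`. -/
def familyENorm (𝓕 : Set (Finset ℕ+)) (p : ℝ≥0∞) (x : ℕ+ → 𝕜) : ℝ≥0∞ :=
  if p = ∞ then ⨆ E ∈ 𝓕, ∑ n ∈ E, ‖x n‖ₑ
  else ⨆ (E : ℕ → Finset ℕ+) (_ : ∀ i, E i ∈ 𝓕) (_ : ∀ i j, i < j → SetLT (E i) (E j)),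
    powSum p fun i => ∑ n ∈ E i, ‖x n‖ₑ

theorem powSum_le_iff {p : ℝ≥0∞} (hp : 1 ≤ p) (hp' : p ≠ ∞) (t : ℕ → ℝ≥0∞) (c : ℝ≥0∞) :
    powSum p t ≤ c ↔ ∀ s : Finset ℕ, (∑ i ∈ s, t i ^ p.toReal) ^ (1 / p.toReal) ≤ c := by
  have hpos : 0 < p.toReal := ENNReal.toReal_pos (by positivity) hp'
  unfold powSum
  simp only [one_div, ENNReal.rpow_inv_le_iff hpos]
  rw [ENNReal.tsum_eq_iSup_sum, iSup_le_iff]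

theorem powSum_mono {p : ℝ≥0∞} {t u : ℕ → ℝ≥0∞} (h : ∀ i, t i ≤ u i) :
    powSum p t ≤ powSum p u := by
  unfold powSum
  gcongr with i
  exact h i

theorem powSum_add_le {p : ℝ≥0∞} (hp : 1 ≤ p) (hp' : p ≠ ∞) (t u : ℕ → ℝ≥0∞) :
    powSum p (fun i => t i + u i) ≤ powSum p t + powSum p u := by
  have h1 : 1 ≤ p.toReal := by simpa using ENNReal.toReal_mono hp' hp
  rw [powSum_le_iff hp hp']
  intro s
  refine (ENNReal.Lp_add_le s t u h1).trans ?_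
  exact add_le_add ((powSum_le_iff hp hp' t _).1 le_rfl s) ((powSum_le_iff hp hp' u _).1 le_rfl s)

theorem powSum_mul {p : ℝ≥0∞} (hp : 1 ≤ p) (hp' : p ≠ ∞) (c : ℝ≥0∞) (t : ℕ → ℝ≥0∞) :
    powSum p (fun i => c * t i) = c * powSum p t := by
  have hpos : 0 < p.toReal := ENNReal.toReal_pos (by positivity) hp'
  unfold powSum
  simp only [ENNReal.mul_rpow_of_nonneg _ _ hpos.le]
  rw [ENNReal.tsum_mul_left, ENNReal.mul_rpow_of_nonneg _ _ (by positivity), ← ENNReal.rpow_mul,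
    mul_one_div_cancel hpos.ne', ENNReal.rpow_one]

theorem powSum_single {p : ℝ≥0∞} (hp : 1 ≤ p) (hp' : p ≠ ∞) (t : ℕ → ℝ≥0∞) (i : ℕ)
    (ht : ∀ j, j ≠ i → t j = 0) : powSum p t = t i := by
  have hpos : 0 < p.toReal := ENNReal.toReal_pos (by positivity) hp'
  unfold powSum
  rw [tsum_eq_single i fun j hj => by rw [ht j hj, ENNReal.zero_rpow_of_pos hpos],
    ← ENNReal.rpow_mul, mul_one_div_cancel hpos.ne', ENNReal.rpow_one]

theorem familyENorm_add_le (𝓕 : Set (Finset ℕ+)) {p : ℝ≥0∞} (hp : 1 ≤ p) (x y : ℕ+ → 𝕜) :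
    familyENorm 𝓕 p (x + y) ≤ familyENorm 𝓕 p x + familyENorm 𝓕 p y := by
  have hsum : ∀ E : Finset ℕ+, ∑ n ∈ E, ‖(x + y) n‖ₑ ≤ ∑ n ∈ E, ‖x n‖ₑ + ∑ n ∈ E, ‖y n‖ₑ := by
    intro E
    rw [← Finset.sum_add_distrib]
    exact Finset.sum_le_sum fun n _ => enorm_add_le _ _
  unfold familyENorm
  split_ifs with h
  · refine iSup₂_le fun E hE => (hsum E).trans ?_
    exact add_le_add (le_iSup₂ (f := fun E (_ : E ∈ 𝓕) => ∑ n ∈ E, ‖x n‖ₑ) E hE)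
      (le_iSup₂ (f := fun E (_ : E ∈ 𝓕) => ∑ n ∈ E, ‖y n‖ₑ) E hE)
  · refine iSup_le fun E => iSup₂_le fun hE hlt => ?_
    refine (powSum_mono fun i => hsum (E i)).trans ((powSum_add_le hp h _ _).trans ?_)
    refine add_le_add ?_ ?_
    · exact le_iSup_of_le E (le_iSup₂_of_le hE hlt le_rfl)
    · exact le_iSup_of_le E (le_iSup₂_of_le hE hlt le_rfl)

theorem familyENorm_smul (𝓕 : Set (Finset ℕ+)) {p : ℝ≥0∞} (hp : 1 ≤ p) (c : 𝕜) (x : ℕ+ → 𝕜) :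
    familyENorm 𝓕 p (c • x) = ‖c‖ₑ * familyENorm 𝓕 p x := by
  have hsum : ∀ E : Finset ℕ+, ∑ n ∈ E, ‖(c • x) n‖ₑ = ‖c‖ₑ * ∑ n ∈ E, ‖x n‖ₑ := by
    intro E
    rw [Finset.mul_sum]
    exact Finset.sum_congr rfl fun n _ => by simp [enorm_mul]
  unfold familyENorm
  split_ifs with h
  · simp only [hsum, ENNReal.mul_iSup]
  · simp only [hsum, ENNReal.mul_iSup, powSum_mul hp h]

/-- Lower semicontinuity with respect to coordinatewise convergence. -/
theorem familyENorm_le_of_tendsto (𝓕 : Set (Finset ℕ+)) {p : ℝ≥0∞} (hp : 1 ≤ p)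
    (y : ℕ → ℕ+ → 𝕜) (x : ℕ+ → 𝕜) (hy : ∀ n, Tendsto (fun k => y k n) atTop (𝓝 (x n)))
    (c : ℝ≥0∞) (hc : ∀ᶠ k in atTop, familyENorm 𝓕 p (y k) ≤ c) : familyENorm 𝓕 p x ≤ c := by
  have hsum : ∀ E : Finset ℕ+, Tendsto (fun k => ∑ n ∈ E, ‖y k n‖ₑ) atTop
      (𝓝 (∑ n ∈ E, ‖x n‖ₑ)) := fun E =>
    tendsto_finsetSum _ fun n _ => (hy n).enorm
  unfold familyENorm at hc ⊢
  split_ifs at hc ⊢ with h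
  · refine iSup₂_le fun E hE => le_of_tendsto (hsum E) ?_
    filter_upwards [hc] with k hk
    exact (iSup₂_le_iff.1 hk) E hE
  · refine iSup_le fun E => iSup₂_le fun hE hlt => ?_
    rw [powSum_le_iff hp h]
    intro s
    have ht : Tendsto (fun k => (∑ i ∈ s, (∑ n ∈ E i, ‖y k n‖ₑ) ^ p.toReal) ^ (1 / p.toReal)) atTop
        (𝓝 ((∑ i ∈ s, (∑ n ∈ E i, ‖x n‖ₑ) ^ p.toReal) ^ (1 / p.toReal))) :=
      (tendsto_finsetSum _ fun i _ => (hsum (E i)).ennrpow_const _).ennrpow_const _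
    refine le_of_tendsto ht ?_
    filter_upwards [hc] with k hk
    exact (powSum_le_iff hp h _ _).1 (iSup₂_le_iff.1 (iSup_le_iff.1 hk E) hE hlt) s

theorem enorm_le_familyENorm {𝓕 : Set (Finset ℕ+)} (h𝓕 : ∀ E : Finset ℕ+, E.card ≤ 1 → E ∈ 𝓕)
    {p : ℝ≥0∞} (hp : 1 ≤ p) (x : ℕ+ → 𝕜) (n : ℕ+) : ‖x n‖ₑ ≤ familyENorm 𝓕 p x := by
  unfold familyENorm
  split_ifs with h
  · exact le_iSup₂_of_le {n} (h𝓕 _ (by simp)) (by simp)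
  · refine le_iSup_of_le (fun i => if i = 0 then {n} else ∅) (le_iSup₂_of_le ?_ ?_ ?_)
    · intro i
      apply h𝓕
      dsimp only
      split_ifs <;> simp
    · intro i j hij u _ v hv
      dsimp only at hv
      rw [if_neg (by omega)] at hv
      simp at hv
    · rw [powSum_single hp h _ 0 fun j hj => by simp [hj]]
      simp

theorem familyENorm_single_lt_top (𝓕 : Set (Finset ℕ+)) {p : ℝ≥0∞} (hp : 1 ≤ p) (n : ℕ+) (c : 𝕜) :
    familyENorm 𝓕 p (Pi.single n c) < ∞ := by
  have hsum : ∀ E : Finset ℕ+, ∑ m ∈ E, ‖(Pi.single n c : ℕ+ → 𝕜) m‖ₑ =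
      if n ∈ E then ‖c‖ₑ else 0 := by
    intro E
    rw [← Finset.sum_ite_eq E n fun _ => ‖c‖ₑ]
    refine Finset.sum_congr rfl fun m _ => ?_
    by_cases h : n = m
    · subst h; simp
    · simp [h, Ne.symm h]
  refine lt_of_le_of_lt (b := ‖c‖ₑ) ?_ enorm_lt_top
  unfold familyENorm
  split_ifs with h
  · refine iSup₂_le fun E _ => ?_
    rw [hsum]
    split_ifs <;> simp
  · refine iSup_le fun E => iSup₂_le fun _ hlt => ?_
    simp only [hsum]
    by_cases hn : ∃ i, n ∈ E i
    · obtain ⟨i, hi⟩ := hn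
      rw [powSum_single hp h _ i]
      · simp [hi]
      · intro j hj
        rw [if_neg]
        intro hj'
        rcases lt_or_gt_of_ne hj with hlt' | hlt'
        · exact lt_irrefl _ (hlt _ _ hlt' n hj' n hi)
        · exact lt_irrefl _ (hlt _ _ hlt' n hi n hj')
    · push Not at hn
      rw [powSum_single hp h _ 0] <;> simp [hn]

theorem familyENorm_zero (𝓕 : Set (Finset ℕ+)) {p : ℝ≥0∞} (hp : 1 ≤ p) :
    familyENorm 𝓕 p (0 : ℕ+ → 𝕜) = 0 := by
  have := familyENorm_smul 𝓕 hp (0 : 𝕜) (0 : ℕ+ → 𝕜)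
  simpa using this

theorem familyENorm_finsupp_lt_top (𝓕 : Set (Finset ℕ+)) {p : ℝ≥0∞} (hp : 1 ≤ p) (y : ℕ+ →₀ 𝕜) :
    familyENorm 𝓕 p y < ∞ := by
  classical
  induction y using Finsupp.induction_linear with
  | zero => simp [familyENorm_zero 𝓕 hp]
  | add f g hf hg =>
    rw [Finsupp.coe_add]
    exact (familyENorm_add_le 𝓕 hp _ _).trans_lt (ENNReal.add_lt_top.2 ⟨hf, hg⟩)
  | single n c =>
    rw [Finsupp.single_eq_pi_single]
    exact familyENorm_single_lt_top 𝓕 hp n c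

variable (𝕜) in
/-- The scalar sequences that belong to the closure of `c₀₀` in the norm `familyENorm 𝓕 p`. -/
def familySubmodule (𝓕 : Set (Finset ℕ+)) (p : ℝ≥0∞) [hp : Fact (1 ≤ p)] :
    Submodule 𝕜 (ℕ+ → 𝕜) where
  carrier := {x | ∀ ε : ℝ≥0∞, 0 < ε → ∃ y : ℕ+ →₀ 𝕜, familyENorm 𝓕 p (x - ⇑y) < ε}
  zero_mem' := fun ε hε => ⟨0, by simpa [familyENorm_zero 𝓕 hp.out] using hε⟩
  add_mem' := by
    intro x x' hx hx' ε hε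
    obtain ⟨y, hy⟩ := hx (ε / 2) (ENNReal.half_pos hε.ne')
    obtain ⟨y', hy'⟩ := hx' (ε / 2) (ENNReal.half_pos hε.ne')
    refine ⟨y + y', ?_⟩
    have : x + x' - (y + y' : ℕ+ →₀ 𝕜) = (x - y) + (x' - y') := by
      rw [Finsupp.coe_add]; abel
    rw [this]
    refine (familyENorm_add_le 𝓕 hp.out _ _).trans_lt ?_
    rw [← ENNReal.add_halves ε]
    exact ENNReal.add_lt_add hy hy'
  smul_mem' := by
    intro c x hx ε hε
    have hpos : 0 < ε / (‖c‖ₑ + 1) := ENNReal.div_pos hε.ne' (by simp)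
    obtain ⟨y, hy⟩ := hx _ hpos
    refine ⟨c • y, ?_⟩
    have : c • x - (c • y : ℕ+ →₀ 𝕜) = c • (x - y) := by
      rw [Finsupp.coe_smul, smul_sub]
    rw [this, familyENorm_smul 𝓕 hp.out]
    rw [ENNReal.lt_div_iff_mul_lt (by simp) (by simp)] at hy
    refine lt_of_le_of_lt ?_ hy
    rw [mul_comm]
    gcongr
    exact le_self_add

theorem familyENorm_lt_top_of_mem {𝓕 : Set (Finset ℕ+)} {p : ℝ≥0∞} [hp : Fact (1 ≤ p)] {x : ℕ+ → 𝕜}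
    (hx : x ∈ familySubmodule 𝕜 𝓕 p) : familyENorm 𝓕 p x < ∞ := by
  obtain ⟨y, hy⟩ : ∃ y : ℕ+ →₀ 𝕜, familyENorm 𝓕 p (x - ⇑y) < 1 := hx 1 one_pos
  have : x = (x - y) + y := by simp
  rw [this]
  exact (familyENorm_add_le 𝓕 hp.out _ _).trans_lt
    (ENNReal.add_lt_top.2 ⟨hy.trans ENNReal.one_lt_top, familyENorm_finsupp_lt_top 𝓕 hp.out y⟩)

theorem finsupp_mem_familySubmodule (𝓕 : Set (Finset ℕ+)) (p : ℝ≥0∞) [hp : Fact (1 ≤ p)]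
    (y : ℕ+ →₀ 𝕜) : (y : ℕ+ → 𝕜) ∈ familySubmodule 𝕜 𝓕 p :=
  fun ε hε => ⟨y, by simpa [familyENorm_zero 𝓕 hp.out] using hε⟩

end

theorem SchreierSystem.mem_family_of_card_le_one (S : SchreierSystem) (ξ : Ordinal.{0})
    (E : Finset ℕ+) (hE : E.card ≤ 1) : E ∈ S.family ξ :=
  schreierFamily_singleton S.seq S.seq_lt ξ E hE

/-- The space `X_{ξ,p}` (the Schreier space `X_ξ` for `p = ∞`, a Baernstein space for `p < ∞`): the
completion of `c₀₀` in the norm given by `𝓢_ξ` and `p`, realized as the space of the scalar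
sequences that are limits of elements of `c₀₀` in this norm. -/
def SchreierSpace (S : SchreierSystem) (𝕜 : Type*) [RCLike 𝕜] (ξ : Ordinal.{0}) (p : ℝ≥0∞)
    [Fact (1 ≤ p)] : Type _ :=
  familySubmodule 𝕜 (S.family ξ) p

namespace SchreierSpace

variable {S : SchreierSystem} {𝕜 : Type*} [RCLike 𝕜] {ξ : Ordinal.{0}} {p : ℝ≥0∞} [hp : Fact (1 ≤ p)]

instance : AddCommGroup (SchreierSpace S 𝕜 ξ p) :=
  inferInstanceAs (AddCommGroup (familySubmodule 𝕜 (S.family ξ) p))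

instance : Module 𝕜 (SchreierSpace S 𝕜 ξ p) :=
  inferInstanceAs (Module 𝕜 (familySubmodule 𝕜 (S.family ξ) p))

/-- The scalar sequence of coordinates of an element of `X_{ξ,p}`. -/
def coord (x : SchreierSpace S 𝕜 ξ p) : ℕ+ → 𝕜 := Subtype.val x

theorem coord_add (x y : SchreierSpace S 𝕜 ξ p) : coord (x + y) = coord x + coord y := rfl

theorem coord_sub (x y : SchreierSpace S 𝕜 ξ p) : coord (x - y) = coord x - coord y := rfl

theorem coord_smul (c : 𝕜) (x : SchreierSpace S 𝕜 ξ p) : coord (c • x) = c • coord x := rfl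

theorem coord_injective : Function.Injective (coord : SchreierSpace S 𝕜 ξ p → ℕ+ → 𝕜) :=
  Subtype.val_injective

theorem coord_mem (x : SchreierSpace S 𝕜 ξ p) : coord x ∈ familySubmodule 𝕜 (S.family ξ) p := x.2

instance : Norm (SchreierSpace S 𝕜 ξ p) := ⟨fun x => (familyENorm (S.family ξ) p (coord x)).toReal⟩

theorem norm_def (x : SchreierSpace S 𝕜 ξ p) :
    ‖x‖ = (familyENorm (S.family ξ) p (coord x)).toReal := rfl

theorem core : NormedSpace.Core 𝕜 (SchreierSpace S 𝕜 ξ p) where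
  norm_nonneg x := ENNReal.toReal_nonneg
  norm_smul c x := by
    rw [norm_def, coord_smul, familyENorm_smul _ hp.out, ENNReal.toReal_mul, toReal_enorm, norm_def]
  norm_triangle x y := by
    simp only [norm_def]
    rw [← ENNReal.toReal_add (familyENorm_lt_top_of_mem (coord_mem x)).ne
      (familyENorm_lt_top_of_mem (coord_mem y)).ne]
    refine ENNReal.toReal_mono (ENNReal.add_lt_top.2 ⟨familyENorm_lt_top_of_mem (coord_mem x),
      familyENorm_lt_top_of_mem (coord_mem y)⟩).ne ?_
    exact familyENorm_add_le _ hp.out _ _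
  norm_eq_zero_iff x := by
    constructor
    · intro h
      rw [norm_def, ENNReal.toReal_eq_zero_iff,
        or_iff_left (familyENorm_lt_top_of_mem (coord_mem x)).ne] at h
      apply coord_injective
      funext n
      have := enorm_le_familyENorm (S.mem_family_of_card_le_one ξ) hp.out (coord x) n
      rw [h] at this
      exact enorm_eq_zero.1 (le_bot_iff.1 this)
    · rintro rfl
      rw [norm_def]
      have : coord (0 : SchreierSpace S 𝕜 ξ p) = 0 := rfl
      rw [this, familyENorm_zero _ hp.out, ENNReal.toReal_zero]

instance : NormedAddCommGroup (SchreierSpace S 𝕜 ξ p) := NormedAddCommGroup.ofCore core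

instance : NormedSpace 𝕜 (SchreierSpace S 𝕜 ξ p) := NormedSpace.ofCore core

/-- The element of `X_{ξ,p}` with given coordinates. -/
def ofMem (y : ℕ+ → 𝕜) (hy : y ∈ familySubmodule 𝕜 (S.family ξ) p) : SchreierSpace S 𝕜 ξ p :=
  Subtype.mk y hy

theorem coord_ofMem (y : ℕ+ → 𝕜) (hy : y ∈ familySubmodule 𝕜 (S.family ξ) p) :
    coord (ofMem y hy) = y := rfl

/-- The inclusion of `c₀₀` into `X_{ξ,p}`. -/
def ofFinsupp (y : ℕ+ →₀ 𝕜) : SchreierSpace S 𝕜 ξ p :=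
  ofMem y (finsupp_mem_familySubmodule _ _ y)

theorem enorm_def (x : SchreierSpace S 𝕜 ξ p) :
    ‖x‖ₑ = familyENorm (S.family ξ) p (coord x) := by
  rw [← ofReal_norm, norm_def, ENNReal.ofReal_toReal (familyENorm_lt_top_of_mem (coord_mem x)).ne]

theorem denseRange_ofFinsupp :
    DenseRange (ofFinsupp : (ℕ+ →₀ 𝕜) → SchreierSpace S 𝕜 ξ p) := by
  intro x
  rw [EMetric.mem_closure_iff]
  intro ε hε
  obtain ⟨y, hy⟩ : ∃ y : ℕ+ →₀ 𝕜, familyENorm (S.family ξ) p (coord x - ⇑y) < ε :=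
    coord_mem x ε hε
  refine ⟨_, ⟨y, rfl⟩, ?_⟩
  rw [edist_eq_enorm_sub, enorm_def]
  exact hy

instance : CompleteSpace (SchreierSpace S 𝕜 ξ p) := by
  refine Metric.complete_of_cauchySeq_tendsto fun u hu => ?_
  have hcoord : ∀ (x : SchreierSpace S 𝕜 ξ p) n, ‖coord x n‖ₑ ≤ ‖x‖ₑ := fun x n => by
    rw [enorm_def]
    exact enorm_le_familyENorm (S.mem_family_of_card_le_one ξ) hp.out (coord x) n
  have hlim : ∀ n, ∃ z, Tendsto (fun k => coord (u k) n) atTop (𝓝 z) := by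
    intro n
    refine cauchySeq_tendsto_of_complete ?_
    rw [EMetric.cauchySeq_iff] at hu ⊢
    intro ε hε
    obtain ⟨N, hN⟩ := hu ε hε
    refine ⟨N, fun i hi j hj => lt_of_le_of_lt ?_ (hN i hi j hj)⟩
    rw [edist_eq_enorm_sub, edist_eq_enorm_sub]
    exact hcoord (u i - u j) n
  choose x hx using hlim
  have hclose : ∀ ε : ℝ≥0∞, 0 < ε → ∃ N, ∀ k ≥ N,
      familyENorm (S.family ξ) p (x - coord (u k)) ≤ ε := by
    intro ε hε
    obtain ⟨N, hN⟩ := EMetric.cauchySeq_iff.1 hu ε hε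
    refine ⟨N, fun k hk => ?_⟩
    refine familyENorm_le_of_tendsto _ hp.out (fun j => coord (u j) - coord (u k)) _ ?_ ε ?_
    · intro n
      exact (hx n).sub tendsto_const_nhds
    · filter_upwards [eventually_ge_atTop N] with j hj
      rw [← coord_sub, ← enorm_def, ← edist_eq_enorm_sub]
      exact (hN j hj k hk).le
  have hmem : x ∈ familySubmodule 𝕜 (S.family ξ) p := by
    intro ε hε
    obtain ⟨δ, hδ, hδε⟩ := exists_between (ENNReal.half_pos hε.ne')
    obtain ⟨N, hN⟩ := hclose δ hδ
    obtain ⟨y, hy⟩ := coord_mem (u N) (ε / 2) (ENNReal.half_pos hε.ne')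
    refine ⟨y, ?_⟩
    have : x - (y : ℕ+ → 𝕜) = (x - coord (u N)) + (coord (u N) - y) := by abel
    rw [this]
    refine (familyENorm_add_le _ hp.out _ _).trans_lt ?_
    rw [← ENNReal.add_halves ε]
    exact ENNReal.add_lt_add ((hN N le_rfl).trans_lt hδε) hy
  refine ⟨ofMem x hmem, ?_⟩
  rw [EMetric.tendsto_atTop]
  intro ε hε
  obtain ⟨δ, hδ, hδε⟩ := exists_between hε
  obtain ⟨N, hN⟩ := hclose δ hδ
  refine ⟨N, fun k hk => ?_⟩
  rw [edist_comm, edist_eq_enorm_sub, enorm_def, coord_sub, coord_ofMem]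
  exact (hN k hk).trans_lt hδε

variable (S 𝕜 ξ p) in
/-- The canonical basis of `X_{ξ,p}`. -/
def basis (n : ℕ+) : SchreierSpace S 𝕜 ξ p := ofFinsupp (Finsupp.single n 1)

/-- The quantity `‖x‖_ζ = sup {∑_{n ∈ E} |x n| : E ∈ 𝓢_ζ}` for an element `x` of `X_{ξ,p}`. -/
def schreierENorm (x : SchreierSpace S 𝕜 ξ p) (ζ : Ordinal.{0}) : ℝ≥0∞ :=
  familyENorm (S.family ζ) ∞ (coord x)

end SchreierSpace

/-! Sequences in normed spaces. -/

section

variable (𝕜 : Type*) [RCLike 𝕜] {E F : Type*} [NormedAddCommGroup E] [NormedSpace 𝕜 E]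
  [NormedAddCommGroup F] [NormedSpace 𝕜 F]

def IsWeaklyNull (x : ℕ+ → E) : Prop :=
  ∀ f : E →L[𝕜] 𝕜, Tendsto (fun n => f (x n)) atTop (𝓝 0)

/-- Weakly unconditionally Cauchy sequences: `∑ₙ |f (x n)| < ∞` for every functional `f`. -/
def IsWUC (x : ℕ+ → E) : Prop := ∀ f : E →L[𝕜] 𝕜, Summable fun n => ‖f (x n)‖

def IsSeminormalized (x : ℕ+ → E) : Prop := ∃ c C : ℝ, 0 < c ∧ ∀ n, c ≤ ‖x n‖ ∧ ‖x n‖ ≤ C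

/-- `x` is an `ℓ₁^𝓕`-spreading model. -/
def IsL1SpreadingModel (𝓕 : Set (Finset ℕ+)) (x : ℕ+ → E) : Prop :=
  IsSeminormalized x ∧ ∃ c : ℝ, 0 < c ∧ ∀ A ∈ 𝓕, ∀ a : ℕ+ → 𝕜, ∑ n ∈ A, ‖a n‖ = 1 →
    c ≤ ‖∑ n ∈ A, a n • x n‖

/-- `x` is `ξ`-weakly null (`ξ` a countable ordinal): it is weakly null and has no subsequence that
is an `ℓ₁^ξ`-spreading model. -/
def IsOrdinalWeaklyNull (S : SchreierSystem) (ξ : Ordinal.{0}) (x : ℕ+ → E) : Prop :=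
  IsWeaklyNull 𝕜 x ∧
    ¬ ∃ φ : ℕ+ → ℕ+, StrictMono φ ∧ IsL1SpreadingModel 𝕜 (S.family ξ) (x ∘ φ)

/-- Equivalence of two sequences, possibly in different spaces. -/
def AreEquivalent (x : ℕ+ → E) (y : ℕ+ → F) : Prop :=
  ∃ c C : ℝ, 0 < c ∧ 0 < C ∧ ∀ a : ℕ+ →₀ 𝕜,
    c * ‖a.sum fun n t => t • y n‖ ≤ ‖a.sum fun n t => t • x n‖ ∧
    ‖a.sum fun n t => t • x n‖ ≤ C * ‖a.sum fun n t => t • y n‖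

/-- The canonical basis of `ℓ_p`. -/
def lpBasis (p : ℝ≥0∞) (n : ℕ+) : lp (fun _ : ℕ+ => 𝕜) p := lp.single p n 1

end

/-- `λ(ξ) = ω ^ ε₁`, where `ω ^ ε₁ * n₁` is the leading term of the Cantor normal form of `ξ ≠ 0`,
and `λ(0) = 0`. -/
def leadingPower (ξ : Ordinal.{0}) : Ordinal.{0} :=
  if ξ = 0 then 0 else ω ^ Ordinal.log ω ξ

/-- The set `Γ` of those `ζ ≤ ξ` for which `limsup ‖x n‖_ζ > 0`. -/
def gammaSet {S : SchreierSystem} {𝕜 : Type*} [RCLike 𝕜] {ξ : Ordinal.{0}} {p : ℝ≥0∞}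
    [Fact (1 ≤ p)] (x : ℕ+ → SchreierSpace S 𝕜 ξ p) : Set Ordinal.{0} :=
  {ζ | ζ ≤ ξ ∧ 0 < limsup (fun n => (x n).schreierENorm ζ) atTop}

end

/-! The coordinates of a weakly null sequence tend to zero, so a subsequence is, up to a summable
error, a sequence of successive blocks. The norms depend only on the absolute values of the
coordinates; hence blocks are treated as weights with values in [0, ∞], and `wnorm` handles p = ∞
and p < ∞ together.

Let γ = min Γ and γ + δ = ξ. Up to spreading, the sets of 𝓢_ξ are the 𝓢_δ-unions of sets of 𝓢_γ
(`exists_decomposition`, `exists_biUnion_mem`). Lower estimate: ‖x_n‖_γ does not tend to zero, so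
the blocks carry sets E_k ∈ 𝓢_γ of mass bounded below. After omission of the first set, an 𝓢_δ-union
of them lies in 𝓢_ξ, so the norm of a combination dominates the norm of its coefficients along a
subsequence of the basis of X_{δ,p} (`le_wnorm_block`). Upper estimate: cut a set of 𝓢_ξ into pieces
in 𝓢_γ. The blocks in which some piece begins form an 𝓢_δ set up to spreading. Any other block is
met only by pieces that begin at or before the end q of the preceding block. There are at most q
such pieces, and each is controlled by q and one family 𝓢_ζ with ζ < γ depending on q alone; since
‖x_n‖_ζ → 0, the block can be chosen almost invisible to them (`wnorm_block_le`). If Γ = ∅, every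
set of 𝓢_ξ sees little of each block, and for p < ∞ the superadditivity of the p-th power of the
norm leaves exactly the ℓ_p structure.

The order of the spreading models is then read off from the bases. Subsequences of the basis of
X_{δ,p} have lower ℓ₁ estimates on 𝓢_δ but not on 𝓢_{δ+1}: there are averages supported in 𝓢_{δ+1}
that are small on 𝓢_δ (`exists_average`), and p > 1 makes their norm small. For WUC subsequences
with p = ∞: if γ = ξ then δ = 0 and the c₀ basis appears, while γ < ξ yields an ℓ₁^δ-spreading model
with δ ≥ 1, which is never WUC. The last equivalence is ordinal arithmetic: ξ - γ = ξ for γ < λ(ξ),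
and ξ - γ ≤ ξ - λ(ξ) < ξ for γ ≥ λ(ξ). -/

/-! Aggregation of nonnegative families and norms of weights. -/

/-- The `ℓ_p` norm of a family in `[0, ∞]`. -/
noncomputable def lpAgg {ι : Type*} (p : ℝ≥0∞) (t : ι → ℝ≥0∞) : ℝ≥0∞ :=
  if p = ∞ then ⨆ i, t i else (∑' i, t i ^ p.toReal) ^ (1 / p.toReal)

theorem one_le_toReal {p : ℝ≥0∞} (hp : 1 ≤ p) (hp' : p ≠ ∞) : 1 ≤ p.toReal := by
  simpa using ENNReal.toReal_mono hp' hp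

theorem toReal_pos_of_one_le {p : ℝ≥0∞} (hp : 1 ≤ p) (hp' : p ≠ ∞) : 0 < p.toReal :=
  one_pos.trans_le (one_le_toReal hp hp')

theorem lpAgg_eq_powSum {p : ℝ≥0∞} (hp' : p ≠ ∞) (t : ℕ → ℝ≥0∞) : lpAgg p t = powSum p t := by
  simp [lpAgg, powSum, hp']

theorem lpAgg_mono {ι : Type*} {p : ℝ≥0∞} {t u : ι → ℝ≥0∞} (h : ∀ i, t i ≤ u i) :
    lpAgg p t ≤ lpAgg p u := by
  unfold lpAgg
  split_ifs
  · exact iSup_mono h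
  · gcongr with i
    exact h i

theorem lpAgg_le_iff {ι : Type*} {p : ℝ≥0∞} (hp : 1 ≤ p) (hp' : p ≠ ∞) (t : ι → ℝ≥0∞)
    (c : ℝ≥0∞) : lpAgg p t ≤ c ↔ ∑' i, t i ^ p.toReal ≤ c ^ p.toReal := by
  rw [lpAgg, if_neg hp', one_div, ENNReal.rpow_inv_le_iff (toReal_pos_of_one_le hp hp')]

theorem lpAgg_rpow {ι : Type*} {p : ℝ≥0∞} (hp : 1 ≤ p) (hp' : p ≠ ∞) (t : ι → ℝ≥0∞) :
    lpAgg p t ^ p.toReal = ∑' i, t i ^ p.toReal := by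
  rw [lpAgg, if_neg hp', ← ENNReal.rpow_mul,
    one_div_mul_cancel (toReal_pos_of_one_le hp hp').ne', ENNReal.rpow_one]

theorem le_lpAgg {ι : Type*} {p : ℝ≥0∞} (hp : 1 ≤ p) (t : ι → ℝ≥0∞) (i : ι) :
    t i ≤ lpAgg p t := by
  by_cases hp' : p = ∞
  · simp only [lpAgg, if_pos hp']
    exact le_iSup t i
  · rw [← ENNReal.rpow_le_rpow_iff (toReal_pos_of_one_le hp hp'), lpAgg_rpow hp hp']
    exact ENNReal.le_tsum i

theorem tsum_rpow_le {ι : Type*} {t : ι → ℝ≥0∞} {a : ℝ≥0∞} {r : ℝ} (hr : 1 ≤ r)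
    (h : ∀ i, t i ≤ a) : ∑' i, t i ^ r ≤ a ^ (r - 1) * ∑' i, t i := by
  rw [← ENNReal.tsum_mul_left]
  refine ENNReal.tsum_le_tsum fun i => ?_
  calc t i ^ r = t i ^ ((r - 1) + 1) := by ring_nf
    _ = t i ^ (r - 1) * t i := by
      rw [ENNReal.rpow_add_of_nonneg _ _ (by linarith) zero_le_one, ENNReal.rpow_one]
    _ ≤ _ := by
      exact mul_le_mul_left (ENNReal.rpow_le_rpow (h i) (by linarith)) _

theorem lpAgg_le_tsum {ι : Type*} {p : ℝ≥0∞} (hp : 1 ≤ p) (t : ι → ℝ≥0∞) :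
    lpAgg p t ≤ ∑' i, t i := by
  by_cases hp' : p = ∞
  · simp only [lpAgg, if_pos hp']
    exact iSup_le ENNReal.le_tsum
  · rw [lpAgg_le_iff hp hp']
    refine (tsum_rpow_le (one_le_toReal hp hp') ENNReal.le_tsum).trans_eq ?_
    have := one_le_toReal hp hp'
    calc _ = (∑' i, t i) ^ (p.toReal - 1) * (∑' i, t i) ^ (1 : ℝ) := by rw [ENNReal.rpow_one]
      _ = _ := by
        rw [← ENNReal.rpow_add_of_nonneg _ _ (by linarith) zero_le_one]; ring_nf

theorem lpAgg_add_le {p : ℝ≥0∞} (hp : 1 ≤ p) (t u : ℕ → ℝ≥0∞) :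
    lpAgg p (fun i => t i + u i) ≤ lpAgg p t + lpAgg p u := by
  by_cases hp' : p = ∞
  · simp only [lpAgg, if_pos hp']
    exact iSup_le fun i => add_le_add (le_iSup t i) (le_iSup u i)
  · simp only [lpAgg_eq_powSum hp']
    exact powSum_add_le hp hp' t u

theorem lpAgg_mul_left {p : ℝ≥0∞} (hp : 1 ≤ p) (c : ℝ≥0∞) (t : ℕ → ℝ≥0∞) :
    lpAgg p (fun i => c * t i) = c * lpAgg p t := by
  by_cases hp' : p = ∞
  · simp only [lpAgg, if_pos hp', ENNReal.mul_iSup]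
  · simp only [lpAgg_eq_powSum hp']
    exact powSum_mul hp hp' c t

theorem lpAgg_comp_equiv {ι κ : Type*} (p : ℝ≥0∞) (e : ι ≃ κ) (t : κ → ℝ≥0∞) :
    lpAgg p (fun i => t (e i)) = lpAgg p t := by
  unfold lpAgg
  split_ifs
  · exact e.iSup_comp (g := t)
  · rw [e.tsum_eq (fun i => t i ^ p.toReal)]

/-- For p < ∞ this is the exchange of two sums. It serves to group the test sets that begin in the
same block. -/
theorem lpAgg_le_fiberwise {p : ℝ≥0∞} (hp : 1 ≤ p) {ι κ : Type*} [DecidableEq κ] (f : ι → κ)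
    (t : ι → ℝ≥0∞) :
    lpAgg p t ≤ lpAgg p (fun k => lpAgg p fun l => if f l = k then t l else 0) := by
  by_cases hp' : p = ∞
  · simp only [lpAgg, if_pos hp']
    refine iSup_le fun l => ?_
    refine le_iSup_of_le (f l) (le_iSup_of_le l ?_)
    simp
  · rw [lpAgg_le_iff hp hp', lpAgg_rpow hp hp']
    simp only [lpAgg_rpow hp hp']
    rw [ENNReal.tsum_comm]
    refine ENNReal.tsum_le_tsum fun l => ?_
    refine le_trans ?_ (ENNReal.le_tsum (f l))
    simp

/-- The norm of a weight given by a family `𝓕` and the exponent `p`. -/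
noncomputable def wnorm (𝓕 : Set (Finset ℕ+)) (p : ℝ≥0∞) (w : ℕ+ → ℝ≥0∞) : ℝ≥0∞ :=
  ⨆ (E : ℕ → Finset ℕ+) (_ : ∀ i, E i ∈ 𝓕) (_ : ∀ i j, i < j → SetLT (E i) (E j)),
    lpAgg p fun i => ∑ n ∈ E i, w n

theorem lpAgg_le_wnorm {𝓕 : Set (Finset ℕ+)} {p : ℝ≥0∞} (w : ℕ+ → ℝ≥0∞)
    {E : ℕ → Finset ℕ+} (hE : ∀ i, E i ∈ 𝓕) (hlt : ∀ i j, i < j → SetLT (E i) (E j)) :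
    lpAgg p (fun i => ∑ n ∈ E i, w n) ≤ wnorm 𝓕 p w :=
  le_iSup_of_le E (le_iSup₂_of_le hE hlt le_rfl)

theorem wnorm_le {𝓕 : Set (Finset ℕ+)} {p : ℝ≥0∞} {w : ℕ+ → ℝ≥0∞} {c : ℝ≥0∞}
    (h : ∀ E : ℕ → Finset ℕ+, (∀ i, E i ∈ 𝓕) → (∀ i j, i < j → SetLT (E i) (E j)) →
      lpAgg p (fun i => ∑ n ∈ E i, w n) ≤ c) : wnorm 𝓕 p w ≤ c :=
  iSup_le fun E => iSup₂_le fun hE hlt => h E hE hlt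

theorem wnorm_mono {𝓕 : Set (Finset ℕ+)} {p : ℝ≥0∞} {w w' : ℕ+ → ℝ≥0∞} (h : ∀ n, w n ≤ w' n) :
    wnorm 𝓕 p w ≤ wnorm 𝓕 p w' :=
  wnorm_le fun _ hE hlt => (lpAgg_mono fun _ => Finset.sum_le_sum fun n _ => h n).trans
    (lpAgg_le_wnorm w' hE hlt)

theorem wnorm_mul_left (𝓕 : Set (Finset ℕ+)) {p : ℝ≥0∞} (hp : 1 ≤ p) (c : ℝ≥0∞)
    (w : ℕ+ → ℝ≥0∞) : wnorm 𝓕 p (fun n => c * w n) = c * wnorm 𝓕 p w := by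
  simp only [wnorm, ← Finset.mul_sum, lpAgg_mul_left hp, ENNReal.mul_iSup]

theorem sum_le_wnorm {𝓕 : Set (Finset ℕ+)} (h0 : ∅ ∈ 𝓕) {p : ℝ≥0∞} (hp : 1 ≤ p)
    (w : ℕ+ → ℝ≥0∞) {E : Finset ℕ+} (hE : E ∈ 𝓕) : ∑ n ∈ E, w n ≤ wnorm 𝓕 p w := by
  let D : ℕ → Finset ℕ+ := fun i => if i = 0 then E else ∅
  have hD : ∀ i, D i ∈ 𝓕 := fun i => by
    simp only [D]
    split_ifs <;> assumption
  have hlt : ∀ i j, i < j → SetLT (D i) (D j) := fun i j hij u _ v hv => by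
    simp only [D, if_neg (show j ≠ 0 by omega)] at hv
    simp at hv
  exact (le_lpAgg hp (fun i => ∑ n ∈ D i, w n) 0).trans (lpAgg_le_wnorm w hD hlt)

theorem wnorm_top_le {𝓕 : Set (Finset ℕ+)} {w : ℕ+ → ℝ≥0∞} {c : ℝ≥0∞}
    (h : ∀ E ∈ 𝓕, ∑ n ∈ E, w n ≤ c) : wnorm 𝓕 ∞ w ≤ c :=
  wnorm_le fun E hE _ => by
    simp only [lpAgg, if_true]
    exact iSup_le fun i => h _ (hE i)

theorem familyENorm_eq_wnorm {𝕜 : Type*} [RCLike 𝕜] {𝓕 : Set (Finset ℕ+)} (h0 : ∅ ∈ 𝓕)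
    (p : ℝ≥0∞) (x : ℕ+ → 𝕜) : familyENorm 𝓕 p x = wnorm 𝓕 p fun n => ‖x n‖ₑ := by
  unfold familyENorm
  split_ifs with h
  · subst h
    refine le_antisymm (iSup₂_le fun E hE => ?_) (wnorm_top_le fun E hE => ?_)
    · exact sum_le_wnorm h0 le_top (fun n => ‖x n‖ₑ) hE
    · exact le_iSup₂_of_le (f := fun E (_ : E ∈ 𝓕) => ∑ n ∈ E, ‖x n‖ₑ) E hE le_rfl
  · simp only [wnorm, lpAgg_eq_powSum h]

/-- Successive sets are disjoint, so each index is counted at most once. -/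
theorem tsum_sum_le_tsum {I : ℕ → Finset ℕ+} (hI : ∀ i j, i < j → SetLT (I i) (I j))
    (c : ℕ+ → ℝ≥0∞) : ∑' i, ∑ n ∈ I i, c n ≤ ∑' n, c n := by
  classical
  have h1 : ∀ i, ∑ n ∈ I i, c n = ∑' n, if n ∈ I i then c n else 0 := fun i => by
    rw [tsum_eq_sum (s := I i) (fun n hn => if_neg hn)]
    exact Finset.sum_congr rfl fun n hn => (if_pos hn).symm
  simp only [h1]
  rw [ENNReal.tsum_comm]
  refine ENNReal.tsum_le_tsum fun n => ?_
  by_cases hn : ∃ i, n ∈ I i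
  · obtain ⟨i, hi⟩ := hn
    rw [tsum_eq_single i, if_pos hi]
    intro j hj
    rw [if_neg]
    intro hj'
    rcases lt_or_gt_of_ne hj with h | h
    · exact lt_irrefl _ (hI _ _ h n hj' n hi)
    · exact lt_irrefl _ (hI _ _ h n hi n hj')
  · push Not at hn
    simp [hn]

/-- Together with `wnorm_le_lpAgg` this identifies the norm given by 𝓢₀ with the ℓ_p norm (the sup
norm for p = ∞). -/
theorem lpAgg_le_wnorm_of_singleton {𝓕 : Set (Finset ℕ+)} (h1 : ∀ n, {n} ∈ 𝓕) {p : ℝ≥0∞}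
    (w : ℕ+ → ℝ≥0∞) : lpAgg p w ≤ wnorm 𝓕 p w := by
  rw [← lpAgg_comp_equiv p Equiv.pnatEquivNat.symm]
  refine le_trans (lpAgg_mono fun i => ?_) (lpAgg_le_wnorm w
    (E := fun i => {Equiv.pnatEquivNat.symm i}) (fun i => h1 _) ?_)
  · simp
  · intro i j hij u hu v hv
    simp only [Finset.mem_singleton] at hu hv
    subst hu hv
    simpa using hij

theorem wnorm_le_lpAgg {𝓕 : Set (Finset ℕ+)} (h1 : ∀ E ∈ 𝓕, E.card ≤ 1) {p : ℝ≥0∞}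
    (hp : 1 ≤ p) (w : ℕ+ → ℝ≥0∞) : wnorm 𝓕 p w ≤ lpAgg p w := by
  refine wnorm_le fun E hE hlt => ?_
  by_cases hp' : p = ∞
  · simp only [lpAgg, if_pos hp']
    refine iSup_le fun i => ?_
    rcases Finset.card_le_one_iff_subset_singleton.1 (h1 _ (hE i)) with ⟨n, hn⟩
    refine (Finset.sum_le_sum_of_subset hn).trans ?_
    simpa using le_iSup w n
  · rw [lpAgg_le_iff hp hp', lpAgg_rpow hp hp']
    refine le_trans (ENNReal.tsum_le_tsum fun i => ?_)
      (tsum_sum_le_tsum hlt fun n => w n ^ p.toReal)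
    rcases Finset.card_le_one_iff_subset_singleton.1 (h1 _ (hE i)) with ⟨n, hn⟩
    rcases Finset.subset_singleton_iff.1 hn with h | h
    · simp [h, toReal_pos_of_one_le hp hp']
    · simp [h]

/-! Combinatorics of the Schreier families. -/

/-- Diagonal domination, needed at limit ordinals: one increasing function serves all the functions
`H n`, each from its own index n on. -/
theorem exists_strictMono_ge (H : ℕ+ → ℕ+ → ℕ+) :
    ∃ f : ℕ+ → ℕ+, StrictMono f ∧ ∀ n k, n ≤ k → H n k ≤ f k := by
  let s : ℕ+ → ℕ := fun k => ∑ j ∈ Finset.Icc 1 k, ∑ n ∈ Finset.Icc 1 k, (H n j : ℕ)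
  have hs : ∀ k k', k ≤ k' → s k ≤ s k' := by
    intro k k' h
    have hsub := Finset.Icc_subset_Icc_right (a := (1 : ℕ+)) h
    refine (Finset.sum_le_sum fun j _ => Finset.sum_le_sum_of_subset hsub).trans ?_
    exact Finset.sum_le_sum_of_subset hsub
  refine ⟨fun k => ⟨k + s k, by positivity⟩, fun k k' h => ?_, fun n k h => ?_⟩
  · have := hs k k' h.le
    have h' : (k : ℕ) < k' := h
    exact PNat.coe_lt_coe _ _ |>.1 (by simpa using by omega)
  · refine PNat.coe_le_coe _ _ |>.1 ?_
    refine le_trans ?_ (le_add_self : s k ≤ k + s k)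
    have h1 : k ∈ Finset.Icc 1 k := by simp
    have h2 : n ∈ Finset.Icc 1 k := by simp [h]
    refine le_trans ?_ (Finset.single_le_sum (f := fun j => ∑ n ∈ Finset.Icc 1 k, (H n j : ℕ))
      (fun _ _ => Nat.zero_le _) h1)
    exact Finset.single_le_sum (f := fun n => (H n k : ℕ)) (fun _ _ => Nat.zero_le _) h2

theorem sum_biUnion_le_sum {ι : Type*} (s : Finset ι) (G : ι → Finset ℕ+) (w : ℕ+ → ℝ≥0∞) :
    ∑ k ∈ s.biUnion G, w k ≤ ∑ i ∈ s, ∑ k ∈ G i, w k := by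
  classical
  induction s using Finset.induction_on with
  | empty => simp
  | insert i s hi ih =>
    rw [Finset.biUnion_insert, Finset.sum_insert hi]
    refine le_trans ?_ (add_le_add_right ih _)
    rw [← Finset.sum_union_inter]
    exact le_self_add

/-- The predecessor function of a finite set of positive integers. -/
theorem Finset.exists_pred (F : Finset ℕ+) (hF : F.Nonempty) :
    ∃ ν : ℕ+ → ℕ+, (∀ k ∈ F.erase (F.min' hF), ν k ∈ F ∧ ν k < k) ∧
      StrictMonoOn ν (F.erase (F.min' hF)) := by
  classical
  have hne : ∀ k ∈ F.erase (F.min' hF), (F.filter (· < k)).Nonempty := fun k hk => by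
    obtain ⟨h1, h2⟩ := Finset.mem_erase.1 hk
    exact ⟨F.min' hF, Finset.mem_filter.2 ⟨F.min'_mem hF, lt_of_le_of_ne (F.min'_le _ h2) h1.symm⟩⟩
  refine ⟨fun k => if h : (F.filter (· < k)).Nonempty then (F.filter (· < k)).max' h else 1,
    fun k hk => ?_, fun k hk k' hk' hlt => ?_⟩
  · dsimp only
    rw [dif_pos (hne k hk)]
    simpa using (F.filter (· < k)).max'_mem (hne k hk)
  · dsimp only
    rw [dif_pos (hne k hk), dif_pos (hne k' hk')]
    have h1 := (F.filter (· < k)).max'_mem (hne k hk)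
    rw [Finset.mem_filter] at h1
    refine h1.2.trans_le (Finset.le_max' _ _ ?_)
    exact Finset.mem_filter.2 ⟨Finset.mem_of_mem_erase hk, hlt⟩

namespace SchreierSystem

variable (S : SchreierSystem)

theorem family_zero : S.family 0 = {E | E.card ≤ 1} := schreierFamily_zero _

theorem family_add_one (ξ : Ordinal.{0}) : S.family (ξ + 1) = schreierSucc (S.family ξ) :=
  schreierFamily_add_one _ _

theorem mem_family_limit {l : Ordinal.{0}} (hl : IsSuccLimit l) {E : Finset ℕ+} :
    E ∈ S.family l ↔ ∃ n : ℕ+, (∀ k ∈ E, n ≤ k) ∧ E ∈ S.family (S.seq l n + 1) := by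
  unfold family
  rw [schreierFamily_limit S.seq hl (S.seq_lt l hl)]
  rfl

theorem empty_mem_family (ξ : Ordinal.{0}) : ∅ ∈ S.family ξ :=
  S.mem_family_of_card_le_one ξ _ (by simp)

theorem singleton_mem_family (ξ : Ordinal.{0}) (n : ℕ+) : {n} ∈ S.family ξ :=
  S.mem_family_of_card_le_one ξ _ (by simp)

variable {S}

theorem family_hereditary {ξ : Ordinal.{0}} {E F : Finset ℕ+} (hF : F ∈ S.family ξ) (h : E ⊆ F) :
    E ∈ S.family ξ :=
  schreierFamily_hereditary S.seq S.seq_lt ξ E F hF h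

variable (S)

theorem family_almost_mono {α β : Ordinal.{0}} (hβ : β < ω₁) (hαβ : α ≤ β) :
    ∃ m : ℕ+, ∀ E ∈ S.family α, (∀ k ∈ E, m ≤ k) → E ∈ S.family β :=
  schreierFamily_almost_mono S.seq S.seq_lt ω₁
    (fun l hl hlim η hη => S.exists_lt l hlim hl η hη) α β hβ hαβ

theorem family_subset_add_one (ξ : Ordinal.{0}) : S.family ξ ⊆ S.family (ξ + 1) := by
  rw [family_add_one]
  exact subset_schreierSucc _

theorem family_seq_mono {l : Ordinal.{0}} (hl : IsSuccLimit l) (hl1 : l < ω₁) {n n' : ℕ+}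
    (h : n ≤ n') : S.family (S.seq l n + 1) ⊆ S.family (S.seq l n' + 1) := by
  induction n' using PNat.recOn with
  | one => rw [le_antisymm h one_le]
  | succ k ih =>
    rcases h.eq_or_lt with rfl | hlt
    · exact subset_rfl
    · exact ((ih (PNat.lt_add_one_iff.1 hlt)).trans (S.subset l hl hl1 k)).trans
        (S.family_subset_add_one _)

variable {S}

/-- The spreading property, by induction on δ. Indexing both sets by K lets a decomposition of the
lower set be pulled back to K and pushed forward to the upper set. -/
theorem family_spread {δ : Ordinal.{0}} {K : Finset ℕ+} {ν ν' : ℕ+ → ℕ+}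
    (hν : StrictMonoOn ν K) (hν' : StrictMonoOn ν' K) (hle : ∀ k ∈ K, ν k ≤ ν' k)
    (h : K.image ν ∈ S.family δ) : K.image ν' ∈ S.family δ := by
  classical
  induction δ using WellFoundedLT.induction generalizing K with
  | ind δ ih =>
  rcases Ordinal.zero_or_succ_or_isSuccLimit δ with rfl | ⟨η, rfl⟩ | hl
  · rw [family_zero] at h ⊢
    refine Finset.card_image_le.trans ?_
    rw [← Finset.card_image_of_injOn hν.injOn]
    exact h
  · rw [succ_eq_add_one, family_add_one] at h ⊢
    obtain ⟨n, G, -, hG, hlt, hn, hGK⟩ := h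
    let T : Fin n → Finset ℕ+ := fun i => K.filter fun k => ν k ∈ G i
    have hT : ∀ i, T i ⊆ K := fun i => Finset.filter_subset _ _
    have := schreierSucc_of_pieces (𝓕 := S.family η) (fun i => (T i).image ν')
      (fun i _ => ih η (lt_succ η) (hν.mono (hT i)) (hν'.mono (hT i)) (fun k hk => hle k (hT i hk))
        (family_hereditary (hG i) fun m hm => by
          obtain ⟨k, hk, rfl⟩ := Finset.mem_image.1 hm
          exact (Finset.mem_filter.1 hk).2)) ?_ ?_
    · convert this
      ext m
      simp only [Finset.mem_image, Finset.mem_biUnion, Finset.mem_univ, true_and, T,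
        Finset.mem_filter]
      constructor
      · rintro ⟨k, hk, rfl⟩
        have : ν k ∈ K.image ν := Finset.mem_image_of_mem _ hk
        rw [hGK] at this
        obtain ⟨i, -, hi⟩ := Finset.mem_biUnion.1 this
        exact ⟨i, k, ⟨hk, hi⟩, rfl⟩
      · rintro ⟨i, k, hk, rfl⟩
        exact ⟨k, hk.1, rfl⟩
    · intro i j hij a ha b hb
      obtain ⟨k, hk, rfl⟩ := Finset.mem_image.1 ha
      obtain ⟨k', hk', rfl⟩ := Finset.mem_image.1 hb
      obtain ⟨h1, h2⟩ := Finset.mem_filter.1 hk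
      obtain ⟨h1', h2'⟩ := Finset.mem_filter.1 hk'
      exact hν' h1 h1' ((hν.lt_iff_lt h1 h1').1 (hlt i j hij _ h2 _ h2'))
    · intro i a ha
      obtain ⟨k, hk, rfl⟩ := Finset.mem_image.1 ha
      obtain ⟨h1, h2⟩ := Finset.mem_filter.1 hk
      exact (hn i _ h2).trans (hle k h1)
  · rw [mem_family_limit S hl] at h ⊢
    obtain ⟨n, hn, h⟩ := h
    refine ⟨n, fun m hm => ?_, ih _ (hl.add_one_lt (S.seq_lt δ hl n)) hν hν' hle h⟩
    obtain ⟨k, hk, rfl⟩ := Finset.mem_image.1 hm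
    exact (hn _ (Finset.mem_image_of_mem ν hk)).trans (hle k hk)

theorem image_mem_family {δ : Ordinal.{0}} {K : Finset ℕ+} {ν : ℕ+ → ℕ+} (hν : StrictMono ν)
    (h : K ∈ S.family δ) : K.image ν ∈ S.family δ :=
  family_spread (ν := id) (strictMono_id.strictMonoOn _) (hν.strictMonoOn _) (fun _ _ => hν.le_apply)
    (by simpa using h)

variable (S)

/-- The sets of `𝓢_γ`, `γ ≠ 0`, that meet `{1, …, q}` are controlled by a smaller Schreier
family. -/
theorem exists_sum_le_wnorm {γ : Ordinal.{0}} (hγ : γ < ω₁) (h0 : γ ≠ 0) (q : ℕ+) :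
    ∃ ζ < γ, ∀ E ∈ S.family γ, ∀ e ∈ E, e ≤ q → ∀ w : ℕ+ → ℝ≥0∞,
      ∑ n ∈ E, w n ≤ q * wnorm (S.family ζ) ∞ w := by
  classical
  rcases Ordinal.zero_or_succ_or_isSuccLimit γ with rfl | ⟨η, rfl⟩ | hl
  · exact absurd rfl h0
  · refine ⟨η, lt_succ η, fun E hE e he heq w => ?_⟩
    rw [succ_eq_add_one, family_add_one] at hE
    obtain ⟨n, G, -, hG, -, hn, rfl⟩ := hE
    obtain ⟨i, -, hi⟩ := Finset.mem_biUnion.1 he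
    -- One element e ≤ q already bounds the number n of pieces, because n ≤ E.
    have hnq : n ≤ q := (hn i e hi).trans heq
    calc ∑ k ∈ Finset.univ.biUnion G, w k ≤ ∑ i, ∑ k ∈ G i, w k := sum_biUnion_le_sum _ _ _
      _ ≤ ∑ i : Fin n, wnorm (S.family η) ∞ w :=
        Finset.sum_le_sum fun i _ => sum_le_wnorm (S.empty_mem_family η) le_top w (hG i)
      _ = n * wnorm (S.family η) ∞ w := by simp
      _ ≤ q * wnorm (S.family η) ∞ w := by gcongr
  · refine ⟨S.seq γ q + 1, hl.add_one_lt (S.seq_lt γ hl q), fun E hE e he heq w => ?_⟩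
    rw [mem_family_limit S hl] at hE
    obtain ⟨n, hn, hE⟩ := hE
    -- The witness n satisfies n ≤ e ≤ q and the approximating families increase, so the family with
    -- the fixed index q contains E.
    have := S.family_seq_mono hl hγ ((hn e he).trans heq) hE
    refine (sum_le_wnorm (S.empty_mem_family _) le_top w this).trans ?_
    refine le_mul_of_one_le_left' ?_
    exact_mod_cast q.pos

/-- Every set in `𝓢_{γ+δ}` is an `𝓢_δ` union of sets in `𝓢_γ`, up to a fixed spreading. -/
theorem exists_decomposition (γ δ : Ordinal.{0}) (h : γ + δ < ω₁) :
    ∃ f : ℕ+ → ℕ+, StrictMono f ∧ ∀ G ∈ S.family (γ + δ), ∃ τ : ℕ+ → ℕ+,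
      (∀ n ∈ G, τ n ∈ G ∧ τ n ≤ n ∧ τ (τ n) = τ n) ∧
      (∀ t, G.filter (fun n => τ n = t) ∈ S.family γ) ∧ (G.image τ).image f ∈ S.family δ := by
  classical
  -- The fibres of τ on G are the pieces, and τ n is the least element of the piece that contains n;
  -- these minima are what `f` spreads into 𝓢_δ.
  induction δ using WellFoundedLT.induction with
  | ind δ ih =>
  rcases Ordinal.zero_or_succ_or_isSuccLimit δ with rfl | ⟨η, rfl⟩ | hl
  · refine ⟨id, strictMono_id, fun G hG => ?_⟩
    rw [add_zero] at hG
    rcases G.eq_empty_or_nonempty with rfl | hne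
    · exact ⟨id, by simp, fun t => by simpa using hG, by simpa using S.empty_mem_family 0⟩
    · refine ⟨fun _ => G.min' hne, fun n hn => ⟨G.min'_mem hne, G.min'_le _ hn, rfl⟩,
        fun t => family_hereditary hG (Finset.filter_subset _ _), ?_⟩
      refine S.mem_family_of_card_le_one _ _ ?_
      rw [Finset.image_id]
      refine (Finset.card_le_card (t := {G.min' hne}) ?_).trans (by simp)
      intro n hn
      obtain ⟨_, _, rfl⟩ := Finset.mem_image.1 hn
      simp
  · rw [succ_eq_add_one, ← add_assoc] at h
    obtain ⟨f, hf, hfG⟩ := ih η (lt_succ η) ((lt_add_one _).trans h)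
    refine ⟨f, hf, fun G hG => ?_⟩
    rw [succ_eq_add_one, ← add_assoc, family_add_one] at hG
    obtain ⟨N, H, -, hH, hlt, hN, rfl⟩ := hG
    choose τ' h1 h2 h3 using fun i => hfG (H i) (hH i)
    have huniq : ∀ i j n, n ∈ H i → n ∈ H j → i = j := by
      intro i j n hi hj
      rcases lt_trichotomy i j with hij | hij | hij
      · exact absurd (hlt i j hij n hi n hj) (lt_irrefl n)
      · exact hij
      · exact absurd (hlt j i hij n hj n hi) (lt_irrefl n)
    let τ : ℕ+ → ℕ+ := fun n => if h : ∃ i, n ∈ H i then τ' h.choose n else n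
    have hτ : ∀ i, ∀ n ∈ H i, τ n = τ' i n := by
      intro i n hn
      have hex : ∃ i, n ∈ H i := ⟨i, hn⟩
      simp only [τ, dif_pos hex]
      rw [huniq _ _ n hex.choose_spec hn]
    refine ⟨τ, fun n hn => ?_, fun t => ?_, ?_⟩
    · obtain ⟨i, -, hi⟩ := Finset.mem_biUnion.1 hn
      obtain ⟨h4, h5, h6⟩ := h1 i n hi
      rw [hτ i n hi]
      refine ⟨Finset.mem_biUnion.2 ⟨i, Finset.mem_univ i, h4⟩, h5, ?_⟩
      rw [hτ i _ h4, h6]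
    · by_cases ht : ∃ i, t ∈ H i
      · obtain ⟨i, hi⟩ := ht
        refine family_hereditary (h2 i t) fun n hn => ?_
        obtain ⟨hn1, hn2⟩ := Finset.mem_filter.1 hn
        obtain ⟨j, -, hj⟩ := Finset.mem_biUnion.1 hn1
        rw [hτ j n hj] at hn2
        obtain rfl : j = i := huniq j i t (hn2 ▸ (h1 j n hj).1) hi
        exact Finset.mem_filter.2 ⟨hj, hn2⟩
      · convert S.empty_mem_family γ
        rw [Finset.filter_eq_empty_iff]
        intro n hn hn2
        obtain ⟨j, -, hj⟩ := Finset.mem_biUnion.1 hn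
        rw [hτ j n hj] at hn2
        exact ht ⟨j, hn2 ▸ (h1 j n hj).1⟩
    · rw [succ_eq_add_one, family_add_one]
      have := schreierSucc_of_pieces (𝓕 := S.family η) (fun i => ((H i).image (τ' i)).image f)
        (fun i _ => h3 i) ?_ ?_
      · convert this
        ext m
        simp only [Finset.mem_image, Finset.mem_biUnion, Finset.mem_univ, true_and]
        constructor
        · rintro ⟨_, ⟨n, ⟨i, hi⟩, rfl⟩, rfl⟩
          exact ⟨i, _, ⟨n, hi, rfl⟩, by rw [hτ i n hi]⟩
        · rintro ⟨i, _, ⟨n, hi, rfl⟩, rfl⟩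
          exact ⟨_, ⟨n, ⟨i, hi⟩, rfl⟩, by rw [hτ i n hi]⟩
      · intro i j hij a ha b hb
        simp only [Finset.mem_image] at ha hb
        obtain ⟨_, ⟨n, hn, rfl⟩, rfl⟩ := ha
        obtain ⟨_, ⟨n', hn', rfl⟩, rfl⟩ := hb
        exact hf (hlt i j hij _ (h1 i n hn).1 _ (h1 j n' hn').1)
      · intro i a ha
        simp only [Finset.mem_image] at ha
        obtain ⟨_, ⟨n, hn, rfl⟩, rfl⟩ := ha
        exact (hN i _ (h1 i n hn).1).trans hf.le_apply
  · have hl' : IsSuccLimit (γ + δ) := Ordinal.isSuccLimit_add γ hl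
    have hδ : δ < ω₁ := (le_add_self).trans_lt h
    -- The sequences fixed for γ + δ and for δ are unrelated. From n₀ on, however, the ordinals
    -- approximating γ + δ exceed γ and thus have the form γ + δ' with δ' < δ.
    obtain ⟨n₀, hn₀⟩ := S.exists_lt _ hl' h γ (by simpa using hl.bot_lt)
    have hseq : ∀ n : ℕ+, ∃ δ' < δ, S.seq (γ + δ) (max n n₀) + 1 = γ + δ' := by
      intro n
      have h1 : γ ≤ S.seq (γ + δ) (max n n₀) + 1 :=
        (hn₀.le.trans ((S.strictMono _ hl' h).monotone (le_max_right n n₀))).trans le_self_add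
      have h2 := Ordinal.add_sub_cancel_of_le h1
      refine ⟨_, ?_, h2.symm⟩
      rw [← add_lt_add_iff_left γ, h2]
      exact hl'.add_one_lt (S.seq_lt _ hl' _)
    choose δ' hδ' hδ'' using hseq
    choose f hf hfG using fun n => ih (δ' n) (hδ' n) (((add_lt_add_iff_left γ).2 (hδ' n)).trans h)
    choose m hm using fun n => S.family_almost_mono hδ (hδ' n).le
    -- At arguments k ≥ n, `F` dominates both the spreading for δ' n and the threshold beyond which
    -- the family of δ' n is contained in 𝓢_δ. All minima of pieces are ≥ n because n ≤ G.
    obtain ⟨F, hF, hFle⟩ := exists_strictMono_ge fun n k => max (f n k) (m n)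
    refine ⟨F, hF, fun G hG => ?_⟩
    obtain ⟨n, hn, hG⟩ := (mem_family_limit S hl').1 hG
    have hG' := S.family_seq_mono hl' h (le_max_left n n₀) hG
    rw [hδ''] at hG'
    obtain ⟨τ, h1, h2, h3⟩ := hfG n G hG'
    have hτn : ∀ t ∈ G.image τ, n ≤ t := by
      intro t ht
      obtain ⟨k, hk, rfl⟩ := Finset.mem_image.1 ht
      exact hn _ (h1 k hk).1
    refine ⟨τ, h1, h2, hm n _ (family_spread ((hf n).strictMonoOn _) (hF.strictMonoOn _)
      (fun t ht => (le_max_left _ _).trans (hFle n t (hτn t ht))) h3) fun a ha => ?_⟩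
    obtain ⟨t, ht, rfl⟩ := Finset.mem_image.1 ha
    exact (le_max_right _ _).trans (hFle n t (hτn t ht))

/-- The `𝓢_δ` union of sparse sets in `𝓢_γ` belongs to `𝓢_{γ+δ}`. -/
theorem exists_biUnion_mem (γ δ : Ordinal.{0}) (h : γ + δ < ω₁) :
    ∃ g : ℕ+ → ℕ+, StrictMono g ∧ ∀ (K : Finset ℕ+) (ν : ℕ+ → ℕ+) (E : ℕ+ → Finset ℕ+),
      StrictMonoOn ν K → K.image ν ∈ S.family δ → (∀ k ∈ K, E k ∈ S.family γ) →
      (∀ k ∈ K, ∀ e ∈ E k, g (ν k) ≤ e) → (∀ k ∈ K, ∀ k' ∈ K, k < k' → SetLT (E k) (E k')) →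
      K.biUnion E ∈ S.family (γ + δ) := by
  classical
  induction δ using WellFoundedLT.induction with
  | ind δ ih =>
  rcases Ordinal.zero_or_succ_or_isSuccLimit δ with rfl | ⟨η, rfl⟩ | hl
  · refine ⟨id, strictMono_id, fun K ν E hν hK hE _ _ => ?_⟩
    rw [family_zero, Set.mem_ofPred_eq, Finset.card_image_of_injOn hν.injOn] at hK
    rw [add_zero]
    obtain ⟨k, hk⟩ := Finset.card_le_one_iff_subset_singleton.1 hK
    rcases Finset.subset_singleton_iff.1 hk with rfl | rfl
    · simpa using S.empty_mem_family γ
    · simpa using hE k (by simp)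
  · rw [succ_eq_add_one, ← add_assoc] at h
    obtain ⟨g, hg, hgK⟩ := ih η (lt_succ η) ((lt_add_one _).trans h)
    refine ⟨g, hg, fun K ν E hν hK hE hgE hlt => ?_⟩
    rw [succ_eq_add_one, family_add_one] at hK
    rw [succ_eq_add_one, ← add_assoc, family_add_one]
    obtain ⟨N, G, -, hG, hGlt, hN, hGK⟩ := hK
    let T : Fin N → Finset ℕ+ := fun i => K.filter fun k => ν k ∈ G i
    have hT : ∀ i, T i ⊆ K := fun i => Finset.filter_subset _ _
    have := schreierSucc_of_pieces (𝓕 := S.family (γ + η)) (fun i => (T i).biUnion E)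
      (fun i _ => hgK (T i) ν E (hν.mono (hT i)) (family_hereditary (hG i) fun m hm => by
          obtain ⟨k, hk, rfl⟩ := Finset.mem_image.1 hm
          exact (Finset.mem_filter.1 hk).2) (fun k hk => hE k (hT i hk))
          (fun k hk => hgE k (hT i hk)) (fun k hk k' hk' => hlt k (hT i hk) k' (hT i hk'))) ?_ ?_
    · convert this
      ext m
      simp only [Finset.mem_biUnion, Finset.mem_univ, true_and, T, Finset.mem_filter]
      constructor
      · rintro ⟨k, hk, hm⟩
        have : ν k ∈ K.image ν := Finset.mem_image_of_mem _ hk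
        rw [hGK] at this
        obtain ⟨i, -, hi⟩ := Finset.mem_biUnion.1 this
        exact ⟨i, k, ⟨hk, hi⟩, hm⟩
      · rintro ⟨i, k, hk, hm⟩
        exact ⟨k, hk.1, hm⟩
    · intro i j hij a ha b hb
      obtain ⟨k, hk, ha⟩ := Finset.mem_biUnion.1 ha
      obtain ⟨k', hk', hb⟩ := Finset.mem_biUnion.1 hb
      obtain ⟨h1, h2⟩ := Finset.mem_filter.1 hk
      obtain ⟨h1', h2'⟩ := Finset.mem_filter.1 hk'
      exact hlt k h1 k' h1' ((hν.lt_iff_lt h1 h1').1 (hGlt i j hij _ h2 _ h2')) a ha b hb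
    · intro i a ha
      obtain ⟨k, hk, ha⟩ := Finset.mem_biUnion.1 ha
      obtain ⟨h1, h2⟩ := Finset.mem_filter.1 hk
      exact (hN i _ h2).trans (hg.le_apply.trans (hgE k h1 a ha))
  · have hlt : ∀ n, S.seq δ n + 1 < δ := fun n => hl.add_one_lt (S.seq_lt δ hl n)
    have hlt' : ∀ n, γ + (S.seq δ n + 1) < γ + δ := fun n => (add_lt_add_iff_left γ).2 (hlt n)
    choose g hg hgK using fun n => ih _ (hlt n) ((hlt' n).trans h)
    choose m hm using fun n => S.family_almost_mono h (hlt' n).le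
    -- The witness n for the markers ν k is a lower bound of them, so `F` at a marker dominates both
    -- the sparseness required at stage n and the threshold for inclusion in 𝓢_{γ+δ}.
    obtain ⟨F, hF, hFle⟩ := exists_strictMono_ge fun n k => max (g n k) (m n)
    refine ⟨F, hF, fun K ν E hν hK hE hFE hsucc => ?_⟩
    obtain ⟨n, hn, hK⟩ := (mem_family_limit S hl).1 hK
    have hn' : ∀ k ∈ K, max (g n (ν k)) (m n) ≤ F (ν k) := fun k hk =>
      hFle n _ (hn _ (Finset.mem_image_of_mem ν hk))
    refine hm n _ (hgK n K ν E hν hK hE (fun k hk e he => ?_) hsucc) fun e he => ?_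
    · exact (le_max_left _ _).trans ((hn' k hk).trans (hFE k hk e he))
    · obtain ⟨k, hk, he⟩ := Finset.mem_biUnion.1 he
      exact (le_max_right _ _).trans ((hn' k hk).trans (hFE k hk e he))

end SchreierSystem

/-! Convex combinations that are small on a Schreier family. -/

namespace SchreierSystem

variable (S : SchreierSystem)

/-- Average n successive weights, each chosen to have mass at most 1/n on every set of 𝓢_δ that
starts no later than the bound q of the preceding supports. A set of 𝓢_δ then collects at most 1
from the first support it meets and 1/n from each later one, in total at most 2 before division by
n. The n supports lie beyond n, so their union is in 𝓢_{δ+1}. -/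
theorem exists_average_of_forall_bounded {δ : Ordinal.{0}} {N : Set ℕ+}
    (hQ : ∀ (q : ℕ+) (ε : ℝ≥0∞), ε ≠ 0 → ∃ F ∈ S.family δ, (∀ n ∈ F, n ∈ N ∧ q < n) ∧
      ∃ w : ℕ+ → ℝ≥0∞, (∀ n ∉ F, w n = 0) ∧ ∑' n, w n = 1 ∧
        ∀ E ∈ S.family δ, ∀ e ∈ E, e ≤ q → ∑ n ∈ E, w n ≤ ε)
    {ε : ℝ≥0∞} (hε : ε ≠ 0) :
    ∃ F ∈ S.family (δ + 1), (∀ n ∈ F, n ∈ N) ∧ ∃ w : ℕ+ → ℝ≥0∞, (∀ n ∉ F, w n = 0) ∧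
      ∑' n, w n = 1 ∧ ∀ E ∈ S.family δ, ∑ n ∈ E, w n ≤ ε := by
  classical
  obtain ⟨n, hn⟩ : ∃ n : ℕ+, 2 / ε ≤ (n : ℕ) := by
    obtain ⟨k, hk⟩ := ENNReal.exists_nat_gt (ENNReal.div_ne_top ENNReal.ofNat_ne_top hε : 2 / ε ≠ ∞)
    exact ⟨k.succPNat, hk.le.trans (by simp)⟩
  have hn0 : ((n : ℕ) : ℝ≥0∞) ≠ 0 := by simp
  have hnt : ((n : ℕ) : ℝ≥0∞) ≠ ∞ := ENNReal.natCast_ne_top _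
  -- Induction on the number r of weights chosen so far; q bounds their supports, and starting from
  -- q = n keeps all supports beyond n.
  have key : ∀ r : ℕ, ∃ (G : ℕ → Finset ℕ+) (w : ℕ+ → ℝ≥0∞) (q : ℕ+), n ≤ q ∧
      (∀ i < r, G i ∈ S.family δ ∧ ∀ k ∈ G i, k ∈ N ∧ n ≤ k ∧ k ≤ q) ∧
      (∀ i j, i < j → j < r → SetLT (G i) (G j)) ∧ (∀ k, w k ≠ 0 → ∃ i < r, k ∈ G i) ∧
      ∑' k, w k = r ∧ ∀ E ∈ S.family δ, ∑ k ∈ E, w k ≤ 1 + r * (n : ℝ≥0∞)⁻¹ := by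
    intro r
    induction r with
    | zero => exact ⟨fun _ => ∅, 0, n, le_rfl, by simp, by simp, by simp, by simp, by simp⟩
    | succ r ih =>
      obtain ⟨G, w, q, hnq, hG, hlt, hw, hsum, hE⟩ := ih
      obtain ⟨F, hF, hFN, v, hv, hvsum, hvE⟩ := hQ q (n : ℝ≥0∞)⁻¹ (ENNReal.inv_ne_zero.2 hnt)
      obtain ⟨q', hq'⟩ := F.exists_le
      have hGr : ∀ i < r, Function.update G r F i = G i := fun i hi =>
        Function.update_of_ne hi.ne _ _
      refine ⟨Function.update G r F, fun k => w k + v k, max q q', le_max_of_le_left hnq,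
        fun i hi => ?_, fun i j hij hj => ?_, fun k hk => ?_, ?_, fun E hEδ => ?_⟩
      · rcases (Nat.lt_succ_iff_lt_or_eq.1 hi) with h | rfl
        · rw [hGr i h]
          refine ⟨(hG i h).1, fun k hk => ?_⟩
          obtain ⟨h1, h2, h3⟩ := (hG i h).2 k hk
          exact ⟨h1, h2, le_max_of_le_left h3⟩
        · rw [Function.update_self]
          exact ⟨hF, fun k hk => ⟨(hFN k hk).1, hnq.trans (hFN k hk).2.le,
            le_max_of_le_right (hq' k hk)⟩⟩
      · rcases (Nat.lt_succ_iff_lt_or_eq.1 hj) with h | rfl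
        · rw [hGr i (hij.trans h), hGr j h]
          exact hlt i j hij h
        · rw [hGr i hij, Function.update_self]
          intro a ha b hb
          exact ((hG i hij).2 a ha).2.2.trans_lt (hFN b hb).2
      · by_cases hk' : w k = 0
        · refine ⟨r, Nat.lt_succ_self r, ?_⟩
          rw [Function.update_self]
          by_contra hkF
          exact hk (by simp [hk', hv k hkF])
        · obtain ⟨i, hi, hki⟩ := hw k hk'
          exact ⟨i, hi.trans (Nat.lt_succ_self r), by rwa [hGr i hi]⟩
      · rw [ENNReal.tsum_add, hsum, hvsum]
        push_cast
        rfl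
      · rw [Finset.sum_add_distrib]
        by_cases hex : ∃ e ∈ E, e ≤ q
        · obtain ⟨e, he, heq⟩ := hex
          refine (add_le_add (hE E hEδ) (hvE E hEδ e he heq)).trans_eq ?_
          push_cast
          ring
        -- A set lying entirely beyond q misses the earlier supports, so only the new weight counts,
        -- with mass at most 1.
        · push Not at hex
          have h0 : ∑ k ∈ E, w k = 0 := Finset.sum_eq_zero fun k hk => by
            by_contra hk'
            obtain ⟨i, hi, hki⟩ := hw k hk'
            exact absurd ((hG i hi).2 k hki).2.2 (not_le.2 (hex k hk))
          rw [h0, zero_add]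
          exact (ENNReal.sum_le_tsum E).trans (hvsum.le.trans le_self_add)
  obtain ⟨G, w, q, hnq, hG, hlt, hw, hsum, hE⟩ := key n
  refine ⟨Finset.univ.biUnion fun i : Fin n => G i, ?_, fun k hk => ?_,
    fun k => (n : ℝ≥0∞)⁻¹ * w k, fun k hk => ?_, ?_, fun E hEδ => ?_⟩
  · rw [family_add_one]
    exact schreierSucc_of_pieces (fun i : Fin n => G i) (fun i _ => (hG i i.2).1)
      (fun i j hij => hlt i j hij j.2) (fun i k hk => ((hG i i.2).2 k hk).2.1)
  · obtain ⟨i, -, hi⟩ := Finset.mem_biUnion.1 hk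
    exact ((hG i i.2).2 k hi).1
  · rw [mul_eq_zero]
    right
    by_contra hk'
    obtain ⟨i, hi, hki⟩ := hw k hk'
    exact hk (Finset.mem_biUnion.2 ⟨⟨i, hi⟩, Finset.mem_univ _, hki⟩)
  · rw [ENNReal.tsum_mul_left, hsum]
    exact ENNReal.inv_mul_cancel hn0 hnt
  · rw [← Finset.mul_sum]
    refine (mul_le_mul_right (hE E hEδ) _).trans ?_
    rw [ENNReal.mul_inv_cancel hn0 hnt, one_add_one_eq_two, mul_comm, ← div_eq_mul_inv]
    rw [ENNReal.div_le_iff hn0 hnt, mul_comm]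
    exact (ENNReal.div_le_iff_le_mul (Or.inl hε) (Or.inr (by simp))).1 hn

/-- Every infinite set contains a set in `𝓢_{δ+1}` that carries a convex combination which is small
on `𝓢_δ`. -/
theorem exists_average {δ : Ordinal.{0}} (hδ : δ < ω₁) {N : Set ℕ+} (hN : ∀ q, ∃ n ∈ N, q < n)
    {ε : ℝ≥0∞} (hε : ε ≠ 0) :
    ∃ F ∈ S.family (δ + 1), (∀ n ∈ F, n ∈ N) ∧ ∃ w : ℕ+ → ℝ≥0∞, (∀ n ∉ F, w n = 0) ∧
      ∑' n, w n = 1 ∧ ∀ E ∈ S.family δ, ∑ n ∈ E, w n ≤ ε := by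
  classical
  induction δ using WellFoundedLT.induction generalizing N ε with
  | ind δ ih =>
  refine S.exists_average_of_forall_bounded (fun q ε' hε' => ?_) hε
  rcases eq_or_ne δ 0 with rfl | h0
  · obtain ⟨n, hn, hqn⟩ := hN q
    refine ⟨{n}, S.singleton_mem_family 0 n, by simp [hn, hqn], Pi.single n 1, fun k hk => ?_, ?_,
      fun E hE e he heq => ?_⟩
    · exact Pi.single_eq_of_ne (by simpa using hk) _
    · exact tsum_pi_single n 1
    · rw [family_zero] at hE
      obtain ⟨a, ha⟩ := Finset.card_le_one_iff_subset_singleton.1 hE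
      rw [Finset.sum_eq_zero]
      · exact zero_le
      · intro k hk
        have h1 : k = a := by simpa using ha hk
        have h2 : e = a := by simpa using ha he
        have : k ≠ n := by
          rintro rfl
          exact absurd hqn (not_lt.2 (h1 ▸ h2 ▸ heq))
        exact Pi.single_eq_of_ne this _
  -- Sets of 𝓢_δ starting at or before q are controlled by q times the norm of one smaller family
  -- 𝓢_ζ, so the induction hypothesis for ζ with ε'/q suffices. Its support is in 𝓢_{ζ+1}, which is
  -- inside 𝓢_δ beyond m.
  · obtain ⟨ζ, hζ, hcov⟩ := S.exists_sum_le_wnorm hδ h0 q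
    obtain ⟨m, hm⟩ := S.family_almost_mono hδ (add_one_le_of_lt hζ)
    have hN' : ∀ r, ∃ n ∈ N ∩ {n | max m q < n}, r < n := fun r => by
      obtain ⟨n, hn, hr⟩ := hN (max r (max m q))
      exact ⟨n, ⟨hn, (le_max_right _ _).trans_lt hr⟩, (le_max_left _ _).trans_lt hr⟩
    have hq0 : ((q : ℕ) : ℝ≥0∞) ≠ 0 := by simp
    have hqt : ((q : ℕ) : ℝ≥0∞) ≠ ∞ := ENNReal.natCast_ne_top _
    obtain ⟨F, hF, hFN, w, hw, hsum, hwE⟩ := ih ζ hζ (hζ.trans hδ) hN'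
      (ENNReal.div_ne_zero.2 ⟨hε', hqt⟩)
    refine ⟨F, hm F hF fun k hk => ((le_max_left _ _).trans_lt (hFN k hk).2).le,
      fun k hk => ⟨(hFN k hk).1, (le_max_right _ _).trans_lt (hFN k hk).2⟩, w, hw, hsum,
      fun E hE e he heq => ?_⟩
    refine (hcov E hE e he heq w).trans ?_
    refine (mul_le_mul_right (wnorm_top_le hwE) _).trans_eq ?_
    exact ENNReal.mul_div_cancel hq0 hqt

end SchreierSystem

/-! Norms of combinations of successive blocks. A sequence of blocks is given by a weight `y` and a
monotone function `idx`, the `k`-th block being the restriction of `y` to `{n | idx n = k}`. -/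

/-- Each test set is split into its part in the first block it meets and the remainder. The first
parts, grouped by block, cost C times the ℓ_p norm of A. The remainders of distinct test sets occupy
successive sets of blocks: there the blocks in K cost C times the norm of A, and all others together
cost at most the sum of ε times the norm. This gives 2C + 1. -/
theorem wnorm_block_le {𝓕 𝓖 : Set (Finset ℕ+)} (h𝓕0 : ∅ ∈ 𝓕)
    (hher : ∀ E ∈ 𝓕, ∀ F ⊆ E, F ∈ 𝓕) (h𝓖0 : ∅ ∈ 𝓖) (h𝓖1 : ∀ n, {n} ∈ 𝓖) {p : ℝ≥0∞} (hp : 1 ≤ p)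
    {idx : ℕ+ → ℕ+} (hidx : Monotone idx) {y : ℕ+ → ℝ≥0∞} {ε : ℕ+ → ℝ≥0∞} {C : ℝ≥0∞}
    (hC : ∀ k, wnorm 𝓕 p (fun n => if idx n = k then y n else 0) ≤ C)
    (hU : ∀ G ∈ 𝓕, ∃ K ∈ 𝓖, K ⊆ G.image idx ∧
      ∀ k ∉ K, ∑ n ∈ G, (if idx n = k then y n else 0) ≤ ε k)
    (hε : ∑' k, ε k ≤ 1) (A : ℕ+ → ℝ≥0∞) :
    wnorm 𝓕 p (fun n => A (idx n) * y n) ≤ (2 * C + 1) * wnorm 𝓖 p A := by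
  classical
  refine wnorm_le fun G hG hlt => ?_
  -- Index of the first block met by `G l`; the value 1 for an empty set plays no role.
  let κ : ℕ → ℕ+ := fun l => if h : (G l).Nonempty then idx ((G l).min' h) else 1
  have hκ : ∀ l, ∀ n ∈ G l, κ l ≤ idx n := fun l n hn => by
    have h : (G l).Nonempty := ⟨n, hn⟩
    simp only [κ, dif_pos h]
    exact hidx ((G l).min'_le n hn)
  have hκmem : ∀ l, (G l).Nonempty → ∃ n ∈ G l, κ l = idx n := fun l h =>
    ⟨_, (G l).min'_mem h, by simp only [κ, dif_pos h]⟩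
  let R : ℕ → Finset ℕ+ := fun l => (G l).filter fun n => idx n ≠ κ l
  have hR : ∀ l, R l ∈ 𝓕 := fun l => hher _ (hG l) _ (Finset.filter_subset _ _)
  -- Two successive test sets may share a block, but only as the first block of the later one.
  -- Removing first blocks makes the block indices strictly successive.
  have hRlt : ∀ i j, i < j → SetLT ((R i).image idx) ((R j).image idx) := by
    intro i j hij a ha b hb
    obtain ⟨n, hn, rfl⟩ := Finset.mem_image.1 ha
    obtain ⟨n', hn', rfl⟩ := Finset.mem_image.1 hb
    obtain ⟨h1, h2⟩ := Finset.mem_filter.1 hn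
    obtain ⟨h1', h2'⟩ := Finset.mem_filter.1 hn'
    obtain ⟨e, he, heκ⟩ := hκmem j ⟨n', h1'⟩
    calc idx n ≤ idx e := hidx (hlt i j hij n h1 e he).le
      _ = κ j := heκ.symm
      _ < idx n' := lt_of_le_of_ne (hκ j n' h1') h2'.symm
  choose K hK hKsub hKy using fun l => hU (R l) (hR l)
  have hsplit : ∀ l, ∑ n ∈ G l, A (idx n) * y n =
      A (κ l) * ∑ n ∈ G l, (if idx n = κ l then y n else 0) + ∑ n ∈ R l, A (idx n) * y n := by
    intro l
    rw [← Finset.sum_filter_add_sum_filter_not (G l) (fun n => idx n = κ l), Finset.mul_sum]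
    congr 1
    rw [Finset.sum_filter]
    refine Finset.sum_congr rfl fun n _ => ?_
    split_ifs with h
    · rw [h]
    · simp
  have hAle : ∀ k, A k ≤ wnorm 𝓖 p A := fun k => by
    simpa using sum_le_wnorm h𝓖0 hp A (h𝓖1 k)
  set a := wnorm 𝓖 p A with ha
  have hrest : ∀ l, ∑ n ∈ R l, A (idx n) * y n ≤
      C * ∑ k ∈ K l, A k + a * ∑ k ∈ (R l).image idx, ε k := by
    intro l
    rw [← Finset.sum_fiberwise_of_maps_to (t := (R l).image idx)
      (fun n hn => Finset.mem_image_of_mem idx hn)]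
    have hterm : ∀ k, ∑ n ∈ (R l).filter (fun n => idx n = k), A (idx n) * y n ≤
        (if k ∈ K l then C * A k else 0) + a * ε k := by
      intro k
      have : ∑ n ∈ (R l).filter (fun n => idx n = k), A (idx n) * y n =
          A k * ∑ n ∈ R l, (if idx n = k then y n else 0) := by
        rw [Finset.sum_filter, Finset.mul_sum]
        refine Finset.sum_congr rfl fun n _ => ?_
        split_ifs with h
        · rw [h]
        · simp
      rw [this]
      split_ifs with hk
      · refine le_trans ?_ (le_self_add : C * A k ≤ C * A k + a * ε k)
        rw [mul_comm]
        exact mul_le_mul_left ((sum_le_wnorm h𝓕0 hp _ (hR l)).trans (hC k)) _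
      · rw [zero_add]
        exact mul_le_mul' (hAle k) (hKy l k hk)
    refine (Finset.sum_le_sum fun k _ => hterm k).trans ?_
    rw [Finset.sum_add_distrib, ← Finset.mul_sum, ← Finset.sum_filter, ← Finset.mul_sum]
    have hsub : ((R l).image idx).filter (· ∈ K l) ⊆ K l := fun k hk => (Finset.mem_filter.1 hk).2
    exact add_le_add_left (mul_le_mul_right (Finset.sum_le_sum_of_subset hsub) C) _
  have h1 : lpAgg p (fun l => A (κ l) * ∑ n ∈ G l, (if idx n = κ l then y n else 0)) ≤ C * a := by
    refine (lpAgg_le_fiberwise hp κ _).trans ?_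
    rw [ha, ← wnorm_mul_left 𝓖 hp]
    refine le_trans (lpAgg_mono fun k => ?_) (lpAgg_le_wnorm_of_singleton h𝓖1 _)
    calc _ ≤ lpAgg p (fun l => A k * ∑ n ∈ G l, (if idx n = k then y n else 0)) := by
          refine lpAgg_mono fun l => ?_
          split_ifs with h
          · rw [h]
          · exact zero_le
      _ = A k * lpAgg p (fun l => ∑ n ∈ G l, (if idx n = k then y n else 0)) :=
        lpAgg_mul_left hp _ _
      _ ≤ C * A k := by
        rw [mul_comm]
        exact mul_le_mul_left ((lpAgg_le_wnorm _ hG hlt).trans (hC k)) _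
  have h2 : lpAgg p (fun l => C * ∑ k ∈ K l, A k) ≤ C * a := by
    rw [lpAgg_mul_left hp]
    refine mul_le_mul_right (lpAgg_le_wnorm A hK fun i j hij u hu v hv => ?_) _
    exact hRlt i j hij u (hKsub i hu) v (hKsub j hv)
  have h3 : lpAgg p (fun l => a * ∑ k ∈ (R l).image idx, ε k) ≤ a := by
    rw [lpAgg_mul_left hp]
    refine mul_le_of_le_one_right' ?_
    exact (lpAgg_le_tsum hp _).trans ((tsum_sum_le_tsum hRlt ε).trans hε)
  calc lpAgg p (fun l => ∑ n ∈ G l, A (idx n) * y n)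
      ≤ lpAgg p (fun l => A (κ l) * ∑ n ∈ G l, (if idx n = κ l then y n else 0) +
          (C * ∑ k ∈ K l, A k + a * ∑ k ∈ (R l).image idx, ε k)) :=
        lpAgg_mono fun l => (hsplit l).trans_le (add_le_add_right (hrest l) _)
    _ ≤ C * a + (C * a + a) := (lpAgg_add_le hp _ _).trans
        (add_le_add h1 ((lpAgg_add_le hp _ _).trans (add_le_add h2 h3)))
    _ = _ := by ring

/-- The factor 2 pays for the least index of each test set. In the application E_k starts only
beyond a point determined by the preceding index, so the least index, having no predecessor in the
set, is tested separately. -/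
theorem le_wnorm_block {𝓕 𝓖 : Set (Finset ℕ+)} (h𝓕0 : ∅ ∈ 𝓕) {p : ℝ≥0∞} (hp : 1 ≤ p)
    {idx : ℕ+ → ℕ+} (hidx : Monotone idx) {y : ℕ+ → ℝ≥0∞} {c : ℝ≥0∞} {E : ℕ+ → Finset ℕ+}
    (hE : ∀ k, ∀ n ∈ E k, idx n = k) (hE𝓕 : ∀ k, E k ∈ 𝓕) (hc : ∀ k, c ≤ ∑ n ∈ E k, y n)
    (hK : ∀ F ∈ 𝓖, ∀ h : F.Nonempty, (F.erase (F.min' h)).biUnion E ∈ 𝓕) (A : ℕ+ → ℝ≥0∞) :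
    c * wnorm 𝓖 p A ≤ 2 * wnorm 𝓕 p (fun n => A (idx n) * y n) := by
  classical
  rw [← wnorm_mul_left 𝓖 hp]
  refine wnorm_le fun F hF hlt => ?_
  set w : ℕ+ → ℝ≥0∞ := fun n => A (idx n) * y n
  have hElt : ∀ k k', k < k' → SetLT (E k) (E k') := fun k k' h a ha b hb => by
    refine hidx.reflect_lt ?_
    rwa [hE k a ha, hE k' b hb]
  have hEw : ∀ k, c * A k ≤ ∑ n ∈ E k, w n := fun k => by
    calc c * A k ≤ A k * ∑ n ∈ E k, y n := by
          rw [mul_comm]; exact mul_le_mul_right (hc k) _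
      _ = ∑ n ∈ E k, w n := by
        rw [Finset.mul_sum]
        exact Finset.sum_congr rfl fun n hn => by simp only [w, hE k n hn]
  let H : ℕ → Finset ℕ+ := fun l => if h : (F l).Nonempty then E ((F l).min' h) else ∅
  let H' : ℕ → Finset ℕ+ := fun l =>
    if h : (F l).Nonempty then ((F l).erase ((F l).min' h)).biUnion E else ∅
  have hmem : ∀ l, ∀ n ∈ H l, ∃ k ∈ F l, n ∈ E k := fun l n hn => by
    by_cases h : (F l).Nonempty
    · simp only [H, dif_pos h] at hn
      exact ⟨_, (F l).min'_mem h, hn⟩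
    · simp [H, dif_neg h] at hn
  have hmem' : ∀ l, ∀ n ∈ H' l, ∃ k ∈ F l, n ∈ E k := fun l n hn => by
    by_cases h : (F l).Nonempty
    · simp only [H', dif_pos h] at hn
      obtain ⟨k, hk, hn⟩ := Finset.mem_biUnion.1 hn
      exact ⟨k, Finset.mem_of_mem_erase hk, hn⟩
    · simp [H', dif_neg h] at hn
  have hH𝓕 : ∀ l, H l ∈ 𝓕 := fun l => by
    simp only [H]
    split_ifs
    exacts [hE𝓕 _, h𝓕0]
  have hH'𝓕 : ∀ l, H' l ∈ 𝓕 := fun l => by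
    simp only [H']
    split_ifs with h
    exacts [hK _ (hF l) h, h𝓕0]
  have hHlt : ∀ i j, i < j → SetLT (H i) (H j) := fun i j hij a ha b hb => by
    obtain ⟨k, hk, ha⟩ := hmem i a ha
    obtain ⟨k', hk', hb⟩ := hmem j b hb
    exact hElt k k' (hlt i j hij k hk k' hk') a ha b hb
  have hHlt' : ∀ i j, i < j → SetLT (H' i) (H' j) := fun i j hij a ha b hb => by
    obtain ⟨k, hk, ha⟩ := hmem' i a ha
    obtain ⟨k', hk', hb⟩ := hmem' j b hb
    exact hElt k k' (hlt i j hij k hk k' hk') a ha b hb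
  calc lpAgg p (fun l => ∑ k ∈ F l, c * A k)
      ≤ lpAgg p (fun l => ∑ n ∈ H l, w n + ∑ n ∈ H' l, w n) := by
        refine lpAgg_mono fun l => ?_
        by_cases h : (F l).Nonempty
        · simp only [H, H', dif_pos h]
          rw [← Finset.add_sum_erase _ _ ((F l).min'_mem h)]
          refine add_le_add (hEw _) ?_
          rw [Finset.sum_biUnion]
          · exact Finset.sum_le_sum fun k _ => hEw k
          · intro k _ k' _ hkk'
            refine Finset.disjoint_left.2 fun n hn hn' => hkk' ?_
            rw [← hE k n hn, hE k' n hn']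
        · rw [Finset.not_nonempty_iff_eq_empty.1 h]
          simp
    _ ≤ wnorm 𝓕 p w + wnorm 𝓕 p w := (lpAgg_add_le hp _ _).trans
        (add_le_add (lpAgg_le_wnorm w hH𝓕 hHlt) (lpAgg_le_wnorm w hH'𝓕 hHlt'))
    _ = _ := (two_mul _).symm

theorem wnorm_rpow_eq_iSup {p : ℝ≥0∞} (hp : 1 ≤ p) (hp' : p ≠ ∞) (𝓕 : Set (Finset ℕ+))
    (w : ℕ+ → ℝ≥0∞) : wnorm 𝓕 p w ^ p.toReal =
      ⨆ E : {E : ℕ → Finset ℕ+ // (∀ i, E i ∈ 𝓕) ∧ ∀ i j, i < j → SetLT (E i) (E j)},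
        ∑' i, (∑ n ∈ E.1 i, w n) ^ p.toReal := by
  have hpos := toReal_pos_of_one_le hp hp'
  have h1 : wnorm 𝓕 p w =
      ⨆ E : {E : ℕ → Finset ℕ+ // (∀ i, E i ∈ 𝓕) ∧ ∀ i j, i < j → SetLT (E i) (E j)},
        lpAgg p (fun i => ∑ n ∈ E.1 i, w n) := by
    refine le_antisymm (wnorm_le fun E hE hlt => ?_) (iSup_le fun E => ?_)
    · exact le_iSup_of_le (⟨E, hE, hlt⟩ :
        {E : ℕ → Finset ℕ+ // (∀ i, E i ∈ 𝓕) ∧ ∀ i j, i < j → SetLT (E i) (E j)}) le_rfl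
    · exact lpAgg_le_wnorm w E.2.1 E.2.2
  have h2 := (ENNReal.orderIsoRpow p.toReal hpos).map_iSup
    fun E : {E : ℕ → Finset ℕ+ // (∀ i, E i ∈ 𝓕) ∧ ∀ i j, i < j → SetLT (E i) (E j)} =>
      lpAgg p (fun i => ∑ n ∈ E.1 i, w n)
  simp only [ENNReal.orderIsoRpow_apply, lpAgg_rpow hp hp'] at h2
  rw [h1, h2]

/-- Superadditivity of the `p`-th power of the norm on successively supported weights. -/
theorem wnorm_rpow_add_le {𝓕 : Set (Finset ℕ+)} (h𝓕0 : ∅ ∈ 𝓕)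
    (hher : ∀ E ∈ 𝓕, ∀ F ⊆ E, F ∈ 𝓕) {p : ℝ≥0∞} (hp : 1 ≤ p) (hp' : p ≠ ∞) {w w' : ℕ+ → ℝ≥0∞}
    (hfin : {n | w n ≠ 0}.Finite) (hlt : ∀ n n', w n ≠ 0 → w' n' ≠ 0 → n < n') :
    wnorm 𝓕 p w ^ p.toReal + wnorm 𝓕 p w' ^ p.toReal ≤
      wnorm 𝓕 p (fun n => w n + w' n) ^ p.toReal := by
  classical
  have hpos := toReal_pos_of_one_le hp hp'
  rw [wnorm_rpow_eq_iSup hp hp' 𝓕 w, wnorm_rpow_eq_iSup hp hp' 𝓕 w']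
  have hne : Nonempty {E : ℕ → Finset ℕ+ // (∀ i, E i ∈ 𝓕) ∧ ∀ i j, i < j → SetLT (E i) (E j)} :=
    ⟨fun _ => ∅, fun _ => h𝓕0, fun i j _ u hu => by simp at hu⟩
  refine ENNReal.iSup_add_iSup_le ?_
  rintro ⟨E, hE, hElt⟩ ⟨E', hE', hElt'⟩
  dsimp only
  have hM : ∀ n : ℕ+, ∃ M : ℕ, ∀ i, n ∈ E i → i ≤ M := by
    intro n
    by_cases h : ∃ i, n ∈ E i
    · obtain ⟨i, hi⟩ := h
      refine ⟨i, fun j hj => ?_⟩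
      by_contra hij
      exact lt_irrefl _ (hElt i j (not_le.1 hij) n hi n hj)
    · exact ⟨0, fun i hi => absurd ⟨i, hi⟩ h⟩
  choose M hM using hM
  -- From N on the first test sequence misses the finite support of w, so the second one can be
  -- appended there; filtering by the supports makes the joined sequence successive.
  set N : ℕ := hfin.toFinset.sup M + 1
  have hN : ∀ i, N ≤ i → ∑ n ∈ E i, w n = 0 := fun i hi => Finset.sum_eq_zero fun n hn => by
    by_contra h
    have h1 := Finset.le_sup (f := M) (hfin.mem_toFinset.2 h)
    have h2 := hM n i hn
    omega
  let D : ℕ → Finset ℕ+ := fun i =>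
    if i < N then (E i).filter (fun n => w n ≠ 0) else (E' (i - N)).filter (fun n => w' n ≠ 0)
  have hD𝓕 : ∀ i, D i ∈ 𝓕 := fun i => by
    simp only [D]
    split_ifs
    exacts [hher _ (hE _) _ (Finset.filter_subset _ _), hher _ (hE' _) _ (Finset.filter_subset _ _)]
  have hDlt : ∀ i j, i < j → SetLT (D i) (D j) := fun i j hij a ha b hb => by
    simp only [D] at ha hb
    by_cases hj : j < N
    · rw [if_pos (hij.trans hj)] at ha
      rw [if_pos hj] at hb
      exact hElt i j hij a (Finset.mem_filter.1 ha).1 b (Finset.mem_filter.1 hb).1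
    · rw [if_neg hj] at hb
      by_cases hi : i < N
      · rw [if_pos hi] at ha
        exact hlt a b (Finset.mem_filter.1 ha).2 (Finset.mem_filter.1 hb).2
      · rw [if_neg hi] at ha
        exact hElt' (i - N) (j - N) (by omega) a (Finset.mem_filter.1 ha).1 b
          (Finset.mem_filter.1 hb).1
  have h1 : ∑' i, (∑ n ∈ E i, w n) ^ p.toReal = ∑ i ∈ Finset.range N,
      (∑ n ∈ E i, w n) ^ p.toReal := tsum_eq_sum fun i hi => by
    rw [hN i (by simpa using hi), ENNReal.zero_rpow_of_pos hpos]
  rw [h1]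
  have h2 : ∑' i, (∑ n ∈ D i, (w n + w' n)) ^ p.toReal ≤
      wnorm 𝓕 p (fun n => w n + w' n) ^ p.toReal := by
    rw [← lpAgg_rpow hp hp']
    exact ENNReal.rpow_le_rpow (lpAgg_le_wnorm _ hD𝓕 hDlt) hpos.le
  refine le_trans ?_ h2
  rw [← Summable.sum_add_tsum_nat_add' (f := fun i => (∑ n ∈ D i, (w n + w' n)) ^ p.toReal)
    (k := N) ENNReal.summable]
  refine add_le_add (Finset.sum_le_sum fun i hi => ?_) (ENNReal.tsum_le_tsum fun i => ?_)
  · refine ENNReal.rpow_le_rpow ?_ hpos.le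
    simp only [D, if_pos (Finset.mem_range.1 hi)]
    rw [Finset.sum_filter]
    refine Finset.sum_le_sum fun n _ => ?_
    split_ifs with h
    · exact le_self_add
    · exact (not_not.1 h).le
  · refine ENNReal.rpow_le_rpow ?_ hpos.le
    simp only [D, if_neg (show ¬ i + N < N by omega), Nat.add_sub_cancel]
    rw [Finset.sum_filter]
    refine Finset.sum_le_sum fun n _ => ?_
    split_ifs with h
    · exact le_add_self
    · exact (not_not.1 h).le

/-- Lower ℓ_p estimate from superadditivity, adding finite blocks one at a time at the right end. -/
theorem le_wnorm_block_of_le_wnorm {𝓕 : Set (Finset ℕ+)} (h𝓕0 : ∅ ∈ 𝓕)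
    (hher : ∀ E ∈ 𝓕, ∀ F ⊆ E, F ∈ 𝓕) {p : ℝ≥0∞} (hp : 1 ≤ p) (hp' : p ≠ ∞) {idx : ℕ+ → ℕ+}
    (hidx : Monotone idx) (hfin : ∀ k, {n | idx n = k}.Finite) {y : ℕ+ → ℝ≥0∞} {c : ℝ≥0∞}
    (hc : ∀ k, c ≤ wnorm 𝓕 p (fun n => if idx n = k then y n else 0)) (A : ℕ+ → ℝ≥0∞) :
    c * lpAgg p A ≤ wnorm 𝓕 p (fun n => A (idx n) * y n) := by
  classical
  have hpos := toReal_pos_of_one_le hp hp'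
  have key : ∀ s : Finset ℕ+, ∑ k ∈ s, (c * A k) ^ p.toReal ≤
      wnorm 𝓕 p (fun n => if idx n ∈ s then A (idx n) * y n else 0) ^ p.toReal := by
    intro s
    induction s using Finset.induction_on_max with
    | empty => simp
    | insert a s hs ih =>
      have ha : a ∉ s := fun h => lt_irrefl _ (hs a h)
      rw [Finset.sum_insert ha, add_comm]
      have hca : c * A a ≤ wnorm 𝓕 p (fun n => if idx n = a then A (idx n) * y n else 0) := by
        calc c * A a ≤ A a * wnorm 𝓕 p (fun n => if idx n = a then y n else 0) := by
              rw [mul_comm]; exact mul_le_mul_right (hc a) _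
          _ = _ := by
            rw [← wnorm_mul_left 𝓕 hp]
            congr 1
            funext n
            split_ifs with h
            · rw [h]
            · simp
      refine (add_le_add ih (ENNReal.rpow_le_rpow hca hpos.le)).trans ?_
      refine (wnorm_rpow_add_le h𝓕0 hher hp hp' ?_ ?_).trans ?_
      · refine (s.finite_toSet.biUnion fun k _ => hfin k).subset fun n hn => ?_
        have : idx n ∈ s := by
          by_contra h
          exact hn (if_neg h)
        simpa using this
      · intro n n' hn hn'
        have h1 : idx n ∈ s := by
          by_contra h
          exact hn (if_neg h)
        have h2 : idx n' = a := by
          by_contra h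
          exact hn' (if_neg h)
        exact hidx.reflect_lt (h2 ▸ hs _ h1)
      · refine ENNReal.rpow_le_rpow (wnorm_mono fun n => ?_) hpos.le
        by_cases h1 : idx n ∈ s
        · have h2 : idx n ≠ a := fun h => ha (h ▸ h1)
          simp [h1, h2]
        · by_cases h2 : idx n = a
          · simp [h2, ha]
          · simp [h1, h2]
  rw [← ENNReal.rpow_le_rpow_iff hpos, ENNReal.mul_rpow_of_nonneg _ _ hpos.le, lpAgg_rpow hp hp',
    ← ENNReal.tsum_mul_left]
  simp only [← ENNReal.mul_rpow_of_nonneg _ _ hpos.le]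
  rw [ENNReal.tsum_eq_iSup_sum]
  refine iSup_le fun s => (key s).trans (ENNReal.rpow_le_rpow (wnorm_mono fun n => ?_) hpos.le)
  split_ifs
  exacts [le_rfl, zero_le]

theorem wnorm_add_le (𝓕 : Set (Finset ℕ+)) {p : ℝ≥0∞} (hp : 1 ≤ p) (w w' : ℕ+ → ℝ≥0∞) :
    wnorm 𝓕 p (fun n => w n + w' n) ≤ wnorm 𝓕 p w + wnorm 𝓕 p w' :=
  wnorm_le fun E hE hlt => by
    simp only [Finset.sum_add_distrib]
    exact (lpAgg_add_le hp _ _).trans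
      (add_le_add (lpAgg_le_wnorm w hE hlt) (lpAgg_le_wnorm w' hE hlt))

theorem wnorm_le_tsum (𝓕 : Set (Finset ℕ+)) {p : ℝ≥0∞} (hp : 1 ≤ p) (w : ℕ+ → ℝ≥0∞) :
    wnorm 𝓕 p w ≤ ∑' n, w n :=
  wnorm_le fun _ _ hlt => (lpAgg_le_tsum hp _).trans (tsum_sum_le_tsum hlt w)

theorem familyENorm_sum_le {𝕜 : Type*} [RCLike 𝕜] (𝓕 : Set (Finset ℕ+)) {p : ℝ≥0∞} (hp : 1 ≤ p)
    {ι : Type*} (s : Finset ι) (f : ι → ℕ+ → 𝕜) :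
    familyENorm 𝓕 p (∑ i ∈ s, f i) ≤ ∑ i ∈ s, familyENorm 𝓕 p (f i) := by
  classical
  induction s using Finset.induction_on with
  | empty => simp [familyENorm_zero 𝓕 hp]
  | insert i s hi ih =>
    rw [Finset.sum_insert hi, Finset.sum_insert hi]
    exact (familyENorm_add_le 𝓕 hp _ _).trans (add_le_add_right ih _)

/-! ### Inductive choice of subsequences and division into blocks. -/

theorem PNat.strictMono_of_lt_add_one {f : ℕ+ → ℕ+} (h : ∀ k, f k < f (k + 1)) : StrictMono f := by
  intro k k' hlt
  induction k' using PNat.recOn with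
  | one => exact absurd hlt (not_lt.2 one_le)
  | succ j ih =>
    rcases (PNat.lt_add_one_iff.1 hlt).eq_or_lt with rfl | h'
    · exact h k
    · exact (ih h').trans (h j)

/-- Two sequences of positive integers chosen alternately. -/
theorem exists_alternating_choice {R : ℕ+ → ℕ+ → Prop} {T : ℕ+ → ℕ+ → ℕ+ → Prop}
    (hR : ∀ q N, ∃ n, N < n ∧ R q n) (hT : ∀ q n, R q n → ∃ h, q < h ∧ T q n h) :
    ∃ φ q h : ℕ+ → ℕ+, StrictMono φ ∧ StrictMono q ∧ StrictMono h ∧ (∀ k, R (q k) (φ k)) ∧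
      (∀ k, T (q k) (φ k) (h k)) ∧ (∀ k, q (k + 1) = h k) ∧ ∀ k, q k < h k := by
  choose nn hnn hnR using hR
  choose hh hhq hhT using hT
  -- The state consists of the last index chosen and the current bound q; the pair (1, 1) only
  -- starts the recursion.
  let st : ℕ+ → ℕ+ × ℕ+ := fun k =>
    PNat.recOn k (1, 1) fun _ s => (nn s.2 s.1, hh s.2 (nn s.2 s.1) (hnR s.2 s.1))
  have hst : ∀ k, st (k + 1) = (nn (st k).2 (st k).1,
      hh (st k).2 (nn (st k).2 (st k).1) (hnR (st k).2 (st k).1)) := fun k => by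
    simp only [st, PNat.recOn_succ]
  have h1 : ∀ k, (st (k + 1)).2 = hh (st k).2 (nn (st k).2 (st k).1) (hnR (st k).2 (st k).1) :=
    fun k => by rw [hst k]
  refine ⟨fun k => nn (st k).2 (st k).1, fun k => (st k).2,
    fun k => hh (st k).2 (nn (st k).2 (st k).1) (hnR (st k).2 (st k).1), ?_, ?_, ?_,
    fun k => hnR _ _, fun k => hhT _ _ _, h1, fun k => hhq _ _ _⟩
  · refine PNat.strictMono_of_lt_add_one fun k => ?_
    have h2 : (st (k + 1)).1 = nn (st k).2 (st k).1 := by rw [hst k]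
    rw [← h2]
    exact hnn _ _
  · refine PNat.strictMono_of_lt_add_one fun k => ?_
    rw [h1]
    exact hhq _ _ _
  · refine PNat.strictMono_of_lt_add_one fun k => ?_
    rw [← h1]
    exact hhq _ _ _

/-- The index of n is the least k with n ≤ h k, so the k-th block is the interval that ends at h k
and begins after the previous end. -/
theorem exists_block_index {h : ℕ+ → ℕ+} (hh : StrictMono h) :
    ∃ idx : ℕ+ → ℕ+, Monotone idx ∧ ∀ n k, idx n ≤ k ↔ n ≤ h k := by
  have hex : ∀ n, ∃ k, n ≤ h k := fun n => ⟨n, hh.le_apply⟩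
  have hiff : ∀ n k, PNat.find (hex n) ≤ k ↔ n ≤ h k := fun n k =>
    ⟨fun hk => (PNat.find_spec (hex n)).trans (hh.monotone hk), fun hk => PNat.find_min' (hex n) hk⟩
  exact ⟨fun n => PNat.find (hex n), fun n n' hn =>
    (hiff n _).2 (hn.trans ((hiff n' _).1 le_rfl)), hiff⟩

/-! ### Block subsequences in X_{ξ,p} and their perturbations. -/

namespace SchreierSpace

variable {S : SchreierSystem} {𝕜 : Type*} [RCLike 𝕜] {ξ : Ordinal.{0}} {p : ℝ≥0∞}
  [hp : Fact (1 ≤ p)]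

/-- The coordinates as a linear map. -/
def coordLinear : SchreierSpace S 𝕜 ξ p →ₗ[𝕜] (ℕ+ → 𝕜) where
  toFun := coord
  map_add' := coord_add
  map_smul' := coord_smul

theorem enorm_eq_wnorm (x : SchreierSpace S 𝕜 ξ p) :
    ‖x‖ₑ = wnorm (S.family ξ) p fun n => ‖coord x n‖ₑ := by
  rw [enorm_def, familyENorm_eq_wnorm (S.empty_mem_family ξ)]

theorem schreierENorm_eq_wnorm (x : SchreierSpace S 𝕜 ξ p) (ζ : Ordinal.{0}) :
    x.schreierENorm ζ = wnorm (S.family ζ) ∞ fun n => ‖coord x n‖ₑ :=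
  familyENorm_eq_wnorm (S.empty_mem_family ζ) ∞ _

theorem enorm_coord_le (x : SchreierSpace S 𝕜 ξ p) (n : ℕ+) : ‖coord x n‖ₑ ≤ ‖x‖ₑ := by
  rw [enorm_def]
  exact enorm_le_familyENorm (S.mem_family_of_card_le_one ξ) hp.out (coord x) n

/-- The coordinate functionals. -/
noncomputable def coordCLM (n : ℕ+) : SchreierSpace S 𝕜 ξ p →L[𝕜] 𝕜 :=
  LinearMap.mkContinuous ((LinearMap.proj n).comp coordLinear) 1 fun x => by
    rw [one_mul]
    exact enorm_le_iff_norm_le.1 (enorm_coord_le x n)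

theorem coord_finsuppSum (u : ℕ+ → SchreierSpace S 𝕜 ξ p) (a : ℕ+ →₀ 𝕜) :
    coord (a.sum fun n t => t • u n) = ∑ k ∈ a.support, a k • coord (u k) := by
  change coordLinear _ = _
  rw [Finsupp.sum, map_sum]
  simp only [map_smul]
  rfl

theorem coord_basis (k : ℕ+) : coord (basis S 𝕜 ξ p k) = Pi.single k 1 := by
  change ⇑(Finsupp.single k (1 : 𝕜)) = _
  exact Finsupp.single_eq_pi_single k 1

/-- The norm of a combination of a subsequence of the canonical basis. -/
theorem enorm_finsuppSum_basis {ψ : ℕ+ → ℕ+} (hψ : StrictMono ψ) (a : ℕ+ →₀ 𝕜) :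
    ‖a.sum fun n t => t • (basis S 𝕜 ξ p ∘ ψ) n‖ₑ =
      wnorm {F | F.image ψ ∈ S.family ξ} p fun n => ‖a n‖ₑ := by
  classical
  rw [enorm_eq_wnorm, coord_finsuppSum]
  set v : ℕ+ → 𝕜 := ∑ k ∈ a.support, a k • coord ((basis S 𝕜 ξ p ∘ ψ) k) with hv
  have hvm : ∀ m, v m = ∑ k ∈ a.support, if m = ψ k then a k else 0 := fun m => by
    rw [hv, Finset.sum_apply]
    refine Finset.sum_congr rfl fun k _ => ?_
    rw [Pi.smul_apply, Function.comp_apply, coord_basis, Pi.single_apply]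
    simp
  have hvψ : ∀ n, v (ψ n) = a n := fun n => by
    rw [hvm]
    simp only [hψ.injective.eq_iff]
    rw [Finset.sum_ite_eq]
    simpa using fun h => h.symm
  have hv0 : ∀ m, (∀ n, ψ n ≠ m) → v m = 0 := fun m hm => by
    rw [hvm]
    exact Finset.sum_eq_zero fun k _ => if_neg fun h => hm k h.symm
  refine le_antisymm (wnorm_le fun E hE hlt => ?_) (wnorm_le fun F hF hlt => ?_)
  · let F : ℕ → Finset ℕ+ := fun l => (E l).preimage ψ hψ.injective.injOn
    have hFE : ∀ l, (F l).image ψ ⊆ E l := fun l m hm => by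
      obtain ⟨n, hn, rfl⟩ := Finset.mem_image.1 hm
      exact Finset.mem_preimage.1 hn
    refine le_trans (lpAgg_mono fun l => ?_) (lpAgg_le_wnorm _
      (fun l => (SchreierSystem.family_hereditary (hE l) (hFE l) : (F l).image ψ ∈ S.family ξ)) ?_)
    · have : ∑ m ∈ (F l).image ψ, ‖v m‖ₑ = ∑ m ∈ E l, ‖v m‖ₑ := by
        refine Finset.sum_subset (hFE l) fun m hm hm' => ?_
        rw [hv0 m, enorm_zero]
        rintro n rfl
        exact hm' (Finset.mem_image_of_mem ψ (Finset.mem_preimage.2 hm))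
      rw [← this, Finset.sum_image hψ.injective.injOn]
      exact Finset.sum_le_sum fun n _ => by rw [hvψ]
    · intro i j hij m hm n hn
      exact hψ.lt_iff_lt.1
        (hlt i j hij _ (Finset.mem_preimage.1 hm) _ (Finset.mem_preimage.1 hn))
  · refine le_trans (lpAgg_mono fun l => ?_) (lpAgg_le_wnorm _ hF ?_)
    · rw [Finset.sum_image hψ.injective.injOn]
      exact Finset.sum_le_sum fun n _ => by rw [hvψ]
    · intro i j hij m hm n hn
      obtain ⟨m', hm', rfl⟩ := Finset.mem_image.1 hm
      obtain ⟨n', hn', rfl⟩ := Finset.mem_image.1 hn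
      exact hψ (hlt i j hij m' hm' n' hn')

/-- The tails of an element of `X_{ξ,p}` tend to zero. -/
theorem eventually_tail_le (x : SchreierSpace S 𝕜 ξ p) {ε : ℝ≥0∞} (hε : ε ≠ 0) :
    ∀ᶠ h : ℕ+ in atTop,
      wnorm (S.family ξ) p (fun n => if h < n then ‖coord x n‖ₑ else 0) ≤ ε := by
  obtain ⟨y, hy⟩ : ∃ y : ℕ+ →₀ 𝕜, familyENorm (S.family ξ) p (coord x - ⇑y) < ε :=
    coord_mem x ε (pos_iff_ne_zero.2 hε)
  obtain ⟨M, hM⟩ := y.support.exists_le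
  filter_upwards [eventually_ge_atTop M] with h hh
  refine le_trans ?_ hy.le
  rw [familyENorm_eq_wnorm (S.empty_mem_family ξ)]
  refine wnorm_mono fun n => ?_
  split_ifs with hn
  · have : y n = 0 := by
      by_contra h0
      exact absurd ((hM n (Finsupp.mem_support_iff.2 h0)).trans hh) (not_le.2 hn)
    simp [this]
  · exact zero_le

theorem eventually_head_le {x : ℕ+ → SchreierSpace S 𝕜 ξ p}
    (hx : ∀ j, Tendsto (fun n => coord (x n) j) atTop (𝓝 0)) (L : ℕ+) {ε : ℝ≥0∞} (hε : ε ≠ 0) :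
    ∀ᶠ n in atTop, ∑ j ∈ Finset.Iic L, ‖coord (x n) j‖ₑ ≤ ε := by
  have : Tendsto (fun n => ∑ j ∈ Finset.Iic L, ‖coord (x n) j‖ₑ) atTop (𝓝 0) := by
    have h := tendsto_finsetSum (Finset.Iic L) fun j _ => (hx j).enorm
    simpa using h
  exact (this.eventually_lt_const (pos_iff_ne_zero.2 hε)).mono fun n hn => hn.le

/-- Passage to a subsequence that is a small perturbation of a sequence of blocks `z`. -/
theorem exists_block_subsequence {x : ℕ+ → SchreierSpace S 𝕜 ξ p}
    (hx : ∀ j, Tendsto (fun n => coord (x n) j) atTop (𝓝 0)) {L : ℕ+ → ℕ+} (hL : ∀ q, q ≤ L q)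
    {ε : ℕ+ → ℝ≥0∞} (hε : ∀ k, ε k ≠ 0) {R : ℕ+ → ℕ+ → Prop} {T : ℕ+ → ℕ+ → ℕ+ → Prop}
    (hR : ∀ q, ∃ᶠ n in atTop, R q n) (hT : ∀ q n, R q n → ∀ᶠ h in atTop, T q n h) :
    ∃ (φ q h idx : ℕ+ → ℕ+) (z : ℕ+ → ℕ+ → 𝕜), StrictMono φ ∧ StrictMono q ∧ StrictMono h ∧
      Monotone idx ∧ (∀ n k, idx n ≤ k ↔ n ≤ h k) ∧ (∀ k' k, k' < k → h k' ≤ q k) ∧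
      (∀ k, R (q k) (φ k)) ∧ (∀ k, T (q k) (φ k) (h k)) ∧
      (∀ k n, z k n = if L (q k) < n ∧ n ≤ h k then coord (x (φ k)) n else 0) ∧
      (∀ k n, L (q k) < n → n ≤ h k → idx n = k) ∧
      (∀ k, ∑ j ∈ Finset.Iic (L (q k)), ‖coord (x (φ k)) j‖ₑ ≤ ε (q k)) ∧
      ∀ k, familyENorm (S.family ξ) p (coord (x (φ k)) - z k) ≤ ε (q k) := by
  classical
  have hε2 : ∀ k, ε k / 2 ≠ 0 := fun k => (ENNReal.half_pos (hε k)).ne'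
  obtain ⟨φ, q, h, hφ, hq, hh, hRk, hTk, hqh, hqlt⟩ := exists_alternating_choice
    (R := fun q n => R q n ∧ ∑ j ∈ Finset.Iic (L q), ‖coord (x n) j‖ₑ ≤ ε q / 2)
    (T := fun q n h => T q n h ∧
      wnorm (S.family ξ) p (fun j => if h < j then ‖coord (x n) j‖ₑ else 0) ≤ ε q / 2)
    (fun q N => by
      obtain ⟨n, hn, h1, h2⟩ := ((hR q).and_eventually
        ((eventually_head_le hx (L q) (hε2 q)).and (eventually_gt_atTop N))).exists
      exact ⟨n, h2, hn, h1⟩)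
    (fun q n hn => by
      obtain ⟨h, ⟨h1, h2⟩, h3⟩ := (((hT q n hn.1).and (eventually_tail_le (x n) (hε2 q))).and
        (eventually_gt_atTop q)).exists
      exact ⟨h, h3, h1, h2⟩)
  obtain ⟨idx, hidx, hiff⟩ := exists_block_index hh
  have hhq : ∀ k' k, k' < k → h k' ≤ q k := fun k' k hk => by
    rw [← hqh]
    exact hq.monotone (PNat.add_one_le_iff.2 hk)
  refine ⟨φ, q, h, idx, fun k n => if L (q k) < n ∧ n ≤ h k then coord (x (φ k)) n else 0, hφ, hq,
    hh, hidx, hiff, hhq, fun k => (hRk k).1, fun k => (hTk k).1, fun k n => rfl, fun k n h1 h2 => ?_,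
    fun k => (hRk k).2.trans ENNReal.half_le_self, fun k => ?_⟩
  · refine le_antisymm ((hiff n k).2 h2) (not_lt.1 fun hlt => ?_)
    have h3 := (hiff n _).1 (le_refl (idx n))
    exact absurd (h3.trans (hhq _ _ hlt)) (not_le.2 ((hL _).trans_lt h1))
  · rw [familyENorm_eq_wnorm (S.empty_mem_family ξ), ← ENNReal.add_halves (ε (q k))]
    refine le_trans ?_ (add_le_add (hRk k).2 (hTk k).2)
    have hhead : wnorm (S.family ξ) p
        (fun j => if j ≤ L (q k) then ‖coord (x (φ k)) j‖ₑ else 0) ≤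
        ∑ j ∈ Finset.Iic (L (q k)), ‖coord (x (φ k)) j‖ₑ := by
      refine (wnorm_le_tsum _ hp.out _).trans_eq ?_
      rw [tsum_eq_sum (s := Finset.Iic (L (q k))) fun j hj => if_neg (by simpa using hj)]
      exact Finset.sum_congr rfl fun j hj => if_pos (by simpa using hj)
    refine le_trans (le_trans (wnorm_mono fun n => ?_) (wnorm_add_le _ hp.out _ _))
      (add_le_add_left hhead _)
    rw [Pi.sub_apply]
    by_cases h1 : L (q k) < n
    · by_cases h2 : n ≤ h k
      · simp [h1, h2]
      · simp [h1, h2, not_le.1 h2, not_le.2 h1]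
    · simp [h1, not_lt.1 h1]

/-- Small perturbations of blocks that are equivalent to a subsequence of the canonical basis. -/
theorem areEquivalent_of_blocks {δ : Ordinal.{0}} {ψ : ℕ+ → ℕ+} (hψ : StrictMono ψ)
    {u : ℕ+ → SchreierSpace S 𝕜 ξ p} {idx : ℕ+ → ℕ+} {z : ℕ+ → ℕ+ → 𝕜}
    (hz : ∀ k n, z k n ≠ 0 → idx n = k) {η c C : ℝ≥0∞} (hηc : η < c) (hc : c ≠ ∞) (hC : C ≠ ∞)
    (herr : ∑' k, familyENorm (S.family ξ) p (coord (u k) - z k) ≤ η)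
    (hup : ∀ A : ℕ+ → ℝ≥0∞, wnorm (S.family ξ) p (fun n => A (idx n) * ‖z (idx n) n‖ₑ) ≤
      C * wnorm {F | F.image ψ ∈ S.family δ} p A)
    (hlow : ∀ A : ℕ+ → ℝ≥0∞, c * wnorm {F | F.image ψ ∈ S.family δ} p A ≤
      wnorm (S.family ξ) p (fun n => A (idx n) * ‖z (idx n) n‖ₑ)) :
    AreEquivalent 𝕜 u (basis S 𝕜 δ p ∘ ψ) := by
  classical
  have hη : η ≠ ∞ := (hηc.trans_le le_top).ne
  have key : ∀ a : ℕ+ →₀ 𝕜,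
      ‖a.sum fun n t => t • u n‖ₑ ≤ (C + η) * ‖a.sum fun n t => t • (basis S 𝕜 δ p ∘ ψ) n‖ₑ ∧
      c * ‖a.sum fun n t => t • (basis S 𝕜 δ p ∘ ψ) n‖ₑ ≤
        ‖a.sum fun n t => t • u n‖ₑ + η * ‖a.sum fun n t => t • (basis S 𝕜 δ p ∘ ψ) n‖ₑ := by
    intro a
    rw [enorm_finsuppSum_basis hψ, enorm_def, coord_finsuppSum]
    set N := wnorm {F | F.image ψ ∈ S.family δ} p fun n => ‖a n‖ₑ with hN
    have hup' := hup fun n => ‖a n‖ₑ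
    have hlow' := hlow fun n => ‖a n‖ₑ
    -- Every coefficient is at most the norm N of the combination of basis vectors, so the total
    -- perturbation error is at most η N.
    have haN : ∀ k, ‖a k‖ₑ ≤ N := fun k => by
      have := sum_le_wnorm (𝓕 := {F | F.image ψ ∈ S.family δ}) (E := {k})
        (by simpa using S.empty_mem_family δ) hp.out (fun n => ‖a n‖ₑ)
        (by simpa using S.singleton_mem_family δ (ψ k))
      simpa using this
    set V : ℕ+ → 𝕜 := ∑ k ∈ a.support, a k • z k with hV
    set U : ℕ+ → 𝕜 := ∑ k ∈ a.support, a k • coord (u k) with hU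
    have hVn : ∀ n, ‖V n‖ₑ = ‖a (idx n)‖ₑ * ‖z (idx n) n‖ₑ := fun n => by
      rw [← enorm_mul, hV, Finset.sum_apply, Finset.sum_eq_single (idx n)]
      · rfl
      · intro k _ hk
        rw [Pi.smul_apply, smul_eq_mul, mul_eq_zero]
        right
        by_contra h
        exact hk (hz k n h).symm
      · intro h
        rw [Finsupp.notMem_support_iff.1 h]
        simp
    have hVN : familyENorm (S.family ξ) p V =
        wnorm (S.family ξ) p (fun n => ‖a (idx n)‖ₑ * ‖z (idx n) n‖ₑ) := by
      rw [familyENorm_eq_wnorm (S.empty_mem_family ξ)]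
      simp only [hVn]
    have hdiff : ∑ k ∈ a.support, familyENorm (S.family ξ) p (a k • (coord (u k) - z k)) ≤
        η * N := by
      calc _ ≤ ∑ k ∈ a.support, N * familyENorm (S.family ξ) p (coord (u k) - z k) := by
            refine Finset.sum_le_sum fun k _ => ?_
            rw [familyENorm_smul _ hp.out]
            exact mul_le_mul_left (haN k) _
        _ ≤ N * η := by
          rw [← Finset.mul_sum]
          exact mul_le_mul_right ((ENNReal.sum_le_tsum _).trans herr) _
        _ = η * N := mul_comm _ _
    set D : ℕ+ → 𝕜 := ∑ k ∈ a.support, a k • (coord (u k) - z k) with hD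
    have hDN : familyENorm (S.family ξ) p D ≤ η * N :=
      (familyENorm_sum_le (S.family ξ) hp.out a.support _).trans hdiff
    have hUV : U = V + D := by
      rw [hU, hV, hD, ← Finset.sum_add_distrib]
      exact Finset.sum_congr rfl fun k _ => by rw [smul_sub]; abel
    have hVU : V = U + (-1 : 𝕜) • D := by
      rw [hUV, neg_one_smul, add_neg_cancel_right]
    rw [← hN] at hup' hlow'
    clear_value U V D N
    have h1 : familyENorm (S.family ξ) p U ≤
        familyENorm (S.family ξ) p V + familyENorm (S.family ξ) p D :=
      hUV ▸ familyENorm_add_le _ hp.out _ _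
    have h2 : familyENorm (S.family ξ) p V ≤
        familyENorm (S.family ξ) p U + familyENorm (S.family ξ) p D := by
      have h := familyENorm_add_le (S.family ξ) hp.out U ((-1 : 𝕜) • D)
      rwa [← hVU, familyENorm_smul _ hp.out, enorm_neg, enorm_one, one_mul] at h
    rw [hVN] at h1 h2
    rw [add_mul]
    exact ⟨h1.trans (add_le_add hup' hDN), hlow'.trans (h2.trans (add_le_add_right hDN _))⟩
  have hCη : C + η ≠ ∞ := ENNReal.add_ne_top.2 ⟨hC, hη⟩
  -- The lower constant is positive because η < c; the added 1 makes the upper constant positive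
  -- even if C + η = 0.
  refine ⟨c.toReal - η.toReal, (C + η).toReal + 1, ?_, by positivity, fun a => ⟨?_, ?_⟩⟩
  · exact sub_pos.2 (ENNReal.toReal_strict_mono hc hηc)
  · have h := ENNReal.toReal_mono (by finiteness) (key a).2
    rw [ENNReal.toReal_add (by finiteness) (by finiteness), ENNReal.toReal_mul, ENNReal.toReal_mul,
      toReal_enorm, toReal_enorm] at h
    linarith
  · have h := ENNReal.toReal_mono (by finiteness) (key a).1
    rw [ENNReal.toReal_mul, toReal_enorm, toReal_enorm] at h
    refine h.trans ?_
    exact mul_le_mul_of_nonneg_right (le_add_of_nonneg_right zero_le_one) (norm_nonneg _)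

end SchreierSpace

/-! ### Subsequences equivalent to basis sequences. -/

theorem ENNReal.tendsto_zero_of_limsup_eq_zero {ι : Type*} {l : Filter ι} {u : ι → ℝ≥0∞}
    (h : limsup u l = 0) : Tendsto u l (𝓝 0) :=
  tendsto_of_le_liminf_of_limsup_le zero_le h.le

/-- Uniform boundedness for the images in the bidual. -/
theorem IsWeaklyNull.exists_enorm_le {𝕜 E : Type*} [RCLike 𝕜] [NormedAddCommGroup E]
    [NormedSpace 𝕜 E] {x : ℕ+ → E} (hx : IsWeaklyNull 𝕜 x) : ∃ C : ℝ≥0∞, C ≠ ∞ ∧ ∀ n, ‖x n‖ₑ ≤ C := by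
  have hb : ∀ f : E →L[𝕜] 𝕜, ∃ C, ∀ n, ‖NormedSpace.inclusionInDoubleDual 𝕜 E (x n) f‖ ≤ C := by
    intro f
    have h1 : Tendsto (fun k : ℕ => f (x k.succPNat)) atTop (𝓝 0) :=
      (hx f).comp (tendsto_atTop_mono (fun k => le_rfl) (OrderIso.pnatIsoNat.symm.tendsto_atTop))
    obtain ⟨C, hC⟩ := (Metric.isBounded_range_of_tendsto _ h1).exists_norm_le
    refine ⟨C, fun n => ?_⟩
    have := hC _ ⟨n.natPred, rfl⟩
    simpa using this
  obtain ⟨C, hC⟩ := banach_steinhaus hb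
  refine ⟨ENNReal.ofReal C, ENNReal.ofReal_ne_top, fun n => ?_⟩
  rw [← ofReal_norm]
  refine ENNReal.ofReal_le_ofReal ?_
  have h := (NormedSpace.inclusionInDoubleDualLi 𝕜 (E := E)).norm_map (x n)
  rw [← h]
  exact hC n

namespace SchreierSpace

variable {S : SchreierSystem} {𝕜 : Type*} [RCLike 𝕜] {ξ : Ordinal.{0}} {p : ℝ≥0∞}
  [hp : Fact (1 ≤ p)]

theorem tendsto_coord {x : ℕ+ → SchreierSpace S 𝕜 ξ p} (hx : IsWeaklyNull 𝕜 x) (j : ℕ+) :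
    Tendsto (fun n => coord (x n) j) atTop (𝓝 0) :=
  hx (coordCLM j)

theorem exists_pos_tsum_le {η : ℝ≥0∞} (hη : η ≠ 0) :
    ∃ ε : ℕ+ → ℝ≥0∞, (∀ k, ε k ≠ 0) ∧ ∑' k, ε k ≤ η := by
  obtain ⟨ε, hε, hs⟩ := ENNReal.exists_pos_sum_of_countable hη ℕ+
  exact ⟨fun k => ε k, fun k => ENNReal.coe_ne_zero.2 (hε k).ne', hs.le⟩

theorem enorm_blockFun {x : ℕ+ → SchreierSpace S 𝕜 ξ p} {φ h L : ℕ+ → ℕ+} {z : ℕ+ → ℕ+ → 𝕜}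
    (hz : ∀ k n, z k n = if L k < n ∧ n ≤ h k then coord (x (φ k)) n else 0) (k n : ℕ+) :
    ‖z k n‖ₑ ≤ ‖coord (x (φ k)) n‖ₑ := by
  rw [hz]
  split_ifs
  · exact le_rfl
  · simp

/-- A sequence that is small on `𝓢_ξ` but not norm null has a subsequence equivalent to the basis
of `ℓ_p`. -/
theorem exists_areEquivalent_basis_zero (hp' : p ≠ ∞) {x : ℕ+ → SchreierSpace S 𝕜 ξ p}
    (hx : IsWeaklyNull 𝕜 x) (hξ : Tendsto (fun n => (x n).schreierENorm ξ) atTop (𝓝 0))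
    (hnorm : ¬ Tendsto (fun n => ‖x n‖ₑ) atTop (𝓝 0)) :
    ∃ φ : ℕ+ → ℕ+, StrictMono φ ∧ AreEquivalent 𝕜 (x ∘ φ) (basis S 𝕜 0 p ∘ id) := by
  classical
  obtain ⟨C, hC, hxC⟩ := hx.exists_enorm_le
  obtain ⟨c, hc0, hc⟩ : ∃ c : ℝ≥0∞, 0 < c ∧ ∃ᶠ n in atTop, c < ‖x n‖ₑ := by
    have : 0 < limsup (fun n => ‖x n‖ₑ) atTop := pos_iff_ne_zero.2 fun h =>
      hnorm (ENNReal.tendsto_zero_of_limsup_eq_zero h)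
    obtain ⟨c, h0, h1⟩ := exists_between this
    exact ⟨c, h0, frequently_lt_of_lt_limsup (by isBoundedDefault) h1⟩
  have hctop : c ≠ ∞ := by
    obtain ⟨n, hn⟩ := hc.exists
    exact (hn.trans_le le_top).ne
  -- The bound 1 is the error budget of `wnorm_block_le`; c/4 keeps the perturbation below the lower
  -- constant c/2 of the blocks.
  have hη0 : min 1 (c / 2 / 2) ≠ 0 :=
    (lt_min one_pos (ENNReal.half_pos (ENNReal.half_pos hc0.ne').ne')).ne'
  obtain ⟨ε, hε0, hε⟩ := exists_pos_tsum_le hη0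
  obtain ⟨φ, q, h, idx, z, hφ, hq, hh, hidx, hiff, -, hR, -, hz, hzidx, -, herr⟩ :=
    exists_block_subsequence (tendsto_coord hx) (L := id) (fun _ => le_rfl) hε0
      (R := fun q n => c < ‖x n‖ₑ ∧ (x n).schreierENorm ξ ≤ ε q) (T := fun _ _ _ => True)
      (fun q => hc.and_eventually ((hξ.eventually_lt_const (pos_iff_ne_zero.2 (hε0 q))).mono
        fun n hn => hn.le)) (fun _ _ _ => Eventually.of_forall fun _ => trivial)
  have hεq : ∑' k, ε (q k) ≤ min 1 (c / 2 / 2) :=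
    (ENNReal.tsum_comp_le_tsum_of_injective hq.injective ε).trans hε
  have hεqk : ∀ k, ε (q k) ≤ c / 2 := fun k =>
    (ENNReal.le_tsum k).trans (hεq.trans ((min_le_right _ _).trans ENNReal.half_le_self))
  have hz0 : ∀ k n, z k n ≠ 0 → idx n = k := fun k n hzn => by
    rw [hz] at hzn
    by_contra hne
    exact hzn (if_neg fun h' => hne (hzidx k n h'.1 h'.2))
  have hblock : ∀ k n, (if idx n = k then ‖z (idx n) n‖ₑ else 0) = ‖z k n‖ₑ := fun k n => by
    split_ifs with hk
    · rw [hk]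
    · by_contra h0
      exact hk (hz0 k n fun h1 => h0 (by rw [h1, enorm_zero]))
  have hpull : {F : Finset ℕ+ | F.image id ∈ S.family 0} = {F | F.card ≤ 1} := by
    simp [SchreierSystem.family_zero]
  refine ⟨φ, hφ, areEquivalent_of_blocks strictMono_id (idx := idx) (z := z) hz0
    (η := c / 2 / 2) (c := c / 2) (C := 2 * C + 1)
    (ENNReal.half_lt_self (ENNReal.half_pos hc0.ne').ne' (by finiteness)) (by finiteness)
    (by finiteness) ?_ ?_ ?_⟩
  · exact (ENNReal.tsum_le_tsum fun k => herr k).trans (hεq.trans (min_le_right _ _))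
  · intro A
    rw [hpull]
    -- No exceptional blocks are needed (K = ∅): every set of 𝓢_ξ sees at most ε (q k) of block k,
    -- since ‖x_n‖_ξ → 0.
    refine wnorm_block_le (S.empty_mem_family ξ)
      (fun E hE F hF => SchreierSystem.family_hereditary hE hF) (by simp) (by simp) hp.out hidx
      (ε := fun k => ε (q k)) (fun k => ?_) (fun G hG => ⟨∅, by simp, by simp, fun k _ => ?_⟩)
      (hεq.trans (min_le_left _ _)) A
    · refine le_trans (wnorm_mono fun n => ?_) ((enorm_eq_wnorm (x (φ k))).symm.trans_le (hxC _))
      rw [hblock]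
      exact enorm_blockFun hz k n
    · simp only [hblock]
      refine le_trans ?_ (hR k).2
      rw [schreierENorm_eq_wnorm]
      exact (Finset.sum_le_sum fun n _ => enorm_blockFun hz k n).trans
        (sum_le_wnorm (S.empty_mem_family ξ) le_top _ hG)
  · intro A
    rw [hpull]
    refine (mul_le_mul_right (wnorm_le_lpAgg (fun E hE => hE) hp.out A) _).trans ?_
    refine le_wnorm_block_of_le_wnorm (S.empty_mem_family ξ)
      (fun E hE F hF => SchreierSystem.family_hereditary hE hF) hp.out hp' hidx (fun k => ?_)
      (fun k => ?_) A
    · exact (Set.finite_Iic (h k)).subset fun n hn => (hiff n k).1 hn.le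
    · simp only [hblock]
      rw [← familyENorm_eq_wnorm (S.empty_mem_family ξ)]
      have h1 := familyENorm_add_le (S.family ξ) hp.out (coord (x (φ k)) - z k) (z k)
      rw [sub_add_cancel, ← enorm_def] at h1
      have h2 : c ≤ c / 2 + familyENorm (S.family ξ) p (z k) :=
        (hR k).1.le.trans (h1.trans (add_le_add_left ((herr k).trans (hεqk k)) _))
      have hc2 : c / 2 ≠ ∞ := by finiteness
      rw [← ENNReal.add_le_add_iff_left hc2, ENNReal.add_halves]
      exact h2

/-- A piece in 𝓢_γ that has begun by q is controlled by one ζ < γ depending only on q, and ‖x_n‖_ζ →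
0. For γ = 0 such a piece has no points beyond q. -/
theorem eventually_forall_sum_le {γ : Ordinal.{0}} (hγ : γ < ω₁)
    {x : ℕ+ → SchreierSpace S 𝕜 ξ p}
    (hζ : ∀ ζ < γ, Tendsto (fun n => (x n).schreierENorm ζ) atTop (𝓝 0)) (q : ℕ+) {ε : ℝ≥0∞}
    (hε : ε ≠ 0) :
    ∀ᶠ n in atTop, ∀ E ∈ S.family γ, ∀ e ∈ E, e ≤ q →
      ∑ j ∈ E, (if q < j then ‖coord (x n) j‖ₑ else 0) ≤ ε := by
  rcases eq_or_ne γ 0 with rfl | h0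
  · refine Eventually.of_forall fun n E hE e he heq => ?_
    rw [Finset.sum_eq_zero]
    · exact zero_le
    · intro j hj
      rw [SchreierSystem.family_zero] at hE
      have : j = e := Finset.card_le_one.1 hE j hj e he
      exact if_neg (not_lt.2 (this ▸ heq))
  · obtain ⟨ζ, hζγ, hcov⟩ := S.exists_sum_le_wnorm hγ h0 q
    have hq0 : ((q : ℕ) : ℝ≥0∞) ≠ 0 := by simp
    have hqt : ((q : ℕ) : ℝ≥0∞) ≠ ∞ := ENNReal.natCast_ne_top _
    filter_upwards [(hζ ζ hζγ).eventually_lt_const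
      (pos_iff_ne_zero.2 (ENNReal.div_ne_zero.2 ⟨hε, hqt⟩))] with n hn E hE e he heq
    rw [schreierENorm_eq_wnorm] at hn
    refine (hcov E hE e he heq _).trans ?_
    rw [← ENNReal.mul_div_cancel hq0 hqt (b := ε)]
    refine mul_le_mul_right (le_trans (wnorm_mono fun j => ?_) hn.le) _
    split_ifs
    exacts [le_rfl, zero_le]

/-- A sequence that is small on `𝓢_ζ` for `ζ < γ` and not on `𝓢_γ` has a subsequence equivalent to a
subsequence of the canonical basis of `X_{δ,p}`, where `γ + δ = ξ`. -/
theorem exists_areEquivalent_basis {γ δ : Ordinal.{0}} (hγδ : γ + δ = ξ) (hξ : ξ < ω₁)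
    {x : ℕ+ → SchreierSpace S 𝕜 ξ p} (hx : IsWeaklyNull 𝕜 x)
    (hζ : ∀ ζ < γ, Tendsto (fun n => (x n).schreierENorm ζ) atTop (𝓝 0))
    (hγ : 0 < limsup (fun n => (x n).schreierENorm γ) atTop) :
    ∃ φ ψ : ℕ+ → ℕ+, StrictMono φ ∧ StrictMono ψ ∧
      AreEquivalent 𝕜 (x ∘ φ) (basis S 𝕜 δ p ∘ ψ) := by
  classical
  subst hγδ
  have hγ1 : γ < ω₁ := le_self_add.trans_lt hξ
  obtain ⟨f, hf, hfG⟩ := S.exists_decomposition γ δ hξ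
  obtain ⟨g, hg, hgK⟩ := S.exists_biUnion_mem γ δ hξ
  obtain ⟨C, hC, hxC⟩ := hx.exists_enorm_le
  obtain ⟨c, hc0, hc⟩ : ∃ c : ℝ≥0∞, 0 < c ∧ ∃ᶠ n in atTop, c < (x n).schreierENorm γ := by
    obtain ⟨c, h0, h1⟩ := exists_between hγ
    exact ⟨c, h0, frequently_lt_of_lt_limsup (by isBoundedDefault) h1⟩
  have hctop : c ≠ ∞ := by
    obtain ⟨n, hn⟩ := hc.exists
    exact (hn.trans_le le_top).ne
  -- The lower constant will be c/4: half of c may be lost with the head, and `le_wnorm_block` costs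
  -- a factor 2. The perturbation c/8 stays below it.
  have hη0 : min 1 (c / 2 / 2 / 2) ≠ 0 := (lt_min one_pos (ENNReal.half_pos
    (ENNReal.half_pos (ENNReal.half_pos hc0.ne').ne').ne')).ne'
  obtain ⟨ε, hε0, hε⟩ := exists_pos_tsum_le hη0
  have hqne : ∀ q : ℕ+, ((q : ℕ) : ℝ≥0∞) ≠ 0 := fun q => by simp
  have hqt : ∀ q : ℕ+, ((q : ℕ) : ℝ≥0∞) ≠ ∞ := fun q => ENNReal.natCast_ne_top _
  -- Blocks start beyond g (f q), the sparseness that the union lemma requires. The bound ε q / q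
  -- allows for up to q old pieces, and h lies beyond a set of 𝓢_γ on which the vector has mass at
  -- least c.
  obtain ⟨φ, q, h, idx, z, hφ, hq, hh, hidx, hiff, hhq, hR, hT, hz, hzidx, hhead, herr⟩ :=
    exists_block_subsequence (tendsto_coord hx) (L := fun q => g (f q))
      (fun q => hf.le_apply.trans hg.le_apply) hε0
      (R := fun q n => c < (x n).schreierENorm γ ∧ ∀ E ∈ S.family γ, ∀ e ∈ E, e ≤ q →
        ∑ j ∈ E, (if q < j then ‖coord (x n) j‖ₑ else 0) ≤ ε q / q)
      (T := fun _ n h => ∃ E ∈ S.family γ, (∀ e ∈ E, e ≤ h) ∧ c ≤ ∑ j ∈ E, ‖coord (x n) j‖ₑ)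
      (fun q => hc.and_eventually (eventually_forall_sum_le hγ1 hζ q
        (ENNReal.div_ne_zero.2 ⟨hε0 q, hqt q⟩)))
      (fun q n hn => by
        have hE : ∃ E ∈ S.family γ, c ≤ ∑ j ∈ E, ‖coord (x n) j‖ₑ := by
          by_contra! hcon
          refine absurd hn.1 (not_lt.2 ?_)
          rw [schreierENorm_eq_wnorm]
          exact wnorm_top_le fun E hE => (hcon E hE).le
        obtain ⟨E, hE, hcE⟩ := hE
        obtain ⟨M, hM⟩ := E.exists_le
        filter_upwards [eventually_ge_atTop M] with h hMh
        exact ⟨E, hE, fun e he => (hM e he).trans hMh, hcE⟩)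
  have hεq : ∑' k, ε (q k) ≤ min 1 (c / 2 / 2 / 2) :=
    (ENNReal.tsum_comp_le_tsum_of_injective hq.injective ε).trans hε
  have hεqk : ∀ k, ε (q k) ≤ c / 2 := fun k => (ENNReal.le_tsum k).trans (hεq.trans
    ((min_le_right _ _).trans (ENNReal.half_le_self.trans ENNReal.half_le_self)))
  have hz0 : ∀ k n, z k n ≠ 0 → idx n = k := fun k n hzn => by
    rw [hz] at hzn
    by_contra hne
    exact hzn (if_neg fun h' => hne (hzidx k n h'.1 h'.2))
  have hblock : ∀ k n, (if idx n = k then ‖z (idx n) n‖ₑ else 0) = ‖z k n‖ₑ := fun k n => by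
    split_ifs with hk
    · rw [hk]
    · by_contra h0
      exact hk (hz0 k n fun h1 => h0 (by rw [h1, enorm_zero]))
  have hψ : StrictMono (f ∘ h) := hf.comp hh
  refine ⟨φ, f ∘ h, hφ, hψ, areEquivalent_of_blocks hψ (idx := idx) (z := z) hz0
    (η := c / 2 / 2 / 2) (c := c / 2 / 2) (C := 2 * C + 1)
    (ENNReal.half_lt_self (ENNReal.half_pos (ENNReal.half_pos hc0.ne').ne').ne' (by finiteness))
    (by finiteness) (by finiteness) ?_ ?_ ?_⟩
  · exact (ENNReal.tsum_le_tsum fun k => herr k).trans (hεq.trans (min_le_right _ _))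
  · intro A
    refine wnorm_block_le (S.empty_mem_family _)
      (fun E hE F hF => SchreierSystem.family_hereditary hE hF)
      (by simpa using S.empty_mem_family δ)
      (fun n => by simpa using S.singleton_mem_family δ (f (h n))) hp.out hidx
      (ε := fun k => ε (q k)) (fun k => ?_) (fun G hG => ?_) (hεq.trans (min_le_left _ _)) A
    · refine le_trans (wnorm_mono fun n => ?_) ((enorm_eq_wnorm (x (φ k))).symm.trans_le (hxC _))
      rw [hblock]
      exact enorm_blockFun hz k n
    -- K consists of the blocks that contain the least element of some piece of G.
    · obtain ⟨τ, hτ, hτγ, hτδ⟩ := hfG G hG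
      refine ⟨(G.image τ).image idx, ?_, ?_, fun k hk => ?_⟩
      · have hex : ∀ k ∈ (G.image τ).image idx, ∃ t ∈ G.image τ, idx t = k := fun k hk =>
          Finset.mem_image.1 hk
        choose! t ht htk using hex
        have htmono : StrictMonoOn t ((G.image τ).image idx : Finset ℕ+) := fun k hk k' hk' hlt => by
          refine hidx.reflect_lt ?_
          rwa [htk k hk, htk k' hk']
        -- A minimum t in block k satisfies t ≤ h k, so passing from f t to f (h k) is a spreading.
        refine SchreierSystem.family_spread (ν := f ∘ t)
          (fun k hk k' hk' hlt => hf (htmono hk hk' hlt)) (hψ.strictMonoOn _)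
          (fun k hk => hf.monotone ((hiff _ _).1 (htk k hk).le))
          (SchreierSystem.family_hereditary hτδ fun m hm => ?_)
        obtain ⟨k, hk, rfl⟩ := Finset.mem_image.1 hm
        exact Finset.mem_image_of_mem f (ht k hk)
      · intro k hk
        simp only [Finset.mem_image] at hk
        obtain ⟨_, ⟨n, hn, rfl⟩, rfl⟩ := hk
        exact Finset.mem_image_of_mem idx (hτ n hn).1
      · simp only [hblock]
        -- If no piece begins in block k, the pieces meeting it begin in earlier blocks, hence at or
        -- before q k. There are at most q k of them, each seeing at most ε (q k) / q k.
        set D := (G.image τ).filter (· ≤ q k) with hD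
        have hDcard : D.card ≤ (q k : ℕ) := by
          have : D ⊆ Finset.Icc 1 (q k) := fun t ht => by
            simpa using (Finset.mem_filter.1 ht).2
          refine (Finset.card_le_card this).trans ?_
          simp
        have hle : ∀ n ∈ G, ‖z k n‖ₑ ≤ ∑ t ∈ D,
            if τ n = t then (if q k < n then ‖coord (x (φ k)) n‖ₑ else 0) else 0 := by
          intro n hn
          by_cases hzn : z k n = 0
          · simp [hzn]
          · have hnk : idx n = k := hz0 k n hzn
            have hLn : q k < n := by
              rw [hz] at hzn
              have : g (f (q k)) < n := by
                by_contra hcon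
                exact hzn (if_neg fun h' => hcon h'.1)
              exact (hf.le_apply.trans hg.le_apply).trans_lt this
            have hτn : idx (τ n) < k := by
              refine lt_of_le_of_ne (hnk ▸ hidx (hτ n hn).2.1) fun heq => hk ?_
              exact Finset.mem_image.2 ⟨_, Finset.mem_image_of_mem τ hn, heq⟩
            have hτq : τ n ≤ q k := ((hiff _ _).1 le_rfl).trans (hhq _ _ hτn)
            have hmem : τ n ∈ D := Finset.mem_filter.2 ⟨Finset.mem_image_of_mem τ hn, hτq⟩
            rw [Finset.sum_ite_eq, if_pos hmem, if_pos hLn]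
            exact enorm_blockFun (L := fun k => g (f (q k))) hz k n
        refine (Finset.sum_le_sum hle).trans ?_
        rw [Finset.sum_comm]
        have hterm : ∀ t ∈ D, ∑ n ∈ G, (if τ n = t then
            (if q k < n then ‖coord (x (φ k)) n‖ₑ else 0) else 0) ≤ ε (q k) / q k := by
          intro t ht
          rw [← Finset.sum_filter]
          obtain ⟨h1, h2⟩ := Finset.mem_filter.1 ht
          obtain ⟨n, hn, rfl⟩ := Finset.mem_image.1 h1
          exact (hR k).2 _ (hτγ (τ n)) (τ n)
            (Finset.mem_filter.2 ⟨(hτ n hn).1, (hτ n hn).2.2⟩) h2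
        refine (Finset.sum_le_sum hterm).trans ?_
        rw [Finset.sum_const, nsmul_eq_mul]
        refine (mul_le_mul_left (Nat.cast_le.2 hDcard) _).trans_eq ?_
        exact ENNReal.mul_div_cancel (hqne _) (hqt _)
  · intro A
    choose E hEγ hEh hcE using hT
    let E' : ℕ+ → Finset ℕ+ := fun k => (E k).filter fun j => g (f (q k)) < j
    have hE' : ∀ k, ∀ n ∈ E' k, n ∈ E k ∧ g (f (q k)) < n := fun k n hn => Finset.mem_filter.1 hn
    have hE'γ : ∀ k, E' k ∈ S.family γ := fun k =>
      SchreierSystem.family_hereditary (hEγ k) (Finset.filter_subset _ _)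
    have hE'idx : ∀ k, ∀ n ∈ E' k, idx n = k := fun k n hn =>
      hzidx k n (hE' k n hn).2 (hEh k n (hE' k n hn).1)
    have hE'lt : ∀ k k', k < k' → SetLT (E' k) (E' k') := fun k k' hkk a ha b hb => by
      refine hidx.reflect_lt ?_
      rwa [hE'idx k a ha, hE'idx k' b hb]
    have hE'sum : ∀ k, c / 2 ≤ ∑ n ∈ E' k, ‖z (idx n) n‖ₑ := by
      intro k
      have h1 : ∑ n ∈ E' k, ‖z (idx n) n‖ₑ = ∑ n ∈ E' k, ‖coord (x (φ k)) n‖ₑ := by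
        refine Finset.sum_congr rfl fun n hn => ?_
        rw [hE'idx k n hn, hz, if_pos ⟨(hE' k n hn).2, hEh k n (hE' k n hn).1⟩]
      have h2 : ∑ n ∈ (E k).filter (fun j => ¬ g (f (q k)) < j), ‖coord (x (φ k)) n‖ₑ ≤ c / 2 := by
        refine le_trans (Finset.sum_le_sum_of_subset fun n hn => ?_) ((hhead k).trans (hεqk k))
        simpa using (Finset.mem_filter.1 hn).2
      have hc2 : c / 2 ≠ ∞ := by finiteness
      rw [h1, ← ENNReal.add_le_add_iff_right hc2, ENNReal.add_halves]
      refine (hcE k).trans ?_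
      rw [← Finset.sum_filter_add_sum_filter_not (E k) fun j => g (f (q k)) < j]
      exact add_le_add_right h2 _
    have h2 := le_wnorm_block (𝓖 := {F | F.image (f ∘ h) ∈ S.family δ})
      (S.empty_mem_family (γ + δ)) hp.out hidx hE'idx (fun k => ?_) hE'sum
      (fun F hF hne => ?_) A
    · rw [ENNReal.mul_comm_div, ← mul_div_assoc]
      exact ENNReal.div_le_of_le_mul' h2
    -- Inclusion of 𝓢_γ in 𝓢_{γ+δ} holds only for sets far enough out. The union lemma with one set
    -- and the dummy marker 1 supplies it.
    · have := hgK {k} (fun _ => 1) E' (by simp) (by simpa using S.singleton_mem_family δ 1)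
        (fun k' _ => hE'γ k') (fun k' _ e he => ?_) (fun k' _ k'' _ hlt => hE'lt k' k'' hlt)
      · simpa using this
      · exact (hg.monotone one_le).trans (hE' k' e he).2.le
    -- The set E' k is marked by f (h (ν k)), with ν k the predecessor of k in F. Since h (ν k) ≤ q
    -- k and E' k lies beyond g (f (q k)), it is sparse enough, whereas its own mark f (h k) could
    -- be too large.
    · obtain ⟨ν, hν1, hν2⟩ := F.exists_pred hne
      refine hgK _ (f ∘ h ∘ ν) E' (fun k hk k' hk' hlt => hψ (hν2 hk hk' hlt))
        (SchreierSystem.family_hereditary (hF : F.image (f ∘ h) ∈ S.family δ) fun m hm => ?_)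
        (fun k _ => hE'γ k) (fun k hk e he => ?_) (fun k _ k' _ hlt => hE'lt k k' hlt)
      · obtain ⟨k, hk, rfl⟩ := Finset.mem_image.1 hm
        exact Finset.mem_image_of_mem (f ∘ h) (hν1 k hk).1
      · refine (hg.monotone (hf.monotone ?_)).trans (hE' k e he).2.le
        exact hhq _ _ (hν1 k hk).2

end SchreierSpace

/-! ### Spreading models under equivalence, subsequences and change of order. -/

section

variable {𝕜 : Type*} [RCLike 𝕜] {E F G : Type*} [NormedAddCommGroup E] [NormedSpace 𝕜 E]
  [NormedAddCommGroup F] [NormedSpace 𝕜 F] [NormedAddCommGroup G] [NormedSpace 𝕜 G]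

theorem IsWeaklyNull.comp {x : ℕ+ → E} (hx : IsWeaklyNull 𝕜 x) {φ : ℕ+ → ℕ+}
    (hφ : StrictMono φ) : IsWeaklyNull 𝕜 (x ∘ φ) := fun f =>
  (hx f).comp (tendsto_atTop_mono (fun _ => hφ.le_apply) tendsto_id)

theorem AreEquivalent.trans {x : ℕ+ → E} {y : ℕ+ → F} {z : ℕ+ → G} (h : AreEquivalent 𝕜 x y)
    (h' : AreEquivalent 𝕜 y z) : AreEquivalent 𝕜 x z := by
  obtain ⟨c, C, hc, hC, h⟩ := h
  obtain ⟨c', C', hc', hC', h'⟩ := h'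
  refine ⟨c * c', C * C', by positivity, by positivity, fun a => ⟨?_, ?_⟩⟩
  · rw [mul_assoc]
    exact (mul_le_mul_of_nonneg_left (h' a).1 hc.le).trans (h a).1
  · rw [mul_assoc]
    exact (h a).2.trans (mul_le_mul_of_nonneg_left (h' a).2 hC.le)

theorem IsL1SpreadingModel.comp {𝓕 𝓕' : Set (Finset ℕ+)} {x : ℕ+ → E}
    (hx : IsL1SpreadingModel 𝕜 𝓕 x) {ν : ℕ+ → ℕ+} (hν : Function.Injective ν)
    (h : ∀ A ∈ 𝓕', A.image ν ∈ 𝓕) : IsL1SpreadingModel 𝕜 𝓕' (x ∘ ν) := by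
  obtain ⟨⟨c₀, C₀, h0, hn⟩, c, hc, hA⟩ := hx
  refine ⟨⟨c₀, C₀, h0, fun n => hn (ν n)⟩, c, hc, fun A hA' a ha => ?_⟩
  have := hA _ (h A hA') (Function.extend ν a 0)
  simpa [Finset.sum_image hν.injOn, hν.extend_apply, ha] using this

/-- The finitely supported family that agrees with `a` on `A`. -/
noncomputable def restrictFinsupp (A : Finset ℕ+) (a : ℕ+ → 𝕜) : ℕ+ →₀ 𝕜 :=
  open scoped Classical in
  Finsupp.onFinset A (fun n => if n ∈ A then a n else 0) fun n hn => by
    by_contra h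
    exact hn (if_neg h)

theorem restrictFinsupp_sum (A : Finset ℕ+) (a : ℕ+ → 𝕜) (x : ℕ+ → E) :
    ((restrictFinsupp A a).sum fun n t => t • x n) = ∑ n ∈ A, a n • x n := by
  unfold restrictFinsupp
  rw [Finsupp.onFinset_sum _ fun n => zero_smul 𝕜 (x n)]
  exact Finset.sum_congr rfl fun n hn => by rw [if_pos hn]

theorem restrictFinsupp_apply_of_mem {A : Finset ℕ+} (a : ℕ+ → 𝕜) {n : ℕ+} (hn : n ∈ A) :
    restrictFinsupp A a n = a n := by
  simp [restrictFinsupp, hn]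

theorem restrictFinsupp_apply_of_notMem {A : Finset ℕ+} (a : ℕ+ → 𝕜) {n : ℕ+} (hn : n ∉ A) :
    restrictFinsupp A a n = 0 := by
  simp [restrictFinsupp, hn]

theorem AreEquivalent.exists_le_of_isL1SpreadingModel {𝓕 : Set (Finset ℕ+)} {x : ℕ+ → E}
    {y : ℕ+ → F} (h : AreEquivalent 𝕜 x y) (hx : IsL1SpreadingModel 𝕜 𝓕 x) :
    ∃ c : ℝ, 0 < c ∧ ∀ A ∈ 𝓕, ∀ a : ℕ+ → 𝕜, ∑ n ∈ A, ‖a n‖ = 1 → c ≤ ‖∑ n ∈ A, a n • y n‖ := by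
  obtain ⟨_, C, _, hC, h⟩ := h
  obtain ⟨-, c, hc, hA⟩ := hx
  refine ⟨c / C, by positivity, fun A hA' a ha => ?_⟩
  rw [div_le_iff₀' hC]
  have := (h (restrictFinsupp A a)).2
  rw [restrictFinsupp_sum, restrictFinsupp_sum] at this
  exact (hA A hA' a ha).trans this

theorem AreEquivalent.isL1SpreadingModel {𝓕 : Set (Finset ℕ+)} {x : ℕ+ → E} {y : ℕ+ → F}
    (h : AreEquivalent 𝕜 x y) (hx : ∃ C : ℝ, ∀ n, ‖x n‖ ≤ C) (h1 : ∀ n, {n} ∈ 𝓕)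
    (hy : ∃ c : ℝ, 0 < c ∧ ∀ A ∈ 𝓕, ∀ a : ℕ+ → 𝕜, ∑ n ∈ A, ‖a n‖ = 1 →
      c ≤ ‖∑ n ∈ A, a n • y n‖) : IsL1SpreadingModel 𝕜 𝓕 x := by
  obtain ⟨c, _, hc, _, h⟩ := h
  obtain ⟨C, hC⟩ := hx
  obtain ⟨c', hc', hy⟩ := hy
  have key : ∀ A ∈ 𝓕, ∀ a : ℕ+ → 𝕜, ∑ n ∈ A, ‖a n‖ = 1 → c * c' ≤ ‖∑ n ∈ A, a n • x n‖ := by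
    intro A hA a ha
    have := (h (restrictFinsupp A a)).1
    rw [restrictFinsupp_sum, restrictFinsupp_sum] at this
    exact (mul_le_mul_of_nonneg_left (hy A hA a ha) hc.le).trans this
  refine ⟨⟨c * c', C, by positivity, fun n => ⟨?_, hC n⟩⟩, c * c', by positivity, key⟩
  simpa using key {n} (h1 n) (fun _ => 1) (by simp)

/-- 𝓢_α is contained in 𝓢_β only beyond some m, so a spreading model of order β is shifted by m;
spreading keeps the shifted sets in 𝓢_α. -/
theorem IsOrdinalWeaklyNull.mono {S : SchreierSystem} {α β : Ordinal.{0}} (hβ : β < ω₁)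
    (h : α ≤ β) {x : ℕ+ → E} (hx : IsOrdinalWeaklyNull 𝕜 S α x) :
    IsOrdinalWeaklyNull 𝕜 S β x := by
  refine ⟨hx.1, fun ⟨φ, hφ, hsm⟩ => hx.2 ?_⟩
  obtain ⟨m, hm⟩ := S.family_almost_mono hβ h
  have hν : StrictMono fun n : ℕ+ => m + n := fun a b hab => by simpa using hab
  refine ⟨φ ∘ (m + ·), hφ.comp hν, hsm.comp hν.injective fun A hA => ?_⟩
  refine hm _ (SchreierSystem.image_mem_family hν hA) fun k hk => ?_
  obtain ⟨n, -, rfl⟩ := Finset.mem_image.1 hk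
  exact (PNat.lt_add_right m n).le

end

/-! ### Lower ℓ₁ estimates for the canonical bases. -/

theorem Ordinal.add_one_lt_omega_one {δ : Ordinal.{0}} (h : δ < ω₁) : δ + 1 < ω₁ :=
  (Cardinal.isSuccLimit_omega 1).add_one_lt h

/-- Along such a sequence each point dominates the ψ-image of its predecessor, so ψ can be undone by
a spreading after the least point is dropped. -/
theorem exists_sparse_sequence (ψ : ℕ+ → ℕ+) (hψ : StrictMono ψ) (m : ℕ+) :
    ∃ i : ℕ+ → ℕ+, StrictMono i ∧ (∀ j, m ≤ i j) ∧ ∀ j j', j < j' → ψ (i j) ≤ i j' := by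
  let i : ℕ+ → ℕ+ := fun j => PNat.recOn j m fun _ a => ψ a + 1
  have hi : ∀ j, i (j + 1) = ψ (i j) + 1 := fun j => by simp only [i, PNat.recOn_succ]
  have hmono : StrictMono i := PNat.strictMono_of_lt_add_one fun j => by
    rw [hi]
    exact PNat.lt_add_one_iff.2 hψ.le_apply
  refine ⟨i, hmono, fun j => ?_, fun j j' hj => ?_⟩
  · refine le_trans ?_ (hmono.monotone (one_le : 1 ≤ j))
    simp only [i, PNat.recOn_one, le_refl]
  · refine le_trans ?_ (hmono.monotone (PNat.add_one_le_iff.2 hj))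
    rw [hi]
    exact (PNat.lt_add_right _ _).le

namespace SchreierSpace

variable {S : SchreierSystem} {𝕜 : Type*} [RCLike 𝕜] {ξ : Ordinal.{0}} {p : ℝ≥0∞}
  [hp : Fact (1 ≤ p)]

/-- A weight of mass one that is small on a family has small norm for `p > 1`. -/
theorem exists_wnorm_le (hp1 : 1 < p) {c : ℝ≥0∞} (hc : c ≠ 0) (hc' : c ≠ ∞) :
    ∃ ε : ℝ≥0∞, ε ≠ 0 ∧ ∀ (𝓕 : Set (Finset ℕ+)) (w : ℕ+ → ℝ≥0∞), ∑' n, w n = 1 →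
      (∀ E ∈ 𝓕, ∑ n ∈ E, w n ≤ ε) → wnorm 𝓕 p w ≤ c := by
  by_cases hp' : p = ∞
  · subst hp'
    exact ⟨c, hc, fun 𝓕 w _ h => wnorm_top_le h⟩
  · have hr : 1 < p.toReal := by
      simpa using (ENNReal.toReal_lt_toReal ENNReal.one_ne_top hp').2 hp1
    -- The solution of ε^(p-1) = c^p: the p-th powers of the masses sum to at most ε^(p-1) times the
    -- total mass 1.
    refine ⟨c ^ (p.toReal / (p.toReal - 1)), ?_, fun 𝓕 w hw h => wnorm_le fun E hE hlt => ?_⟩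
    · rw [Ne, ENNReal.rpow_eq_zero_iff]
      simp [hc, hc']
    · rw [lpAgg_le_iff hp.out hp']
      refine (tsum_rpow_le hr.le fun i => h _ (hE i)).trans ?_
      rw [← ENNReal.rpow_mul, div_mul_cancel₀ _ (by linarith)]
      refine mul_le_of_le_one_right' ?_
      exact (tsum_sum_le_tsum hlt w).trans hw.le

/-- No subsequence of the canonical basis satisfies lower `ℓ₁` estimates on `𝓢_{δ+1}`. -/
theorem exists_norm_sum_basis_lt (hp1 : 1 < p) {δ δ' : Ordinal.{0}} (hδ : δ < ω₁) (hδ' : δ' ≤ δ)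
    {ψ : ℕ+ → ℕ+} (hψ : StrictMono ψ) {c : ℝ} (hc : 0 < c) :
    ∃ F ∈ S.family (δ + 1), ∃ a : ℕ+ → 𝕜, ∑ n ∈ F, ‖a n‖ = 1 ∧
      ‖∑ n ∈ F, a n • (basis S 𝕜 δ' p ∘ ψ) n‖ < c := by
  classical
  obtain ⟨m, hm⟩ := S.family_almost_mono (Ordinal.add_one_lt_omega_one hδ)
    (add_le_add_left hδ' 1)
  obtain ⟨i, hi, him, hiψ⟩ := exists_sparse_sequence ψ hψ m
  obtain ⟨ε, hε, hsmall⟩ := exists_wnorm_le hp1 (c := ENNReal.ofReal (c / 2))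
    (by simpa using hc) ENNReal.ofReal_ne_top
  -- The average is taken with ε/2, one half for the least point of a test set and one half for the
  -- rest.
  obtain ⟨F, hF, hFN, w, hw, hw1, hwE⟩ := S.exists_average (hδ'.trans_lt hδ) (N := Set.range i)
    (fun q => ⟨i (q + 1), ⟨q + 1, rfl⟩, (PNat.lt_add_one_iff.2 le_rfl).trans_le hi.le_apply⟩)
    (ENNReal.half_pos hε).ne'
  have hwt : ∀ n, w n ≠ ∞ := fun n =>
    ((ENNReal.le_tsum n).trans_lt (hw1 ▸ ENNReal.one_lt_top)).ne
  have hnorm : ∀ n, ‖((w n).toReal : 𝕜)‖ₑ = w n := fun n => by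
    rw [← ofReal_norm, RCLike.norm_ofReal, abs_of_nonneg ENNReal.toReal_nonneg,
      ENNReal.ofReal_toReal (hwt n)]
  refine ⟨F, hm F hF fun k hk => ?_, fun n => ((w n).toReal : 𝕜), ?_, ?_⟩
  · obtain ⟨j, rfl⟩ := hFN k hk
    exact him j
  · have : ∑ n ∈ F, w n = 1 := by rw [← hw1, tsum_eq_sum fun n hn => hw n hn]
    simp only [RCLike.norm_ofReal, abs_of_nonneg ENNReal.toReal_nonneg]
    rw [← ENNReal.toReal_sum fun n _ => hwt n, this, ENNReal.toReal_one]
  · rw [← restrictFinsupp_sum]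
    set b := restrictFinsupp F fun n => ((w n).toReal : 𝕜)
    have hb : ∀ n, ‖b n‖ₑ = w n := fun n => by
      by_cases hn : n ∈ F
      · rw [restrictFinsupp_apply_of_mem _ hn, hnorm]
      · rw [restrictFinsupp_apply_of_notMem _ hn, hw n hn, enorm_zero]
    have key : ‖b.sum fun n t => t • (basis S 𝕜 δ' p ∘ ψ) n‖ₑ ≤ ENNReal.ofReal (c / 2) := by
      rw [enorm_finsuppSum_basis hψ]
      simp only [hb]
      refine hsmall _ w hw1 fun E hE => ?_
      have hE' : E.image ψ ∈ S.family δ' := hE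
      have hEF : ∑ n ∈ E, w n = ∑ n ∈ E ∩ F, w n := by
        refine (Finset.sum_subset Finset.inter_subset_left fun n hn hn' => hw n fun h => ?_).symm
        exact hn' (Finset.mem_inter.2 ⟨hn, h⟩)
      rw [hEF]
      set D := E ∩ F
      have hDN : ∀ n ∈ D, n ∈ Set.range i := fun n hn => hFN n (Finset.mem_inter.1 hn).2
      rcases D.eq_empty_or_nonempty with h0 | hne
      · simp [h0]
      · rw [← Finset.add_sum_erase _ _ (D.min'_mem hne), ← ENNReal.add_halves ε]
        refine add_le_add ?_ (hwE _ ?_)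
        · simpa using hwE {D.min' hne} (S.singleton_mem_family δ' _)
        -- The ψ-images of the predecessors form a subset of ψ(E) ∈ 𝓢_{δ'}. Each is at most the
        -- point itself, so by spreading D without its least point is in 𝓢_{δ'}, where w is small.
        · obtain ⟨ν, hν1, hν2⟩ := D.exists_pred hne
          have h1 : (D.erase (D.min' hne)).image (ψ ∘ ν) ∈ S.family δ' := by
            refine SchreierSystem.family_hereditary hE' fun k hk => ?_
            obtain ⟨n, hn, rfl⟩ := Finset.mem_image.1 hk
            exact Finset.mem_image_of_mem ψ (Finset.mem_inter.1 (hν1 n hn).1).1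
          have h2 := SchreierSystem.family_spread (ν' := id)
            (fun a ha b hb hab => hψ (hν2 ha hb hab)) (strictMono_id.strictMonoOn _)
            (fun n hn => ?_) h1
          · simpa using h2
          · obtain ⟨h3, h4⟩ := hν1 n hn
            obtain ⟨j, hj⟩ := hDN _ h3
            obtain ⟨j', hj'⟩ := hDN n (Finset.mem_of_mem_erase hn)
            change ψ (ν n) ≤ n
            rw [← hj, ← hj'] at h4 ⊢
            exact hiψ j j' (hi.lt_iff_lt.1 h4)
    rw [← ofReal_norm, ENNReal.ofReal_le_ofReal_iff (by positivity)] at key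
    linarith

/-- The combinations of a subsequence of the canonical basis satisfy lower `ℓ₁` estimates. -/
theorem one_le_norm_sum_basis {δ : Ordinal.{0}} {ψ : ℕ+ → ℕ+} (hψ : StrictMono ψ) {A : Finset ℕ+}
    (hA : A ∈ S.family δ) {a : ℕ+ → 𝕜} (ha : ∑ n ∈ A, ‖a n‖ = 1) :
    1 ≤ ‖∑ n ∈ A, a n • (basis S 𝕜 δ p ∘ ψ) n‖ := by
  rw [← restrictFinsupp_sum]
  have h := sum_le_wnorm (𝓕 := {F | F.image ψ ∈ S.family δ}) (E := A)
    (by simpa using S.empty_mem_family δ) hp.out (fun n => ‖restrictFinsupp A a n‖ₑ)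
    (SchreierSystem.image_mem_family hψ hA)
  rw [← enorm_finsuppSum_basis hψ, Finset.sum_congr rfl fun n hn => by
    rw [restrictFinsupp_apply_of_mem a hn]] at h
  have h1 : ∑ n ∈ A, ‖a n‖ₑ = 1 := by
    simp only [← ofReal_norm]
    rw [← ENNReal.ofReal_sum_of_nonneg fun n _ => norm_nonneg _, ha, ENNReal.ofReal_one]
  rw [h1, ← ofReal_norm, ENNReal.one_le_ofReal] at h
  exact h

end SchreierSpace

/-! ### Weakly unconditionally Cauchy sequences. -/

theorem SchreierSystem.mem_family_one_of_card_le (S : SchreierSystem) {F : Finset ℕ+}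
    (hF : ∀ k ∈ F, F.card ≤ (k : ℕ)) : F ∈ S.family 1 := by
  classical
  have h01 : S.family 1 = schreierSucc (S.family 0) := by rw [← S.family_add_one, zero_add]
  rw [h01]
  have := schreierSucc_of_pieces (𝓕 := S.family 0) (fun i => {F.orderEmbOfFin rfl i})
    (fun i _ => S.singleton_mem_family 0 _)
    (fun i j hij a ha b hb => by
      rw [Finset.mem_singleton] at ha hb
      subst ha hb
      exact (F.orderEmbOfFin rfl).strictMono hij)
    (fun i k hk => by
      rw [Finset.mem_singleton] at hk
      subst hk
      exact hF _ (F.orderEmbOfFin_mem rfl i))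
  convert this
  ext k
  simp only [Finset.mem_biUnion, Finset.mem_univ, true_and, Finset.mem_singleton]
  have := Set.ext_iff.1 (F.range_orderEmbOfFin rfl) k
  simp only [Set.mem_range, Finset.mem_coe] at this
  rw [← this]
  simp only [eq_comm]

section

variable {𝕜 : Type*} [RCLike 𝕜] {E : Type*} [NormedAddCommGroup E] [NormedSpace 𝕜 E]

theorem IsWUC.exists_norm_sum_le {x : ℕ+ → E} (hx : IsWUC 𝕜 x) :
    ∃ C : ℝ, ∀ F : Finset ℕ+, ‖∑ n ∈ F, x n‖ ≤ C := by
  have hb : ∀ f : E →L[𝕜] 𝕜, ∃ C, ∀ F : Finset ℕ+,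
      ‖NormedSpace.inclusionInDoubleDual 𝕜 E (∑ n ∈ F, x n) f‖ ≤ C := by
    intro f
    refine ⟨∑' n, ‖f (x n)‖, fun F => ?_⟩
    rw [NormedSpace.dual_def, map_sum]
    exact (norm_sum_le _ _).trans ((hx f).sum_le_tsum F fun _ _ => norm_nonneg _)
  obtain ⟨C, hC⟩ := banach_steinhaus hb
  refine ⟨C, fun F => ?_⟩
  have h := (NormedSpace.inclusionInDoubleDualLi 𝕜 (E := E)).norm_map (∑ n ∈ F, x n)
  rw [← h]
  exact hC F

/-- For δ ≥ 1 the family contains, far out, intervals of any length N. The mean over one has norm at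
least c, but WUC bounds all finite sums and forces this norm below C/N. -/
theorem IsL1SpreadingModel.not_isWUC {S : SchreierSystem} {δ : Ordinal.{0}} (hδ : δ < ω₁)
    (h0 : δ ≠ 0) {x : ℕ+ → E} (hx : IsL1SpreadingModel 𝕜 (S.family δ) x) : ¬ IsWUC 𝕜 x := by
  intro hw
  obtain ⟨C, hC⟩ := hw.exists_norm_sum_le
  obtain ⟨-, c, hc, hA⟩ := hx
  obtain ⟨m, hm⟩ := S.family_almost_mono hδ (one_le_iff_ne_zero.2 h0)
  obtain ⟨N, hN⟩ : ∃ N : ℕ+, C / c < (N : ℕ) := by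
    obtain ⟨k, hk⟩ := exists_nat_gt (C / c)
    exact ⟨k.succPNat, hk.trans (by simp)⟩
  have hN0 : (0 : ℝ) < (N : ℕ) := by exact_mod_cast N.pos
  set M : ℕ+ := max m N
  set F : Finset ℕ+ := Finset.Ico M (M + N) with hF
  have hcard : F.card = N := by
    rw [hF, PNat.card_Ico, PNat.add_coe]
    simp
  have hFm : F ∈ S.family δ := by
    refine hm F (S.mem_family_one_of_card_le fun k hk => ?_) fun k hk => ?_
    · rw [hcard]
      exact (le_max_right m N).trans (Finset.mem_Ico.1 hk).1
    · exact (le_max_left _ _).trans (Finset.mem_Ico.1 hk).1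
  have h1 := hA F hFm (fun _ => ((N : ℕ) : 𝕜)⁻¹) (by
    rw [Finset.sum_const, hcard, norm_inv, RCLike.norm_natCast, nsmul_eq_mul]
    exact mul_inv_cancel₀ hN0.ne')
  rw [← Finset.smul_sum, norm_smul, norm_inv, RCLike.norm_natCast] at h1
  have h2 : c ≤ ((N : ℕ) : ℝ)⁻¹ * C := h1.trans (mul_le_mul_of_nonneg_left (hC F) (by positivity))
  rw [div_lt_iff₀ hc] at hN
  have h3 : (N : ℕ) * c ≤ C := by
    calc (N : ℕ) * c ≤ (N : ℕ) * (((N : ℕ) : ℝ)⁻¹ * C) := mul_le_mul_of_nonneg_left h2 hN0.le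
      _ = C := by field_simp
  linarith

/-- Unimodular coefficients align the values f (x n), so that the sum of their absolute values is a
single value of f. -/
theorem isWUC_of_norm_sum_le {x : ℕ+ → E} {C : ℝ}
    (hC : ∀ (F : Finset ℕ+) (a : ℕ+ → 𝕜), (∀ n, ‖a n‖ ≤ 1) → ‖∑ n ∈ F, a n • x n‖ ≤ C) :
    IsWUC 𝕜 x := by
  intro f
  choose a ha1 ha using fun n => RCLike.exists_norm_eq_mul_self (f (x n))
  refine summable_of_sum_le (c := ‖f‖ * C) (fun _ => norm_nonneg _) fun F => ?_
  have h1 : ((∑ n ∈ F, ‖f (x n)‖ : ℝ) : 𝕜) = f (∑ n ∈ F, a n • x n) := by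
    rw [map_sum, RCLike.ofReal_sum]
    exact Finset.sum_congr rfl fun n _ => by rw [ha, map_smul, smul_eq_mul]
  calc ∑ n ∈ F, ‖f (x n)‖ = ‖((∑ n ∈ F, ‖f (x n)‖ : ℝ) : 𝕜)‖ := by
        rw [RCLike.norm_ofReal, abs_of_nonneg (Finset.sum_nonneg fun _ _ => norm_nonneg _)]
    _ ≤ ‖f‖ * C := by
      rw [h1]
      exact (f.le_opNorm _).trans
        (mul_le_mul_of_nonneg_left (hC F a fun n => (ha1 n).le) (norm_nonneg _))

theorem exists_isWUC_comp_of_tendsto_zero {x : ℕ+ → E}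
    (hx : Tendsto (fun n => ‖x n‖ₑ) atTop (𝓝 0)) :
    ∃ ψ : ℕ+ → ℕ+, StrictMono ψ ∧ IsWUC 𝕜 (x ∘ ψ) := by
  obtain ⟨ε, hε0, hε⟩ := SchreierSpace.exists_pos_tsum_le one_ne_zero
  obtain ⟨ψ, q, -, hψ, hq, -, hR, -⟩ := exists_alternating_choice
    (R := fun q n => ‖x n‖ₑ ≤ ε q) (T := fun _ _ _ => True)
    (fun q N => by
      obtain ⟨n, h1, h2⟩ := ((hx.eventually_lt_const (pos_iff_ne_zero.2 (hε0 q))).and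
        (eventually_gt_atTop N)).exists
      exact ⟨n, h2, h1.le⟩)
    (fun q _ _ => ⟨q + 1, PNat.lt_add_one_iff.2 le_rfl, trivial⟩)
  have hsum : ∑' k, ‖x (ψ k)‖ₑ ≤ 1 := (ENNReal.tsum_le_tsum hR).trans
    ((ENNReal.tsum_comp_le_tsum_of_injective hq.injective ε).trans hε)
  have hs : Summable fun k => ‖x (ψ k)‖ := by
    simpa using ENNReal.summable_toReal (hsum.trans_lt ENNReal.one_lt_top).ne
  exact ⟨ψ, hψ, fun f => (hs.mul_left ‖f‖).of_nonneg_of_le (fun _ => norm_nonneg _)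
    fun k => f.le_opNorm _⟩

end

/-! ### The set Γ and the order of the spreading models. -/

namespace SchreierSpace

variable {S : SchreierSystem} {𝕜 : Type*} [RCLike 𝕜] {ξ : Ordinal.{0}} {p : ℝ≥0∞}
  [hp : Fact (1 ≤ p)]

theorem gammaSet_comp_subset (x : ℕ+ → SchreierSpace S 𝕜 ξ p) {φ : ℕ+ → ℕ+} (hφ : StrictMono φ) :
    gammaSet (x ∘ φ) ⊆ gammaSet x := by
  rintro ζ ⟨hζ, hpos⟩
  have hlim : Tendsto φ atTop atTop := tendsto_atTop_mono (fun _ => hφ.le_apply) tendsto_id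
  have h := hlim.limsup_comp_le_limsup (u := fun n => (x n).schreierENorm ζ)
    (by isBoundedDefault) (by isBoundedDefault)
  exact ⟨hζ, lt_of_lt_of_le hpos h⟩

theorem tendsto_of_notMem_gammaSet {x : ℕ+ → SchreierSpace S 𝕜 ξ p} {ζ : Ordinal.{0}}
    (hζ : ζ ≤ ξ) (h : ζ ∉ gammaSet x) :
    Tendsto (fun n => (x n).schreierENorm ζ) atTop (𝓝 0) :=
  ENNReal.tendsto_zero_of_limsup_eq_zero (nonpos_iff_eq_zero.1 (not_lt.1 fun h' => h ⟨hζ, h'⟩))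

theorem notMem_gammaSet_of_tendsto {x : ℕ+ → SchreierSpace S 𝕜 ξ p} {ζ : Ordinal.{0}}
    (h : Tendsto (fun n => (x n).schreierENorm ζ) atTop (𝓝 0)) : ζ ∉ gammaSet x := fun hζ =>
  hζ.2.ne' h.limsup_eq

theorem exists_isLeast_gammaSet {x : ℕ+ → SchreierSpace S 𝕜 ξ p} (h : gammaSet x ≠ ∅) :
    ∃ γ, IsLeast (gammaSet x) γ := by
  have hne := Set.nonempty_iff_ne_empty.2 h
  exact ⟨_, csInf_mem hne, fun _ hζ => csInf_le' hζ⟩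

/-- Beyond some m the sets of 𝓢_ζ belong to 𝓢_ξ, and each of the finitely many coordinates below m
is bounded by the norm. -/
theorem schreierENorm_le (hξ : ξ < ω₁) {ζ : Ordinal.{0}} (hζ : ζ ≤ ξ) :
    ∃ C : ℝ≥0∞, C ≠ ∞ ∧ ∀ x : SchreierSpace S 𝕜 ξ p, x.schreierENorm ζ ≤ C * ‖x‖ₑ := by
  classical
  obtain ⟨m, hm⟩ := S.family_almost_mono hξ hζ
  refine ⟨(Finset.Iio m).card + 1, by finiteness, fun x => ?_⟩
  rw [schreierENorm_eq_wnorm]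
  refine wnorm_top_le fun E hE => ?_
  rw [← Finset.sum_filter_add_sum_filter_not E (· < m), add_mul, one_mul]
  refine add_le_add ?_ ?_
  · calc ∑ n ∈ E.filter (· < m), ‖coord x n‖ₑ ≤ ∑ n ∈ Finset.Iio m, ‖x‖ₑ := by
          refine (Finset.sum_le_sum_of_subset fun n hn => ?_).trans
            (Finset.sum_le_sum fun n _ => enorm_coord_le x n)
          simpa using (Finset.mem_filter.1 hn).2
      _ = _ := by simp
  · rw [enorm_eq_wnorm]
    refine sum_le_wnorm (S.empty_mem_family ξ) hp.out _ (hm _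
      (SchreierSystem.family_hereditary hE (Finset.filter_subset _ _)) fun k hk => ?_)
    exact not_lt.1 (Finset.mem_filter.1 hk).2

theorem gammaSet_eq_empty_of_tendsto (hξ : ξ < ω₁) {x : ℕ+ → SchreierSpace S 𝕜 ξ p}
    (hx : Tendsto (fun n => ‖x n‖ₑ) atTop (𝓝 0)) : gammaSet x = ∅ := by
  refine Set.eq_empty_iff_forall_notMem.2 fun _ hζ => ?_
  obtain ⟨C, hC, hle⟩ := schreierENorm_le (S := S) (𝕜 := 𝕜) (p := p) hξ hζ.1
  have h1 := ENNReal.Tendsto.const_mul hx (Or.inr hC)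
  rw [mul_zero] at h1
  exact notMem_gammaSet_of_tendsto (tendsto_of_tendsto_of_tendsto_of_le_of_le
    tendsto_const_nhds h1 (fun _ => zero_le) fun n => hle (x n)) hζ

theorem enorm_eq_schreierENorm (x : SchreierSpace S 𝕜 ξ ∞) : ‖x‖ₑ = x.schreierENorm ξ :=
  enorm_def x

theorem tendsto_enorm_of_gammaSet_eq_empty (hp' : p = ∞) {x : ℕ+ → SchreierSpace S 𝕜 ξ p}
    (h : gammaSet x = ∅) : Tendsto (fun n => ‖x n‖ₑ) atTop (𝓝 0) := by
  subst hp'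
  simp only [enorm_eq_schreierENorm]
  exact tendsto_of_notMem_gammaSet le_rfl (h ▸ Set.notMem_empty ξ)

theorem exists_areEquivalent_of_isLeast (hξ : ξ < ω₁) {x : ℕ+ → SchreierSpace S 𝕜 ξ p}
    (hx : IsWeaklyNull 𝕜 x) {γ : Ordinal.{0}} (hγ : IsLeast (gammaSet x) γ) :
    ∃ φ ψ : ℕ+ → ℕ+, StrictMono φ ∧ StrictMono ψ ∧
      AreEquivalent 𝕜 (x ∘ φ) (basis S 𝕜 (ξ - γ) p ∘ ψ) :=
  exists_areEquivalent_basis (Ordinal.add_sub_cancel_of_le hγ.1.1) hξ hx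
    (fun _ hζ => tendsto_of_notMem_gammaSet (hζ.le.trans hγ.1.1) fun h =>
      absurd (hγ.2 h) (not_le.2 hζ)) hγ.1.2

/-- The key bound on the order of the spreading models of a weakly null sequence. -/
theorem isOrdinalWeaklyNull_add_one (hξ : ξ < ω₁) (hp1 : 1 < p)
    {x : ℕ+ → SchreierSpace S 𝕜 ξ p} (hx : IsWeaklyNull 𝕜 x) {δ : Ordinal.{0}} (hδ : δ < ω₁)
    (h : ∀ γ ∈ gammaSet x, ξ - γ ≤ δ) : IsOrdinalWeaklyNull 𝕜 S (δ + 1) x := by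
  refine ⟨hx, fun ⟨φ, hφ, hsm⟩ => ?_⟩
  have hnorm : ¬ Tendsto (fun n => ‖(x ∘ φ) n‖ₑ) atTop (𝓝 0) := fun hlim => by
    obtain ⟨⟨c, C, hc, hcn⟩, -⟩ := hsm
    obtain ⟨n, hn⟩ := ((tendsto_zero_iff_norm_tendsto_zero.1
      (tendsto_zero_iff_enorm_tendsto_zero.2 hlim)).eventually_lt_const hc).exists
    exact absurd (hcn n).1 (not_le.2 hn)
  have hx' := hx.comp hφ
  -- The spreading model is not norm null, so some subsequence behaves like a basis of order δ' ≤ δ.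
  -- The ℓ_p alternative, which arises when Γ is empty, counts as δ' = 0.
  obtain ⟨δ', φ', ψ, hδ', hφ', hψ, heq⟩ : ∃ (δ' : Ordinal.{0}) (φ' ψ : ℕ+ → ℕ+), δ' ≤ δ ∧
      StrictMono φ' ∧ StrictMono ψ ∧ AreEquivalent 𝕜 (x ∘ φ ∘ φ') (basis S 𝕜 δ' p ∘ ψ) := by
    by_cases hΓ : gammaSet (x ∘ φ) = ∅
    · have hp' : p ≠ ∞ := fun hp' => hnorm (tendsto_enorm_of_gammaSet_eq_empty hp' hΓ)
      obtain ⟨φ', hφ', heq⟩ := exists_areEquivalent_basis_zero hp' hx'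
        (tendsto_of_notMem_gammaSet le_rfl (hΓ ▸ Set.notMem_empty ξ)) hnorm
      exact ⟨0, φ', id, zero_le, hφ', strictMono_id, heq⟩
    · obtain ⟨γ, hγ⟩ := exists_isLeast_gammaSet hΓ
      obtain ⟨φ', ψ, hφ', hψ, heq⟩ := exists_areEquivalent_of_isLeast hξ hx' hγ
      exact ⟨ξ - γ, φ', ψ, h γ (gammaSet_comp_subset x hφ hγ.1), hφ', hψ, heq⟩
  have hsm' : IsL1SpreadingModel 𝕜 (S.family (δ + 1)) (x ∘ φ ∘ φ') :=
    hsm.comp hφ'.injective fun A hA => SchreierSystem.image_mem_family hφ' hA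
  obtain ⟨c, hc, hA⟩ := heq.exists_le_of_isL1SpreadingModel hsm'
  obtain ⟨F, hF, a, ha, hlt⟩ := exists_norm_sum_basis_lt (S := S) (𝕜 := 𝕜) hp1 hδ hδ' hψ hc
  exact absurd (hA F hF a ha) (not_le.2 hlt)

/-- The subsequence equivalent to basis vectors of X_{ξ-γ,p} inherits their lower ℓ₁ estimates on
𝓢_{ξ-γ}. -/
theorem not_isOrdinalWeaklyNull_of_isLeast (hξ : ξ < ω₁) {x : ℕ+ → SchreierSpace S 𝕜 ξ p}
    (hx : IsWeaklyNull 𝕜 x) {γ : Ordinal.{0}} (hγ : IsLeast (gammaSet x) γ) :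
    ¬ IsOrdinalWeaklyNull 𝕜 S (ξ - γ) x := by
  rintro ⟨-, h⟩
  obtain ⟨φ, ψ, hφ, hψ, heq⟩ := exists_areEquivalent_of_isLeast hξ hx hγ
  obtain ⟨C, hC, hxC⟩ := hx.exists_enorm_le
  refine h ⟨φ, hφ, heq.isL1SpreadingModel ⟨C.toReal, fun n => ?_⟩ (S.singleton_mem_family _)
    ⟨1, one_pos, fun A hA a ha => one_le_norm_sum_basis hψ hA ha⟩⟩
  rw [← toReal_enorm]
  exact ENNReal.toReal_mono hC (hxC _)

theorem enorm_finsuppSum_basis_zero (a : ℕ+ →₀ 𝕜) {ψ : ℕ+ → ℕ+} (hψ : StrictMono ψ) :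
    ‖a.sum fun n t => t • (basis S 𝕜 0 p ∘ ψ) n‖ₑ = lpAgg p fun n => ‖a n‖ₑ := by
  rw [enorm_finsuppSum_basis hψ]
  have h : ∀ F : Finset ℕ+, F.image ψ ∈ S.family 0 ↔ F.card ≤ 1 := fun F => by
    rw [SchreierSystem.family_zero, Set.mem_ofPred_eq,
      Finset.card_image_of_injective _ hψ.injective]
  exact le_antisymm (wnorm_le_lpAgg (fun E hE => (h E).1 hE) hp.out _)
    (lpAgg_le_wnorm_of_singleton (fun n => (h {n}).2 (by simp)) _)

theorem areEquivalent_basis_zero_lpBasis (hp' : p ≠ ∞) :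
    AreEquivalent 𝕜 (basis S 𝕜 0 p ∘ id) (lpBasis 𝕜 p) := by
  have hpos := toReal_pos_of_one_le hp.out hp'
  have key : ∀ a : ℕ+ →₀ 𝕜, ‖a.sum fun n t => t • (basis S 𝕜 0 p ∘ id) n‖ =
      ‖a.sum fun n t => t • lpBasis 𝕜 p n‖ := by
    intro a
    have h1 : (a.sum fun n t => t • lpBasis 𝕜 p n) =
        ∑ n ∈ a.support, lp.single p n (a n) := by
      refine Finset.sum_congr rfl fun n _ => ?_
      change a n • lp.single (E := fun _ : ℕ+ => 𝕜) p n 1 = _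
      rw [← lp.single_smul, smul_eq_mul, mul_one]
    have h2 := lp.norm_sum_single (E := fun _ : ℕ+ => 𝕜) hpos a a.support
    have h3 := lpAgg_rpow hp.out hp' fun n => ‖a n‖ₑ
    rw [← enorm_finsuppSum_basis_zero (S := S) a strictMono_id, tsum_eq_sum (s := a.support)
      fun n hn => by rw [Finsupp.notMem_support_iff.1 hn, enorm_zero,
        ENNReal.zero_rpow_of_pos hpos]] at h3
    have h4 := congrArg ENNReal.toReal h3
    rw [← ENNReal.toReal_rpow, toReal_enorm, ENNReal.toReal_sum fun n _ =>
      ENNReal.rpow_ne_top_of_nonneg hpos.le enorm_ne_top] at h4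
    simp only [← ENNReal.toReal_rpow, toReal_enorm] at h4
    rw [h1]
    rw [← h2] at h4
    exact (Real.rpow_left_inj (norm_nonneg _) (norm_nonneg _) hpos.ne').1 h4
  exact ⟨1, 1, one_pos, one_pos, fun a => by rw [key, one_mul]; exact ⟨le_rfl, le_rfl⟩⟩

/-- For p = ∞ the space of order 0 has the sup norm, so combinations with coefficients bounded by 1
are uniformly bounded. -/
theorem _root_.AreEquivalent.isWUC_of_basis_zero {E : Type*} [NormedAddCommGroup E]
    [NormedSpace 𝕜 E] (hp' : p = ∞) {x : ℕ+ → E} {ψ : ℕ+ → ℕ+} (hψ : StrictMono ψ)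
    (h : AreEquivalent 𝕜 x (basis S 𝕜 0 p ∘ ψ)) : IsWUC 𝕜 x := by
  subst hp'
  obtain ⟨_, C, _, hC, h⟩ := h
  refine isWUC_of_norm_sum_le (C := C) fun F a ha => ?_
  rw [← restrictFinsupp_sum]
  refine (h _).2.trans (mul_le_of_le_one_right hC.le ?_)
  rw [← toReal_enorm, enorm_finsuppSum_basis_zero _ hψ]
  refine ENNReal.toReal_le_of_le_ofReal zero_le_one ?_
  simp only [lpAgg, if_true, ENNReal.ofReal_one]
  refine iSup_le fun n => ?_
  by_cases hn : n ∈ F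
  · rw [restrictFinsupp_apply_of_mem _ hn, ← ofReal_norm, ENNReal.ofReal_le_one]
    exact ha n
  · rw [restrictFinsupp_apply_of_notMem _ hn]
    simp

end SchreierSpace

/-! ### The main theorem. -/

open SchreierSpace in
theorem mainTheorem9 (S : SchreierSystem) {𝕜 : Type*} [RCLike 𝕜] (ξ : Ordinal.{0}) (hξ : ξ < ω₁)
    (p : ℝ≥0∞) [Fact (1 ≤ p)] (hp : 1 < p) (x : ℕ+ → SchreierSpace S 𝕜 ξ p)
    (hx : IsWeaklyNull 𝕜 x) :
    (p = ∞ → (gammaSet x = ∅ ↔ Tendsto (fun n => ‖x n‖) atTop (𝓝 0))) ∧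
    (p < ∞ → gammaSet x = ∅ →
      Tendsto (fun n => ‖x n‖) atTop (𝓝 0) ∨
      ∃ φ : ℕ+ → ℕ+, StrictMono φ ∧ AreEquivalent 𝕜 (x ∘ φ) (lpBasis 𝕜 p)) ∧
    (∀ γ, IsLeast (gammaSet x) γ →
      (∃ φ ψ : ℕ+ → ℕ+, StrictMono φ ∧ StrictMono ψ ∧
        AreEquivalent 𝕜 (x ∘ φ) (SchreierSpace.basis S 𝕜 (ξ - γ) p ∘ ψ)) ∧
      IsOrdinalWeaklyNull 𝕜 S (ξ - γ + 1) x ∧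
      ¬ IsOrdinalWeaklyNull 𝕜 S (ξ - γ) x) ∧
    (p = ∞ →
      ((∀ φ : ℕ+ → ℕ+, StrictMono φ → ∃ ψ : ℕ+ → ℕ+, StrictMono ψ ∧ IsWUC 𝕜 (x ∘ φ ∘ ψ)) ↔
        gammaSet x ⊆ {ξ})) ∧
    (0 < ξ →
      (IsOrdinalWeaklyNull 𝕜 S ξ x ↔
        ∀ β < leadingPower ξ, Tendsto (fun n => (x n).schreierENorm β) atTop (𝓝 0))) := by
  have hlt : ∀ γ, ξ - γ < ω₁ := fun γ => (Ordinal.sub_le_self ξ γ).trans_lt hξ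
  have hnorm : Tendsto (fun n => ‖x n‖) atTop (𝓝 0) ↔ Tendsto (fun n => ‖x n‖ₑ) atTop (𝓝 0) := by
    rw [← tendsto_zero_iff_norm_tendsto_zero, tendsto_zero_iff_enorm_tendsto_zero]
  refine ⟨fun hp' => ?_, fun hp' hΓ => ?_, fun γ hγ => ⟨exists_areEquivalent_of_isLeast hξ hx hγ,
    isOrdinalWeaklyNull_add_one hξ hp hx (hlt γ) fun γ' hγ' => ?_,
    not_isOrdinalWeaklyNull_of_isLeast hξ hx hγ⟩, fun hp' => ⟨fun h ζ hζ => ?_, fun h φ hφ => ?_⟩,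
    fun hξ0 => ⟨fun h β hβ => ?_, fun h => ?_⟩⟩
  · rw [hnorm]
    exact ⟨tendsto_enorm_of_gammaSet_eq_empty hp', gammaSet_eq_empty_of_tendsto hξ⟩
  · rw [hnorm, or_iff_not_imp_left]
    intro hn
    obtain ⟨φ, hφ, heq⟩ := exists_areEquivalent_basis_zero hp'.ne hx
      (tendsto_of_notMem_gammaSet le_rfl (hΓ ▸ Set.notMem_empty ξ)) hn
    exact ⟨φ, hφ, heq.trans (areEquivalent_basis_zero_lpBasis hp'.ne)⟩
  -- The map γ ↦ ξ - γ is decreasing, so the least element of Γ gives the largest order.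
  · rw [Ordinal.sub_le]
    exact (Ordinal.le_add_sub ξ γ).trans (add_le_add_left (hγ.2 hγ') _)
  · obtain ⟨γ, hγ⟩ := exists_isLeast_gammaSet (Set.nonempty_iff_ne_empty.1 ⟨ζ, hζ⟩)
    by_contra hne
    have hγξ : γ < ξ := (hγ.2 hζ).trans_lt (lt_of_le_of_ne hζ.1 hne)
    -- If γ < ξ, some subsequence is a spreading model of order ξ - γ ≥ 1, and so is each of its
    -- subsequences; none of them is WUC.
    refine not_isOrdinalWeaklyNull_of_isLeast hξ hx hγ ⟨hx, fun ⟨φ, hφ, hsm⟩ => ?_⟩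
    obtain ⟨ψ, hψ, hwuc⟩ := h φ hφ
    exact IsL1SpreadingModel.not_isWUC (hlt γ) (Ordinal.sub_ne_zero_iff_lt.2 hγξ)
      (hsm.comp hψ.injective fun A hA => SchreierSystem.image_mem_family hψ hA) hwuc
  · have hsub := gammaSet_comp_subset x hφ
    by_cases hΓ : gammaSet (x ∘ φ) = ∅
    · obtain ⟨ψ, hψ, hwuc⟩ := exists_isWUC_comp_of_tendsto_zero (𝕜 := 𝕜)
        (tendsto_enorm_of_gammaSet_eq_empty hp' hΓ)
      exact ⟨ψ, hψ, hwuc⟩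
    · obtain ⟨γ, hγ⟩ := exists_isLeast_gammaSet hΓ
      obtain ⟨ψ, ψ', hψ, hψ', heq⟩ := exists_areEquivalent_of_isLeast hξ (hx.comp hφ) hγ
      have hγξ : γ = ξ := h (hsub hγ.1)
      rw [hγξ, Ordinal.sub_self] at heq
      have hwuc := heq.isWUC_of_basis_zero hp' hψ'
      exact ⟨ψ, hψ, hwuc⟩
  · have hle : leadingPower ξ ≤ ξ := by
      rw [leadingPower, if_neg hξ0.ne']
      exact Ordinal.opow_log_le_self ω hξ0.ne'
    by_contra hcon
    have hβΓ : β ∈ gammaSet x := by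
      by_contra hβΓ
      exact hcon (tendsto_of_notMem_gammaSet (hβ.le.trans hle) hβΓ)
    obtain ⟨γ, hγ⟩ := exists_isLeast_gammaSet (Set.nonempty_iff_ne_empty.1 ⟨β, hβΓ⟩)
    have hγlt : γ < leadingPower ξ := (hγ.2 hβΓ).trans_lt hβ
    -- Ordinals below the leading power ω^ε₁ are absorbed: γ + ξ = ξ.
    have hγξ : ξ - γ = ξ := by
      rw [leadingPower, if_neg hξ0.ne'] at hγlt
      exact Ordinal.sub_eq_of_add_eq
        (Ordinal.add_of_omega0_opow_le hγlt (Ordinal.opow_log_le_self ω hξ0.ne'))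
    have hnot := not_isOrdinalWeaklyNull_of_isLeast hξ hx hγ
    rw [hγξ] at hnot
    exact hnot h
  -- Here Γ lies above λ(ξ), so all orders ξ - γ are at most ξ - λ(ξ). This removes one leading term
  -- and is less than ξ, so its successor is at most ξ.
  · have hsub : ξ - leadingPower ξ < ξ := by
      rw [leadingPower, if_neg hξ0.ne']
      exact Ordinal.sub_omega0_opow_log_lt hξ0.ne'
    refine (isOrdinalWeaklyNull_add_one hξ hp hx (hlt (leadingPower ξ)) fun γ hγ => ?_).mono hξ
      (add_one_le_of_lt hsub)
    have hγle : leadingPower ξ ≤ γ := not_lt.1 fun hlt' => notMem_gammaSet_of_tendsto (h γ hlt') hγ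
    rw [Ordinal.sub_le]
    exact (Ordinal.le_add_sub ξ _).trans (add_le_add_left hγle _)
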